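/- **Setting.** Let $n\ge 3$, $R>0$, and let $V$ be either $\mathbb S^{n-1}$ (with surface measure $dv$) or an open subset of $\mathbb R^n$ with $\inf_{v\in V}|v|>0$ (with Lebesgue measure $dv$). Write $\hat v=v/|v|$, $xy$ for the scalar product, $\Pi_v(R)=\{x\in\mathbb R^n: xv=0,\ |x|<R\}$, and $$O=\{(x,v)\in\mathbb R^n\times V: |x\hat v|<R,\ |x-(x\hat v)\hat v|<R\},\quad F=\{(x,v): v\in V,\ x\in\Pi_v(R)\},\quad F_\pm=\{(x\pm R\hat v,v):(x,v)\in F\}.$$ $L^1(F_\pm)$ is the $L^1$ space for the norm $\int_V\int_{\Pi_v(R)}|v|\,|f(x\pm R\hat v,v)|\,dx\,dv$. Let $X\subset\mathbb R^n$ be open and convex with $C^1$ boundary and $\bar X\subset\{|x|<R\}$. Let $(\sigma,k)$ and $(\tilde\sigma,\tilde k)$ be two pairs of coefficients, each satisfying the following (stated for $(\sigma,k)$). 1. (Admissibility) $0\le\sigma\in L^\infty(\mathbb R^n\times V)$; $k(x,v',v)$ is measurable on $\mathbb R^n\times V\times V$; $\sigma(x,v)=k(x,v',v)=0$ for $|x|>R$;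 $0\le k(x,v',\cdot)\in L^1(V)$ for a.e. $(x,v')$; and $\sigma_p(x,v'):=\int_V k(x,v',v)\,dv$ belongs to $L^\infty(\mathbb R^n\times V)$. 2. (Subcriticality) $I+K$ has a bounded inverse on $L^1(O,|v|\,dx\,dv)$, where, for $(x,v)\in O$, $$Kf(x,v)=-|v|^{-1}\int_0^{R+x\hat v}e^{-|v|^{-1}\int_0^t\sigma(x-s\hat v,v)ds}\int_V k(x-t\hat v,v',v)f(x-t\hat v,v')\,dv'\,dt.$$ 3. (Continuity) $\sigma\ge0$ is continuous and bounded on $X\times V$, $k\ge 0$ is continuous and bounded on $X\times V\times V$, and $\sigma(x,v)=k(x,v',v)=0$ for $x\notin\bar X$. For $f_-\in L^1(F_-)$ put $$Jf_-(x,v)=e^{-|v|^{-1}\int_0^{R+x\hat v}\sigma(x-s\hat v,v)ds}f_-(x-(x\hat v+R)\hat v,v),\qquad (x,v)\in O.$$ The albedo operator $\mathcal A$ maps $f_-$ to the trace $f_{|F_+}$ of the solution $f\in L^1(O,|v|\,dx\,dv)$ of $(I+K)f=Jf_-$, which is the integral form of the transport equation $v\nabla_xf+\sigma f-\int_Vk(x,v',v)f(x,v')dv'=0$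 in $O$, $f_{|F_-}=f_-$. Here the trace is taken along almost every line $t\mapsto(x+t\hat v,v)$, $(x,v)\in F$: it is the value at $t=R$ of the representative of $f$ that is continuous in $t\in[-R,R]$. Let $\tilde{\mathcal A}$ be the albedo operator of $(\tilde\sigma,\tilde k)$. For $x\in\mathbb R^n$, $t\in\mathbb R$, $v,v'\in V$ let $$E(x,t,v,v')=\exp\Big(-|v|^{-1}\int_{-R}^t\sigma(x-s\hat v,v)ds-|v'|^{-1}\int_0^{R+(x-t\hat v)\hat v'}\sigma(x-t\hat v-s\hat v',v')ds\Big),$$ and let $\tilde E$ be the same expression with $\tilde\sigma$ in place of $\sigma$. **Theorem.** Each of $(\sigma,k)$, $(\tilde\sigma,\tilde k)$ has a unique albedo operator, and $\mathcal A,\tilde{\mathcal A}$ are bounded from $L^1(F_-)$ to $L^1(F_+)$. For every $(x_0',v_0')\in F$ such that the line $\{x_0'+tv_0':t\in\mathbb R\}$ meets $X$, $$\left|e^{-|v_0'|^{-1}\int_{-R}^R\sigma(x_0'-s\hat v_0',v_0')ds}-e^{-|v_0'|^{-1}\int_{-R}^R\tilde\sigma(x_0'-s\hat v_0',v_0')ds}\right|\le\|\mathcal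 A-\tilde{\mathcal A}\|_{\mathcal L(L^1(F_-),L^1(F_+))},$$ and $$|v_0'|^{-1}\int_V\int_{-R}^R\big|(k-\tilde k)(x_0'+t'\hat v_0',v_0',v)\big|\,E\big(x(t',v),t(t',v),v,v_0'\big)\,dt'\,dv$$ $$\le 2R|v_0'|^{-1}\,\|\tilde\sigma_p(x_0'+t'\hat v_0',v_0')\|_{L^\infty(\mathbb R_{t'})}\sup_{(x,v)\in F,\ t\in\mathbb R}\big|(E-\tilde E)(x,t,v,v_0')\big|+\|\mathcal A-\tilde{\mathcal A}\|_{\mathcal L(L^1(F_-),L^1(F_+))},$$ where $t(t',v)=-(x_0'+t'\hat v_0')\hat v$ and $x(t',v)=x_0'+t'\hat v_0'-((x_0'+t'\hat v_0')\hat v)\hat v$. -/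

import Mathlib

open MeasureTheory Set Metric
open scoped ENNReal RealInnerProductSpace

noncomputable section

namespace Transport

/-- Euclidean space `ℝⁿ`. -/
abbrev Space (n : ℕ) : Type := EuclideanSpace ℝ (Fin n)

/-- The velocity domain: either the unit sphere or an open subset of `ℝⁿ` whose elements have
norms bounded away from zero. -/
inductive VelocityDomain (n : ℕ) : Type
  | unitSphere : VelocityDomain n
  | openSet (U : Set (Space n)) (isOpen : IsOpen U) (away : ∃ c > 0, ∀ v ∈ U, c ≤ ‖v‖) :
      VelocityDomain n

/-- The velocity domain as a set of vectors. -/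
def VelocityDomain.carrier {n : ℕ} : VelocityDomain n → Set (Space n)
  | .unitSphere => sphere 0 1
  | .openSet U _ _ => U

/-- The measure `dv`, as a measure on `ℝⁿ` concentrated on the velocity domain: surface measure
on the sphere, Lebesgue measure on an open set. -/
def VelocityDomain.measure {n : ℕ} : VelocityDomain n → Measure (Space n)
  | .unitSphere => ((volume : Measure (Space n)).toSphere).map Subtype.val
  | .openSet U _ _ => volume.restrict U

variable {n : ℕ}

/-- The direction `v̂ = v / |v|`. -/
def dir (v : Space n) : Space n := ‖v‖⁻¹ • v

/-- The component of `x` orthogonal to `v`, that is `x - (x · v̂) v̂`. -/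
def perp (v x : Space n) : Space n := x - ⟪x, dir v⟫ • dir v

/-- The phase space `O`: pairs `(x, v)` with `v ∈ V`, `|x · v̂| < R`, `|x - (x · v̂) v̂| < R`. -/
def phaseSpace (R : ℝ) (V : VelocityDomain n) : Set (Space n × Space n) :=
  {p | p.2 ∈ V.carrier ∧ |⟪p.1, dir p.2⟫| < R ∧ ‖perp p.2 p.1‖ < R}

/-- The measure `|v| dx dv` on `O`. -/
def phaseMeasure (R : ℝ) (V : VelocityDomain n) : Measure (Space n × Space n) :=
  (((volume : Measure (Space n)).prod V.measure).restrict (phaseSpace R V)).withDensity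
    (fun p => ‖p.2‖ₑ)

/-- The space `L¹(O, |v| dx dv)`. -/
abbrev L1O (R : ℝ) (V : VelocityDomain n) : Type := Lp ℝ 1 (phaseMeasure R V)

/-- The set `F` of pairs `(x, v)` with `v ∈ V`, `x · v = 0`, `|x| < R`. -/
def discBundle (R : ℝ) (V : VelocityDomain n) : Set (Space n × Space n) :=
  {p | p.2 ∈ V.carrier ∧ ⟪p.1, p.2⟫ = 0 ∧ ‖p.1‖ < R}

/-- Lebesgue measure of a linear subspace, as a measure on the ambient space. -/
def subspaceMeasure (S : Submodule ℝ (Space n)) : Measure (Space n) :=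
  (volume : Measure S).map Subtype.val

/-- The `(n-1)`-dimensional Lebesgue measure on the disc
`Π_v(R) = {x | x · v = 0, |x| < R}`. -/
def discMeasure (R : ℝ) (v : Space n) : Measure (Space n) :=
  (subspaceMeasure (ℝ ∙ v)ᗮ).restrict (ball 0 R)

/-- The image of the measure `|v| dx dv` on `F` under `(x, v) ↦ (x + c v̂, v)`. The shifts `c = R`
and `c = -R` give the measures on `F₊` and `F₋`, and `c = 0` gives the measure on `F`. -/
def fluxMeasure (R : ℝ) (V : VelocityDomain n) (c : ℝ) : Measure (Space n × Space n) :=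
  V.measure.bind fun v => ‖v‖ₑ • (discMeasure R v).map fun x => (x + c • dir v, v)

/-- The space `L¹(F₋)`. -/
abbrev L1In (R : ℝ) (V : VelocityDomain n) : Type := Lp ℝ 1 (fluxMeasure R V (-R))

/-- The space `L¹(F₊)`. -/
abbrev L1Out (R : ℝ) (V : VelocityDomain n) : Type := Lp ℝ 1 (fluxMeasure R V R)

/-- `A₂ f (x, v) = ∫_V k(x, v', v) f(x, v') dv'`. -/
def scatter (V : VelocityDomain n) (k : Space n → Space n → Space n → ℝ)
    (f : Space n × Space n → ℝ) (p : Space n × Space n) : ℝ :=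
  ∫ v', k p.1 v' p.2 * f (p.1, v') ∂V.measure

/-- The attenuation `exp (-|v|⁻¹ ∫₀ᵗ σ(x - s v̂, v) ds)`. -/
def attenuation (σ : Space n → Space n → ℝ) (x v : Space n) (t : ℝ) : ℝ :=
  Real.exp (-(‖v‖⁻¹ * ∫ s in (0 : ℝ)..t, σ (x - s • dir v) v))

/-- The operator `K`. -/
def opK (R : ℝ) (V : VelocityDomain n) (σ : Space n → Space n → ℝ)
    (k : Space n → Space n → Space n → ℝ) (f : Space n × Space n → ℝ)
    (p : Space n × Space n) : ℝ :=
  -(‖p.2‖⁻¹ * ∫ t in (0 : ℝ)..(R + ⟪p.1, dir p.2⟫),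
    attenuation σ p.1 p.2 t * scatter V k f (p.1 - t • dir p.2, p.2))

/-- The extension `J f₋` of an incoming condition `f₋` on `F₋`. -/
def opJ (R : ℝ) (σ : Space n → Space n → ℝ) (g : Space n × Space n → ℝ)
    (p : Space n × Space n) : ℝ :=
  attenuation σ p.1 p.2 (R + ⟪p.1, dir p.2⟫) *
    g (p.1 - (⟪p.1, dir p.2⟫ + R) • dir p.2, p.2)

/-- `σ_p(x, v') = ∫_V k(x, v', v) dv`. -/
def sigmaP (V : VelocityDomain n) (k : Space n → Space n → Space n → ℝ) (x v' : Space n) : ℝ :=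
  ∫ v, k x v' v ∂V.measure

/-- Admissible pairs of coefficients. -/
structure Admissible (R : ℝ) (V : VelocityDomain n) (σ : Space n → Space n → ℝ)
    (k : Space n → Space n → Space n → ℝ) : Prop where
  sigma_memLp : MemLp (fun p : Space n × Space n => σ p.1 p.2) ∞ (volume.prod V.measure)
  sigma_nonneg : ∀ᵐ p ∂((volume : Measure (Space n)).prod V.measure), 0 ≤ σ p.1 p.2
  k_measurable : AEStronglyMeasurable
    (fun p : Space n × Space n × Space n => k p.1 p.2.1 p.2.2)
    (volume.prod (V.measure.prod V.measure))
  sigma_zero : ∀ x, R < ‖x‖ → ∀ v ∈ V.carrier, σ x v = 0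
  k_zero : ∀ x, R < ‖x‖ → ∀ v' ∈ V.carrier, ∀ v ∈ V.carrier, k x v' v = 0
  k_integrable : ∀ᵐ p ∂((volume : Measure (Space n)).prod V.measure),
    (∀ᵐ v ∂V.measure, 0 ≤ k p.1 p.2 v) ∧ Integrable (k p.1 p.2) V.measure
  sigmaP_memLp : MemLp (fun p : Space n × Space n => sigmaP V k p.1 p.2) ∞
    (volume.prod V.measure)

/-- Subcriticality: `I + K` has a bounded inverse on `L¹(O, |v| dx dv)`. -/
def Subcritical (R : ℝ) (V : VelocityDomain n) (σ : Space n → Space n → ℝ)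
    (k : Space n → Space n → Space n → ℝ) : Prop :=
  ∃ B : L1O R V →L[ℝ] L1O R V, ∀ f g : L1O R V,
    (fun p => f p + opK R V σ k f p) =ᵐ[phaseMeasure R V] g ↔ f = B g

/-- `X` has a `C¹` boundary: near each boundary point, `X` is the sublevel set of a `C¹` function
with nonvanishing differential at this point. -/
def HasC1Boundary (X : Set (Space n)) : Prop :=
  ∀ p ∈ frontier X, ∃ U : Set (Space n), IsOpen U ∧ p ∈ U ∧ ∃ φ : Space n → ℝ,
    ContDiffOn ℝ 1 φ U ∧ fderiv ℝ φ p ≠ 0 ∧ X ∩ U = {x ∈ U | φ x < 0}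

/-- Continuity of the coefficients in `X`, and vanishing outside the closure of `X`. -/
structure ContinuousIn (X : Set (Space n)) (V : VelocityDomain n) (σ : Space n → Space n → ℝ)
    (k : Space n → Space n → Space n → ℝ) : Prop where
  sigma_nonneg : ∀ x ∈ X, ∀ v ∈ V.carrier, 0 ≤ σ x v
  sigma_continuousOn : ContinuousOn (fun p : Space n × Space n => σ p.1 p.2) (X ×ˢ V.carrier)
  sigma_bounded : ∃ M, ∀ x ∈ X, ∀ v ∈ V.carrier, σ x v ≤ M
  k_nonneg : ∀ x ∈ X, ∀ v' ∈ V.carrier, ∀ v ∈ V.carrier, 0 ≤ k x v' v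
  k_continuousOn : ContinuousOn (fun p : Space n × Space n × Space n => k p.1 p.2.1 p.2.2)
    (X ×ˢ (V.carrier ×ˢ V.carrier))
  k_bounded : ∃ M, ∀ x ∈ X, ∀ v' ∈ V.carrier, ∀ v ∈ V.carrier, k x v' v ≤ M
  sigma_zero : ∀ x ∉ closure X, ∀ v ∈ V.carrier, σ x v = 0
  k_zero : ∀ x ∉ closure X, ∀ v' ∈ V.carrier, ∀ v ∈ V.carrier, k x v' v = 0

/-- `g` is the trace of `f` on `F₊`: along almost every characteristic line
`t ↦ (x + t v̂, v)`, `(x, v) ∈ F`, `-R < t < R`, the function `f` agrees almost everywhere with a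
function that is continuous up to the end points, whose value at `t = R` is the value of `g`. -/
def IsOutgoingTrace (R : ℝ) (V : VelocityDomain n) (f g : Space n × Space n → ℝ) : Prop :=
  ∀ᵐ p ∂(fluxMeasure R V 0), ∃ h : ℝ → ℝ, ContinuousOn h (Icc (-R) R) ∧
    (∀ᵐ t ∂((volume : Measure ℝ).restrict (Ioo (-R) R)), f (p.1 + t • dir p.2, p.2) = h t) ∧
    g (p.1 + R • dir p.2, p.2) = h R

/-- `A : L¹(F₋) → L¹(F₊)` is the albedo operator of `(σ, k)`: it maps `f₋` to the trace on `F₊` of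
a solution `f` in `L¹(O, |v| dx dv)` of the transport equation `(I + K) f = J f₋`. -/
def IsAlbedo (R : ℝ) (V : VelocityDomain n) (σ : Space n → Space n → ℝ)
    (k : Space n → Space n → Space n → ℝ) (A : L1In R V →L[ℝ] L1Out R V) : Prop :=
  ∀ g : L1In R V, ∃ f : L1O R V,
    (fun p => f p + opK R V σ k f p) =ᵐ[phaseMeasure R V] opJ R σ g ∧
      IsOutgoingTrace R V f (A g)

/-- The factor `E(x, t, v, v')` of attenuation along a broken ray. -/
def brokenRay (R : ℝ) (σ : Space n → Space n → ℝ) (x : Space n) (t : ℝ) (v v' : Space n) : ℝ :=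
  Real.exp (-(‖v‖⁻¹ * ∫ s in (-R)..t, σ (x - s • dir v) v) -
    ‖v'‖⁻¹ * ∫ s in (0 : ℝ)..(R + ⟪x - t • dir v, dir v'⟫), σ (x - t • dir v - s • dir v') v')

/-! The measure `fluxMeasure` is given by the expected iterated integral. -/

theorem VelocityDomain.ne_zero {V : VelocityDomain n} {v : Space n} (hv : v ∈ V.carrier) :
    v ≠ 0 := by
  cases V with
  | unitSphere =>
    rintro rfl
    simp [VelocityDomain.carrier] at hv
  | openSet U hU h =>
    obtain ⟨c, hc, h⟩ := h
    rintro rfl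
    have := h 0 hv
    simp at this
    linarith

theorem VelocityDomain.ae_mem (V : VelocityDomain n) : ∀ᵐ v ∂V.measure, v ∈ V.carrier := by
  cases V with
  | unitSphere =>
    refine (ae_map_iff measurable_subtype_coe.aemeasurable isClosed_sphere.measurableSet).2 ?_
    exact Filter.Eventually.of_forall fun v => v.2
  | openSet U hU h => exact ae_restrict_mem hU.measurableSet

theorem norm_dir {v : Space n} (hv : v ≠ 0) : ‖dir v‖ = 1 := by
  simp [dir, norm_smul, hv]

theorem measurable_dir : Measurable (dir : Space n → Space n) := by
  unfold dir; fun_prop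

/-- `dx = dt dy` for `x = y + t v̂`, `y · v = 0`. -/
theorem measurePreserving_split {v : Space n} (hv : v ≠ 0) :
    MeasurePreserving (fun q : ℝ × (ℝ ∙ dir v)ᗮ => (q.2 : Space n) + q.1 • dir v)
      ((volume : Measure ℝ).prod volume) volume := by
  let e := LinearIsometryEquiv.toSpanUnitSingleton (𝕜 := ℝ) (dir v) (norm_dir hv)
  have h1 : MeasurePreserving (Prod.map e (id : (ℝ ∙ dir v)ᗮ → (ℝ ∙ dir v)ᗮ))
      ((volume : Measure ℝ).prod volume) (volume.prod volume) :=
    e.measurePreserving.prod (MeasurePreserving.id _)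
  have h2 := WithLp.volume_preserving_toLp (ℝ ∙ dir v) (ℝ ∙ dir v)ᗮ
  have h3 := (ℝ ∙ dir v).orthogonalDecomposition.symm.measurePreserving
  have hfun : (fun q : ℝ × (ℝ ∙ dir v)ᗮ => (q.2 : Space n) + q.1 • dir v) =
      (ℝ ∙ dir v).orthogonalDecomposition.symm ∘
        (WithLp.toLp 2) ∘ (Prod.map e (id : (ℝ ∙ dir v)ᗮ → (ℝ ∙ dir v)ᗮ)) := by
    funext q
    simp [e, add_comm]
  rw [hfun]
  exact h3.comp (h2.comp h1)

theorem span_dir {v : Space n} (hv : v ≠ 0) : (ℝ ∙ dir v) = (ℝ ∙ v) :=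
  Submodule.span_singleton_smul_eq (IsUnit.mk0 _ (by simpa using hv)) v

theorem inner_split {v : Space n} (hv : v ≠ 0) (q : ℝ × (ℝ ∙ dir v)ᗮ) :
    ⟪(q.2 : Space n) + q.1 • dir v, dir v⟫ = q.1 := by
  have h : ⟪(q.2 : Space n), dir v⟫ = 0 := by
    rw [real_inner_comm]
    exact Submodule.mem_orthogonal_singleton_iff_inner_right.1 q.2.2
  rw [inner_add_left, h, inner_smul_left, real_inner_self_eq_norm_sq, norm_dir hv]
  simp

theorem measurable_perp_uncurry :
    Measurable (fun p : Space n × Space n => perp p.1 p.2) := by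
  have := measurable_dir (n := n)
  unfold perp
  fun_prop

theorem measurableSet_slab (R : ℝ) {s : Set (Space n)} (hs : MeasurableSet s) :
    MeasurableSet {p : Space n × Space n | |⟪p.2, dir p.1⟫| < R ∧ perp p.1 p.2 ∈ s} := by
  have h1 := measurable_dir (n := n)
  have h2 : Measurable fun p : Space n × Space n => |⟪p.2, dir p.1⟫| := by fun_prop
  exact (measurableSet_lt h2 measurable_const).inter (measurable_perp_uncurry hs)

theorem volume_slab {R : ℝ} (v : Space n) (hv : v ≠ 0) {s : Set (Space n)}
    (hs : MeasurableSet s) :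
    volume {x : Space n | |⟪x, dir v⟫| < R ∧ perp v x ∈ s} =
      ENNReal.ofReal (2 * R) * subspaceMeasure (ℝ ∙ v)ᗮ s := by
  have hm : MeasurableSet {x : Space n | |⟪x, dir v⟫| < R ∧ perp v x ∈ s} :=
    measurable_prodMk_left (measurableSet_slab R hs)
  rw [← (measurePreserving_split hv).measure_preimage hm.nullMeasurableSet]
  have : (fun q : ℝ × (ℝ ∙ dir v)ᗮ => (q.2 : Space n) + q.1 • dir v) ⁻¹'
      {x : Space n | |⟪x, dir v⟫| < R ∧ perp v x ∈ s} = Ioo (-R) R ×ˢ (Subtype.val ⁻¹' s) := by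
    ext q
    simp only [mem_preimage, mem_ofPred_eq, perp, inner_split hv, mem_prod, mem_Ioo, abs_lt,
      add_sub_cancel_right]
  rw [this, Measure.prod_prod, Real.volume_Ioo, ← span_dir hv, subspaceMeasure,
    Measure.map_apply measurable_subtype_coe hs]
  congr 2
  ring

theorem aemeasurable_flux {R : ℝ} (hR : 0 < R) (V : VelocityDomain n) (c : ℝ) :
    AEMeasurable (fun v => ‖v‖ₑ • (discMeasure R v).map fun x => (x + c • dir v, v))
      V.measure := by
  have hd := measurable_dir (n := n)
  have hp : ∀ v : Space n, Measurable (perp v) := fun v =>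
    measurable_perp_uncurry.comp measurable_prodMk_left
  let m : Space n → Measure (Space n) := fun v =>
    (ENNReal.ofReal (2 * R))⁻¹ •
      ((volume.restrict {x : Space n | |⟪x, dir v⟫| < R}).map (perp v)).restrict (ball 0 R)
  have happ : ∀ v s, MeasurableSet s → m v s = (ENNReal.ofReal (2 * R))⁻¹ *
      volume {x : Space n | |⟪x, dir v⟫| < R ∧ perp v x ∈ s ∩ ball 0 R} := by
    intro v s hs
    have hb : MeasurableSet (s ∩ ball (0 : Space n) R) := hs.inter isOpen_ball.measurableSet
    simp only [m, Measure.smul_apply, smul_eq_mul]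
    rw [Measure.restrict_apply hs, Measure.map_apply (hp v) hb,
      Measure.restrict_apply ((hp v) hb)]
    congr 2
    ext x
    simp [and_comm]
  have hg : ∀ v : Space n, Measurable fun x : Space n => (x + c • dir v, v) := fun v => by
    fun_prop
  refine ⟨fun v => ‖v‖ₑ • (m v).map fun x => (x + c • dir v, v),
    Measure.measurable_of_measurable_coe _ fun s hs => ?_, ?_⟩
  · simp only [Measure.smul_apply, smul_eq_mul, Measure.map_apply (hg _) hs,
      happ _ _ ((hg _) hs)]
    refine measurable_enorm.mul (Measurable.const_mul ?_ _)
    have hpu := measurable_perp_uncurry (n := n)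
    have h1 : Measurable fun p : Space n × Space n => |⟪p.2, dir p.1⟫| := by fun_prop
    have h2 : Measurable fun p : Space n × Space n => (perp p.1 p.2 + c • dir p.1, p.1) := by
      fun_prop
    exact measurable_measure_prodMk_left ((measurableSet_lt h1 measurable_const).inter
      ((h2 hs).inter (hpu isOpen_ball.measurableSet)))
  · filter_upwards [V.ae_mem] with v hv
    have : discMeasure R v = m v := by
      refine Measure.ext fun s hs => ?_
      rw [happ v s hs, volume_slab v (VelocityDomain.ne_zero hv)
        (hs.inter isOpen_ball.measurableSet), ← mul_assoc, ENNReal.inv_mul_cancel, one_mul,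
        discMeasure, Measure.restrict_apply hs]
      · simpa using hR
      · exact ENNReal.ofReal_ne_top
    rw [this]

/-- The integral over `F` (shifted by `c v̂`) is the iterated integral. -/
theorem lintegral_fluxMeasure {R : ℝ} (hR : 0 < R) (V : VelocityDomain n) (c : ℝ)
    {f : Space n × Space n → ℝ≥0∞} (hf : Measurable f) :
    ∫⁻ p, f p ∂fluxMeasure R V c =
      ∫⁻ v, ‖v‖ₑ * ∫⁻ x, f (x + c • dir v, v) ∂discMeasure R v ∂V.measure := by
  rw [fluxMeasure, Measure.lintegral_bind (aemeasurable_flux hR V c) hf.aemeasurable]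
  refine lintegral_congr fun v => ?_
  rw [lintegral_smul_measure, smul_eq_mul, lintegral_map hf (by fun_prop)]

end Transport

end

open MeasureTheory Set Metric Filter Topology
open scoped ENNReal RealInnerProductSpace

noncomputable section

namespace Transport

variable {n : ℕ}

/-! ### The velocity domain -/

/-! The outgoing trace is expanded by the number of collisions. If `u = (I + K)⁻¹ J g` and `w = K u
= J g - u`, then on `F₊` one has `A g = J g - K J g + K w`: the ballistic part, the particles
scattered once (`K` carries a minus sign), and a remainder `K² u` with at least two collisions
(`Regular.exists_albedo`). When `g` is a nonnegative density of mass one concentrated near a single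
incoming line, these three parts have different degrees of singularity, and suitable tests on `F₊`
separate them. Each test is bounded by `‖A - A'‖`.

Ballistic part. The test keeps the outgoing velocities in a small ball around `v₀`. Unscattered
particles remain in it and carry the attenuation factor as mass. The flux scattered at least once
into the ball is at most a constant times the measure of the ball, since `k` is bounded. This is
`abs_inAtt_sub_le`.

Single scattering. The test keeps the outgoing lines at distance less than `δ` from the incoming
line, with bounded velocity away from `v₀`, so that the ballistic part is not seen. A particle
scattered once leaves on a line that meets its incoming line. A particle scattered at least twice
comes back to that line only by chance: from a point off the line, the velocities that point at the
line lie in a plane, which is null because `n ≥ 3`. Hence the multiple scattering seen by the test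
vanishes with `δ`, at a rate proportional to the mass of `u`
(`Regular.exists_lintegral_nearSet_le`). The outgoing line also determines the collision point, so
the test may be weighted by a continuous version of the sign of `k - k'`. In the limit
(`singleFlux_add_le`) this yields integrals over the given line, and `k E - k' E' = (k - k') E + k'
(E - E')` gives the second estimate.

Regularity. The coefficients are first restricted to `X` and extended by zero, which makes them
Borel and bounded everywhere. Only values over `∂X` change, and `∂X` is null on almost every line,
so the albedo operator is the same. By convexity a line that meets `X` crosses `∂X` at most twice.
Almost all its points are therefore points of continuity, and dominated convergence gives the limits
along lines near the given one. -/

theorem VelocityDomain.measurableSet_carrier (V : VelocityDomain n) :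
    MeasurableSet V.carrier := by
  cases V with
  | unitSphere => exact isClosed_sphere.measurableSet
  | openSet U hU h => exact hU.measurableSet

theorem VelocityDomain.exists_le_norm (V : VelocityDomain n) :
    ∃ c > 0, ∀ v ∈ V.carrier, c ≤ ‖v‖ := by
  cases V with
  | unitSphere => exact ⟨1, one_pos, fun v hv => by simp [VelocityDomain.carrier] at hv; simp [hv]⟩
  | openSet U hU h => exact h

instance VelocityDomain.isLocallyFiniteMeasure (V : VelocityDomain n) :
    IsLocallyFiniteMeasure V.measure := by
  cases V with
  | unitSphere =>
    have : IsFiniteMeasure (((volume : Measure (Space n)).toSphere).map Subtype.val) :=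
      inferInstance
    exact inferInstanceAs
      (IsLocallyFiniteMeasure (((volume : Measure (Space n)).toSphere).map Subtype.val))
  | openSet U hU h =>
    exact inferInstanceAs (IsLocallyFiniteMeasure ((volume : Measure (Space n)).restrict U))

theorem VelocityDomain.measure_pos (V : VelocityDomain n) {v : Space n} (hv : v ∈ V.carrier)
    {U : Set (Space n)} (hU : U ∈ 𝓝 v) : 0 < V.measure U := by
  obtain ⟨W, hWU, hW, hvW⟩ := _root_.mem_nhds_iff.1 hU
  refine lt_of_lt_of_le ?_ (measure_mono hWU)
  cases V with
  | unitSphere =>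
    rw [VelocityDomain.measure, Measure.map_apply measurable_subtype_coe hW.measurableSet]
    exact (hW.preimage continuous_subtype_val).measure_pos _ ⟨⟨v, hv⟩, hvW⟩
  | openSet O hO h =>
    rw [VelocityDomain.measure, Measure.restrict_apply hW.measurableSet]
    exact (hW.inter hO).measure_pos _ ⟨v, hvW, hv⟩

theorem VelocityDomain.measure_submodule (V : VelocityDomain n) (W : Submodule ℝ (Space n))
    (hW : W ≠ ⊤) : V.measure (W : Set (Space n)) = 0 := by
  have h0 : volume (W : Set (Space n)) = 0 := Measure.addHaar_submodule _ W hW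
  have hm : MeasurableSet (W : Set (Space n)) := W.closed_of_finiteDimensional.measurableSet
  cases V with
  | unitSphere =>
    rw [VelocityDomain.measure, Measure.map_apply measurable_subtype_coe hm,
      Measure.toSphere_apply' _ (measurable_subtype_coe hm)]
    -- The surface measure of a set is a multiple of the volume of the cone over it, and a cone over
    -- vectors of `W` stays in `W`.
    refine mul_eq_zero_of_right _ (measure_mono_null ?_ h0)
    rintro _ ⟨r, -, _, ⟨w, hw, rfl⟩, rfl⟩
    exact W.smul_mem r hw
  | openSet U hU h => exact Measure.restrict_le_self.absolutelyContinuous h0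

/-- The restriction on the dimension enters the argument only through this fact: planes of
velocities, and hence single velocities, are null for `dv`. -/
theorem span_pair_ne_top (hn : 3 ≤ n) (a b : Space n) : Submodule.span ℝ {a, b} ≠ ⊤ := by
  intro h
  have h1 := finrank_span_finset_le_card (R := ℝ) ({a, b} : Finset (Space n))
  have h2 : Module.finrank ℝ (Submodule.span ℝ ({a, b} : Set (Space n))) = n := by
    rw [h, finrank_top]; simp
  rw [Set.finrank, Finset.coe_insert, Finset.coe_singleton, h2] at h1
  have := Finset.card_le_two (a := a) (b := b)
  omega

theorem VelocityDomain.ae_notMem_span_pair (V : VelocityDomain n) (hn : 3 ≤ n) (a b : Space n) :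
    ∀ᵐ v ∂V.measure, v ∉ Submodule.span ℝ {a, b} :=
  measure_eq_zero_iff_ae_notMem.1 (V.measure_submodule _ (span_pair_ne_top hn a b))

theorem VelocityDomain.measure_singleton_eq_zero (V : VelocityDomain n) (hn : 3 ≤ n)
    (v : Space n) : V.measure {v} = 0 := by
  refine measure_mono_null ?_ (V.measure_submodule _ (span_pair_ne_top hn v v))
  rintro _ rfl
  exact Submodule.subset_span (by simp)

theorem VelocityDomain.exists_ball_measure_lt (V : VelocityDomain n) (hn : 3 ≤ n) (v : Space n)
    {ε : ℝ≥0∞} (hε : 0 < ε) : ∃ r > 0, V.measure (ball v r) < ε := by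
  obtain ⟨U, hvU, hU, hlt⟩ := ({v} : Set (Space n)).exists_isOpen_lt_of_lt (μ := V.measure) ε
    (by rwa [V.measure_singleton_eq_zero hn])
  obtain ⟨r, hr, hb⟩ := Metric.isOpen_iff.1 hU v (hvU rfl)
  exact ⟨r, hr, (measure_mono hb).trans_lt hlt⟩

/-- A property that holds almost everywhere on `ℝⁿ × V` holds at points arbitrarily close to a
given point. -/
theorem VelocityDomain.frequently_of_ae (V : VelocityDomain n) {P : Space n × Space n → Prop}
    (hP : ∀ᵐ p ∂(volume : Measure (Space n)).prod V.measure, P p) (x : Space n) {v : Space n}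
    (hv : v ∈ V.carrier) : ∃ᶠ p in 𝓝 (x, v), p.2 ∈ V.carrier ∧ P p := by
  intro h
  rw [nhds_prod_eq] at h
  obtain ⟨s, hs, t, ht, hst⟩ := Filter.mem_prod_iff.1 h
  have hpos : ((volume : Measure (Space n)).prod V.measure) (s ×ˢ t) ≠ 0 := by
    rw [Measure.prod_prod]
    exact mul_ne_zero (Measure.measure_pos_of_mem_nhds _ hs).ne' (V.measure_pos hv ht).ne'
  refine hpos (measure_mono_null (fun p hp => hst hp) ?_)
  have h2 : ∀ᵐ p ∂(volume : Measure (Space n)).prod V.measure, p.2 ∈ V.carrier :=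
    Measure.quasiMeasurePreserving_snd.ae V.ae_mem
  have := h2.and hP
  rw [ae_iff] at this
  simpa using this

theorem VelocityDomain.continuousAt_dir {v : Space n} (hv : v ≠ 0) :
    ContinuousAt (dir : Space n → Space n) v :=
  (continuousAt_id.norm.inv₀ (by simpa using hv)).smul continuousAt_id


/-! ### Phase space in terms of characteristic lines -/

theorem measurableSet_phaseSpace (R : ℝ) (V : VelocityDomain n) :
    MeasurableSet (phaseSpace R V) := by
  have h1 := measurable_dir (n := n)
  have h2 : Measurable fun p : Space n × Space n => |⟪p.1, dir p.2⟫| := by fun_prop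
  have h3 : Measurable fun p : Space n × Space n => ‖perp p.2 p.1‖ := by
    unfold perp; fun_prop
  exact (measurable_snd V.measurableSet_carrier).inter
    ((measurableSet_lt h2 measurable_const).inter (measurableSet_lt h3 measurable_const))

/-! ### Orthogonal decomposition of a point with respect to a direction. -/

theorem inner_dir_of_inner {x v : Space n} (h : ⟪x, v⟫ = 0) : ⟪x, dir v⟫ = 0 := by
  rw [dir, inner_smul_right, h, mul_zero]

theorem inner_dir_dir {v : Space n} (hv : v ≠ 0) : ⟪dir v, dir v⟫ = 1 := by
  rw [real_inner_self_eq_norm_sq, norm_dir hv, one_pow]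

theorem inner_add_smul_dir {v : Space n} (hv : v ≠ 0) (x : Space n) (t : ℝ) :
    ⟪x + t • dir v, dir v⟫ = ⟪x, dir v⟫ + t := by
  rw [inner_add_left, inner_smul_left, inner_dir_dir hv]
  simp

theorem perp_add_smul {v : Space n} (hv : v ≠ 0) (x : Space n) (t : ℝ) :
    perp v (x + t • dir v) = perp v x := by
  simp only [perp, inner_add_left, inner_smul_left, inner_dir_dir hv]
  simp only [conj_trivial, mul_one, add_smul]
  abel

theorem perp_eq_self {v x : Space n} (h : ⟪x, dir v⟫ = 0) : perp v x = x := by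
  simp [perp, h]

theorem perp_add_inner_smul (v x : Space n) : perp v x + ⟪x, dir v⟫ • dir v = x := by
  simp [perp]

theorem inner_perp_dir {v : Space n} (hv : v ≠ 0) (x : Space n) : ⟪perp v x, dir v⟫ = 0 := by
  simp [perp, inner_sub_left, inner_smul_left, norm_dir hv]

theorem norm_sq_eq_perp {v : Space n} (hv : v ≠ 0) (x : Space n) :
    ‖x‖ ^ 2 = ‖perp v x‖ ^ 2 + ⟪x, dir v⟫ ^ 2 := by
  conv_lhs => rw [← perp_add_inner_smul v x]
  rw [norm_add_sq_real, inner_smul_right, inner_perp_dir hv, norm_smul, norm_dir hv]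
  simp

theorem norm_perp_le {v : Space n} (hv : v ≠ 0) (x : Space n) : ‖perp v x‖ ≤ ‖x‖ := by
  have := norm_sq_eq_perp hv x
  exact abs_le_of_sq_le_sq' (by nlinarith [sq_nonneg ⟪x, dir v⟫]) (norm_nonneg _) |>.2

theorem abs_inner_dir_le {v : Space n} (hv : v ≠ 0) (x : Space n) : |⟪x, dir v⟫| ≤ ‖x‖ := by
  simpa [norm_dir hv] using abs_real_inner_le_norm x (dir v)

theorem mem_phaseSpace_of_norm_lt {R : ℝ} {V : VelocityDomain n} {x v : Space n} (hx : ‖x‖ < R)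
    (hv : v ∈ V.carrier) : (x, v) ∈ phaseSpace R V :=
  ⟨hv, (abs_inner_dir_le (VelocityDomain.ne_zero hv) x).trans_lt hx,
    (norm_perp_le (VelocityDomain.ne_zero hv) x).trans_lt hx⟩

/-- This is Tonelli in the coordinates `x = y + t v̂`, in which the cylinder is the product of a
disc and an interval. -/
theorem lintegral_slab {R : ℝ} {v : Space n} (hv : v ≠ 0) {f : Space n → ℝ≥0∞}
    (hf : Measurable f) :
    ∫⁻ x in {x : Space n | |⟪x, dir v⟫| < R ∧ ‖perp v x‖ < R}, f x =
      ∫⁻ x, (∫⁻ t in Ioo (-R) R, f (x + t • dir v)) ∂discMeasure R v := by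
  have hs : MeasurableSet {x : Space n | |⟪x, dir v⟫| < R ∧ ‖perp v x‖ < R} := by
    have := measurable_prodMk_left (x := v) (measurableSet_slab R
      (isOpen_ball (x := (0 : Space n)) (ε := R)).measurableSet)
    simpa [Set.preimage, Set.ofPred_and] using this
  have hm : Measurable fun x : Space n => ∫⁻ t in Ioo (-R) R, f (x + t • dir v) :=
    Measurable.lintegral_prod_right' (f := fun q : Space n × ℝ => f (q.1 + q.2 • dir v))
      (hf.comp (by fun_prop))
  have hmp := measurePreserving_split hv
  rw [← lintegral_indicator hs, ← hmp.lintegral_comp (hf.indicator hs), discMeasure,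
    ← lintegral_indicator isOpen_ball.measurableSet, subspaceMeasure, ← span_dir hv,
    lintegral_map (hm.indicator isOpen_ball.measurableSet) measurable_subtype_coe]
  refine (lintegral_prod_symm _ ((hf.indicator hs).comp hmp.measurable).aemeasurable).trans ?_
  refine lintegral_congr fun y => ?_
  simp only [Function.comp_apply]
  have hy : ⟪(y : Space n), dir v⟫ = 0 := by
    rw [real_inner_comm]
    exact Submodule.mem_orthogonal_singleton_iff_inner_right.1 y.2
  by_cases hyR : ‖(y : Space n)‖ < R
  · rw [indicator_of_mem (by simpa using hyR), ← lintegral_indicator measurableSet_Ioo]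
    refine lintegral_congr fun t => ?_
    by_cases ht : t ∈ Ioo (-R) R
    · rw [indicator_of_mem ht, indicator_of_mem]
      refine ⟨?_, ?_⟩
      · simpa [inner_add_smul_dir hv, hy, abs_lt] using ht
      · simpa [perp_add_smul hv, perp_eq_self hy] using hyR
    · rw [indicator_of_notMem ht, indicator_of_notMem]
      rintro ⟨h1, -⟩
      rw [inner_add_smul_dir hv, hy, zero_add, abs_lt] at h1
      exact ht h1
  · rw [indicator_of_notMem (by simpa using hyR)]
    refine (lintegral_congr fun t => ?_).trans lintegral_zero
    rw [indicator_of_notMem]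
    rintro ⟨-, h2⟩
    simp only [perp_add_smul hv, perp_eq_self hy] at h2
    exact hyR h2

theorem lintegral_phaseMeasure_eq_prod (R : ℝ) (V : VelocityDomain n)
    {f : Space n × Space n → ℝ≥0∞} (hf : Measurable f) :
    ∫⁻ p, f p ∂phaseMeasure R V =
      ∫⁻ p in phaseSpace R V, ‖p.2‖ₑ * f p ∂(volume.prod V.measure) := by
  rw [phaseMeasure, lintegral_withDensity_eq_lintegral_mul _ (by fun_prop) hf]
  rfl

/-- Integration over phase space along characteristic lines. -/
theorem lintegral_phaseMeasure (R : ℝ) (V : VelocityDomain n)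
    {f : Space n × Space n → ℝ≥0∞} (hf : Measurable f) :
    ∫⁻ p, f p ∂phaseMeasure R V =
      ∫⁻ v, ‖v‖ₑ * ∫⁻ x, (∫⁻ t in Ioo (-R) R, f (x + t • dir v, v)) ∂discMeasure R v
        ∂V.measure := by
  have hs := measurableSet_phaseSpace R V
  have hg : Measurable fun p : Space n × Space n => ‖p.2‖ₑ * f p := by fun_prop
  rw [lintegral_phaseMeasure_eq_prod R V hf, ← lintegral_indicator hs,
    lintegral_prod_symm _ (hg.indicator hs).aemeasurable]
  refine lintegral_congr_ae ?_
  filter_upwards [V.ae_mem] with v hv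
  have hv0 := VelocityDomain.ne_zero hv
  have hfv : Measurable fun x => f (x, v) := hf.comp measurable_prodMk_right
  rw [← lintegral_slab hv0 hfv, ← lintegral_const_mul _ hfv, ← lintegral_indicator]
  · refine lintegral_congr fun x => ?_
    simp only [indicator, phaseSpace, mem_ofPred_eq, hv, true_and]
  · have := measurable_prodMk_right (y := v) hs
    simpa [Set.preimage, phaseSpace, hv] using this

/-- Every characteristic line has length `2 R` inside `O`, so forgetting the position on the line
multiplies the flux measure by `2 R`. Null sets, positivity and finiteness can thus be studied in
phase space, where the measure is a product measure with a density. -/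
theorem fluxMeasure_eq_map {R : ℝ} (hR : 0 < R) (V : VelocityDomain n) (c : ℝ) :
    fluxMeasure R V c = (ENNReal.ofReal (2 * R))⁻¹ •
      (phaseMeasure R V).map fun p => (perp p.2 p.1 + c • dir p.2, p.2) := by
  have hd := measurable_dir (n := n)
  have hp : Measurable fun p : Space n × Space n => (perp p.2 p.1 + c • dir p.2, p.2) := by
    unfold perp; fun_prop
  refine Measure.ext_of_lintegral _ fun f hf => ?_
  have hfp := lintegral_phaseMeasure R V (hf.comp hp)
  simp only [Function.comp_apply] at hfp
  rw [lintegral_smul_measure, lintegral_map hf hp, hfp,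
    lintegral_fluxMeasure hR V c hf, smul_eq_mul]
  have hne : (ENNReal.ofReal (2 * R))⁻¹ ≠ ∞ := by simp [hR]
  rw [← lintegral_const_mul' _ _ hne]
  refine lintegral_congr_ae ?_
  filter_upwards [V.ae_mem] with v hv
  have hv0 := VelocityDomain.ne_zero hv
  rw [mul_left_comm, ← lintegral_const_mul' _ _ hne]
  congr 1
  refine lintegral_congr_ae ?_
  have hdisc : ∀ᵐ x ∂discMeasure R v, ⟪x, dir v⟫ = 0 := by
    refine ae_restrict_of_ae ?_
    rw [subspaceMeasure, ae_map_iff measurable_subtype_coe.aemeasurable]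
    · refine Eventually.of_forall fun y => inner_dir_of_inner ?_
      rw [real_inner_comm]
      exact Submodule.mem_orthogonal_singleton_iff_inner_right.1 y.2
    · exact (isClosed_eq (by fun_prop) continuous_const).measurableSet
  filter_upwards [hdisc] with x hx
  simp only [perp_add_smul hv0, perp_eq_self hx, lintegral_const,
    Measure.restrict_apply_univ, Real.volume_Ioo]
  rw [show R - -R = 2 * R by ring, mul_comm, mul_assoc, ENNReal.mul_inv_cancel, mul_one]
  · simpa using hR
  · exact ENNReal.ofReal_ne_top

/-- The point `(x + t v̂, v)` of the characteristic line through `(x, v)`. -/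
def alongLine (q : (Space n × Space n) × ℝ) : Space n × Space n :=
  (q.1.1 + q.2 • dir q.1.2, q.1.2)

/-- The translation `(x, v) ↦ (x + c v̂, v)`. -/
def shift (c : ℝ) (p : Space n × Space n) : Space n × Space n := (p.1 + c • dir p.2, p.2)

/-- The orthogonal projection `(x, v) ↦ (x - (x · v̂) v̂, v)`. -/
def foot (p : Space n × Space n) : Space n × Space n := (perp p.2 p.1, p.2)

theorem measurable_alongLine : Measurable (alongLine (n := n)) := by
  have hd := measurable_dir (n := n)
  unfold alongLine; fun_prop

theorem measurable_shift (c : ℝ) : Measurable (shift (n := n) c) := by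
  have hd := measurable_dir (n := n)
  unfold shift; fun_prop

theorem measurable_foot : Measurable (foot (n := n)) := by
  have hd := measurable_dir (n := n)
  unfold foot perp; fun_prop

theorem shift_shift (a b : ℝ) (p : Space n × Space n) : shift a (shift b p) = shift (b + a) p := by
  simp [shift, add_smul, add_assoc]

theorem shift_zero (p : Space n × Space n) : shift 0 p = p := by simp [shift]

theorem measurePreserving_shift {R : ℝ} (hR : 0 < R) (V : VelocityDomain n) {a b : ℝ} (c : ℝ)
    (h : a + c = b) : MeasurePreserving (shift c) (fluxMeasure R V a) (fluxMeasure R V b) := by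
  refine ⟨measurable_shift c, Measure.ext_of_lintegral _ fun f hf => ?_⟩
  have h1 := lintegral_fluxMeasure hR V a (hf.comp (measurable_shift c))
  simp only [Function.comp_apply] at h1
  rw [lintegral_map hf (measurable_shift c), lintegral_fluxMeasure hR V b hf, h1]
  simp [shift, ← h, add_smul, add_assoc]

theorem measurePreserving_alongLine {R : ℝ} (hR : 0 < R) (V : VelocityDomain n) :
    MeasurePreserving alongLine
      ((fluxMeasure R V 0).prod ((volume : Measure ℝ).restrict (Ioo (-R) R)))
      (phaseMeasure R V) := by
  refine ⟨measurable_alongLine, Measure.ext_of_lintegral _ fun f hf => ?_⟩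
  have h := hf.comp (measurable_alongLine (n := n))
  have h1 := lintegral_prod (μ := fluxMeasure R V 0)
    (ν := (volume : Measure ℝ).restrict (Ioo (-R) R)) _ h.aemeasurable
  simp only [Function.comp_apply] at h1
  rw [lintegral_map hf measurable_alongLine, h1, lintegral_fluxMeasure hR V 0
    (Measurable.lintegral_prod_right' (f := fun q => f (alongLine q)) h),
    lintegral_phaseMeasure R V hf]
  simp [alongLine]

theorem lintegral_phase_line {R : ℝ} (hR : 0 < R) (V : VelocityDomain n)
    {f : Space n × Space n → ℝ≥0∞} (hf : Measurable f) :
    ∫⁻ p, f p ∂phaseMeasure R V =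
      ∫⁻ p, (∫⁻ t in Ioo (-R) R, f (alongLine (p, t))) ∂fluxMeasure R V 0 := by
  rw [← (measurePreserving_alongLine hR V).lintegral_comp hf]
  exact lintegral_prod _ (hf.comp measurable_alongLine).aemeasurable

theorem ae_line_of_ae_phase {R : ℝ} (hR : 0 < R) {V : VelocityDomain n}
    {P : Space n × Space n → Prop} (h : ∀ᵐ p ∂phaseMeasure R V, P p) :
    ∀ᵐ p ∂fluxMeasure R V 0, ∀ᵐ t ∂(volume : Measure ℝ).restrict (Ioo (-R) R),
      P (alongLine (p, t)) :=
  Measure.ae_ae_of_ae_prod ((measurePreserving_alongLine hR V).quasiMeasurePreserving.ae h)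

theorem ae_phase_mem (R : ℝ) (V : VelocityDomain n) :
    ∀ᵐ p ∂phaseMeasure R V, p ∈ phaseSpace R V :=
  withDensity_absolutelyContinuous _ _ (ae_restrict_mem (measurableSet_phaseSpace R V))

theorem ae_flux_zero_mem {R : ℝ} (hR : 0 < R) (V : VelocityDomain n) :
    ∀ᵐ p ∂fluxMeasure R V 0, p ∈ discBundle R V := by
  have hm : MeasurableSet (discBundle R V) := by
    have h2 : Measurable fun p : Space n × Space n => ⟪p.1, p.2⟫ := by fun_prop
    exact (measurable_snd V.measurableSet_carrier).inter
      ((measurableSet_eq_fun h2 measurable_const).inter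
        (measurableSet_lt measurable_fst.norm measurable_const))
  rw [fluxMeasure_eq_map hR]
  refine Measure.ae_smul_measure ?_ _
  have hp : Measurable fun p : Space n × Space n => (perp p.2 p.1 + (0 : ℝ) • dir p.2, p.2) := by
    simp only [zero_smul, add_zero]; exact measurable_foot
  refine (ae_map_iff hp.aemeasurable hm).2 ?_
  filter_upwards [ae_phase_mem R V] with p hp
  have hv := VelocityDomain.ne_zero hp.1
  refine ⟨hp.1, ?_, by simpa using hp.2.2⟩
  have := inner_perp_dir hv p.1
  rw [dir, inner_smul_right] at this
  simpa [hv] using this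

/-- Translations along the lines are invertible and preserve the flux measures in both directions,
so no measurability of `P` is needed. -/
theorem ae_flux_iff {R : ℝ} (hR : 0 < R) {V : VelocityDomain n} (c : ℝ)
    {P : Space n × Space n → Prop} :
    (∀ᵐ p ∂fluxMeasure R V c, P p) ↔ ∀ᵐ p ∂fluxMeasure R V 0, P (shift c p) := by
  refine ⟨fun h => (measurePreserving_shift hR V c (zero_add c)).quasiMeasurePreserving.ae h,
    fun h => ?_⟩
  have := (measurePreserving_shift hR V (-c) (add_neg_cancel c)).quasiMeasurePreserving.ae h
  simpa [shift_shift, shift_zero] using this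
/-! ### The operators along characteristic lines -/

theorem integral_backward {E : Type*} [NormedAddCommGroup E] [NormedSpace ℝ E]
    (φ : Space n → E) (x e : Space n) (a b : ℝ) :
    ∫ s in (0 : ℝ)..b, φ (x + a • e - s • e) = ∫ s in (a - b)..a, φ (x + s • e) := by
  have := intervalIntegral.integral_comp_sub_left (a := 0) (b := b)
    (fun s => φ (x + s • e)) a
  simp only [sub_zero] at this
  rw [← this]
  simp [sub_smul, add_sub_assoc]

theorem attenuation_line (σ : Space n → Space n → ℝ) (x v : Space n) (a t : ℝ) :
    attenuation σ (x + a • dir v) v t =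
      Real.exp (-(‖v‖⁻¹ * ∫ s in (a - t)..a, σ (x + s • dir v) v)) := by
  rw [attenuation, integral_backward (fun y => σ y v)]

theorem opJ_alongLine (R : ℝ) (σ : Space n → Space n → ℝ) (g : Space n × Space n → ℝ)
    {q : Space n × Space n} (hv : q.2 ≠ 0) (hq : ⟪q.1, q.2⟫ = 0) (t : ℝ) :
    opJ R σ g (alongLine (q, t)) =
      Real.exp (-(‖q.2‖⁻¹ * ∫ s in (-R)..t, σ (q.1 + s • dir q.2) q.2)) * g (shift (-R) q) := by
  have h : ⟪q.1 + t • dir q.2, dir q.2⟫ = t := by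
    rw [inner_add_smul_dir hv, inner_dir_of_inner hq, zero_add]
  simp only [opJ, alongLine, h, attenuation_line, shift]
  congr 5
  · ring
  · rw [add_smul, neg_smul]; abel

/-- The substitution `r = t - s` replaces the distance travelled backwards by the position of the
collision on the line. The exponential is then the attenuation between the positions `r` and `t`. -/
theorem opK_alongLine (R : ℝ) (V : VelocityDomain n) (σ : Space n → Space n → ℝ)
    (k : Space n → Space n → Space n → ℝ) (f : Space n × Space n → ℝ)
    {q : Space n × Space n} (hv : q.2 ≠ 0) (hq : ⟪q.1, q.2⟫ = 0) (t : ℝ) :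
    opK R V σ k f (alongLine (q, t)) =
      -(‖q.2‖⁻¹ * ∫ r in (-R)..t,
        Real.exp (-(‖q.2‖⁻¹ * ∫ s in r..t, σ (q.1 + s • dir q.2) q.2)) *
          scatter V k f (alongLine (q, r))) := by
  have h : ⟪q.1 + t • dir q.2, dir q.2⟫ = t := by
    rw [inner_add_smul_dir hv, inner_dir_of_inner hq, zero_add]
  have key := intervalIntegral.integral_comp_sub_left (a := 0) (b := R + t)
    (fun r => Real.exp (-(‖q.2‖⁻¹ * ∫ s in r..t, σ (q.1 + s • dir q.2) q.2)) *
          scatter V k f (alongLine (q, r))) t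
  rw [show t - (R + t) = -R by ring, sub_zero] at key
  simp only [opK, alongLine, h, attenuation_line] at key ⊢
  rw [← key]
  simp [sub_smul, add_sub_assoc]

/-- `∫_V k(x, v', v) f(x, v') dv'` for functions with values in `[0, ∞]`. -/
def lscatter (V : VelocityDomain n) (k : Space n → Space n → Space n → ℝ)
    (f : Space n × Space n → ℝ≥0∞) (p : Space n × Space n) : ℝ≥0∞ :=
  ∫⁻ v', ENNReal.ofReal (k p.1 v' p.2) * f (p.1, v') ∂V.measure

/-- Bounded Borel measurable nonnegative coefficients supported in the ball of radius `R`. -/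
structure Regular (R : ℝ) (V : VelocityDomain n) (σ : Space n → Space n → ℝ)
    (k : Space n → Space n → Space n → ℝ) (M : ℝ) : Prop where
  bound_nonneg : 0 ≤ M
  sigma_measurable : Measurable fun p : Space n × Space n => σ p.1 p.2
  sigma_nonneg : ∀ x v, 0 ≤ σ x v
  sigma_le : ∀ x v, σ x v ≤ M
  sigma_zero : ∀ x v, R ≤ ‖x‖ → σ x v = 0
  k_measurable : Measurable fun p : Space n × Space n × Space n => k p.1 p.2.1 p.2.2
  k_nonneg : ∀ x v' v, 0 ≤ k x v' v
  k_le : ∀ x v' v, k x v' v ≤ M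
  k_zero : ∀ x v' v, R ≤ ‖x‖ → k x v' v = 0
  lintegral_k_le : ∀ x v', ∫⁻ v, ENNReal.ofReal (k x v' v) ∂V.measure ≤ ENNReal.ofReal M

namespace Regular

variable {R M : ℝ} {V : VelocityDomain n} {σ : Space n → Space n → ℝ}
  {k : Space n → Space n → Space n → ℝ}

theorem measurable_lscatter (h : Regular R V σ k M) {f : Space n × Space n → ℝ≥0∞}
    (hf : Measurable f) : Measurable (lscatter V k f) := by
  have h1 : Measurable fun q : (Space n × Space n) × Space n =>
      ENNReal.ofReal (k q.1.1 q.2 q.1.2) * f (q.1.1, q.2) := by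
    have hk : Measurable fun q : (Space n × Space n) × Space n => k q.1.1 q.2 q.1.2 :=
      h.k_measurable.comp (f := fun q : (Space n × Space n) × Space n =>
        (q.1.1, q.2, q.1.2)) (by fun_prop)
    exact hk.ennreal_ofReal.mul (hf.comp (by fun_prop))
  exact h1.lintegral_prod_right'

theorem stronglyMeasurable_scatter (h : Regular R V σ k M) {f : Space n × Space n → ℝ}
    (hf : Measurable f) : StronglyMeasurable (scatter V k f) := by
  have h1 : Measurable fun q : (Space n × Space n) × Space n =>
      k q.1.1 q.2 q.1.2 * f (q.1.1, q.2) := by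
    have hk : Measurable fun q : (Space n × Space n) × Space n => k q.1.1 q.2 q.1.2 :=
      h.k_measurable.comp (f := fun q : (Space n × Space n) × Space n =>
        (q.1.1, q.2, q.1.2)) (by fun_prop)
    exact hk.mul (hf.comp (by fun_prop))
  exact h1.stronglyMeasurable.integral_prod_right'

theorem enorm_scatter_le (h : Regular R V σ k M) (f : Space n × Space n → ℝ)
    (p : Space n × Space n) : ‖scatter V k f p‖ₑ ≤ lscatter V k (fun p => ‖f p‖ₑ) p := by
  refine (enorm_integral_le_lintegral_enorm _).trans (lintegral_mono fun v' => ?_)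
  rw [enorm_mul, Real.enorm_of_nonneg (h.k_nonneg _ _ _)]

theorem lscatter_zero (h : Regular R V σ k M) (f : Space n × Space n → ℝ≥0∞)
    {p : Space n × Space n} (hp : R ≤ ‖p.1‖) : lscatter V k f p = 0 := by
  simp [lscatter, h.k_zero _ _ _ hp]

end Regular

theorem enorm_ne_zero_of_mem {V : VelocityDomain n} {v : Space n} (hv : v ∈ V.carrier) :
    ‖v‖ₑ ≠ 0 := by
  simpa using VelocityDomain.ne_zero hv

/-- The factor `|v|⁻¹` cancels the density of the phase measure. Since `O` contains every `(x, v)`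
with `|x| < R` and `v ∈ V`, the restriction to `O` is invisible to functions supported there. -/
theorem lintegral_phase_inv {R : ℝ} {V : VelocityDomain n} {G : Space n × Space n → ℝ≥0∞}
    (hG : Measurable G) (h0 : ∀ p, R ≤ ‖p.1‖ → G p = 0) :
    ∫⁻ p, ‖p.2‖ₑ⁻¹ * G p ∂phaseMeasure R V = ∫⁻ p, G p ∂(volume.prod V.measure) := by
  rw [lintegral_phaseMeasure_eq_prod R V (by fun_prop), ← lintegral_indicator
    (measurableSet_phaseSpace R V)]
  refine lintegral_congr_ae ?_
  have h2 : ∀ᵐ p ∂(volume : Measure (Space n)).prod V.measure, p.2 ∈ V.carrier :=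
    Measure.quasiMeasurePreserving_snd.ae V.ae_mem
  filter_upwards [h2] with p hp
  by_cases hx : ‖p.1‖ < R
  · rw [indicator_of_mem (mem_phaseSpace_of_norm_lt hx hp), ← mul_assoc,
      ENNReal.mul_inv_cancel (enorm_ne_zero_of_mem hp) enorm_ne_top, one_mul]
  · by_cases hO : p ∈ phaseSpace R V
    · simp [indicator_of_mem hO, h0 p (not_lt.1 hx)]
    · rw [indicator_of_notMem hO, h0 p (not_lt.1 hx)]

namespace Regular

variable {R M : ℝ} {V : VelocityDomain n} {σ : Space n → Space n → ℝ}
  {k : Space n → Space n → Space n → ℝ}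

theorem measurable_weighted_k (h : Regular R V σ k M) {Φ : Space n × Space n → ℝ≥0∞}
    (hΦ : Measurable Φ) : Measurable fun p : Space n × Space n =>
      ∫⁻ v, Φ (p.1, v) * ENNReal.ofReal (k p.1 p.2 v) ∂V.measure := by
  have hk : Measurable fun q : (Space n × Space n) × Space n => k q.1.1 q.1.2 q.2 :=
    h.k_measurable.comp (f := fun q : (Space n × Space n) × Space n =>
      (q.1.1, q.1.2, q.2)) (by fun_prop)
  exact Measurable.lintegral_prod_right' (f := fun q : (Space n × Space n) × Space n =>
    Φ (q.1.1, q.2) * ENNReal.ofReal (k q.1.1 q.1.2 q.2))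
    ((hΦ.comp (by fun_prop)).mul hk.ennreal_ofReal)

/-- Duality between scattering and integration of the scattering kernel over outgoing
velocities. -/
theorem lintegral_lscatter (h : Regular R V σ k M) {Φ F : Space n × Space n → ℝ≥0∞}
    (hΦ : Measurable Φ) (hF : Measurable F) :
    ∫⁻ p, ‖p.2‖ₑ⁻¹ * (Φ p * lscatter V k F p) ∂phaseMeasure R V =
      ∫⁻ p, ‖p.2‖ₑ⁻¹ * (F p * ∫⁻ v, Φ (p.1, v) * ENNReal.ofReal (k p.1 p.2 v) ∂V.measure)
        ∂phaseMeasure R V := by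
  have hm1 := h.measurable_lscatter hF
  have hm2 := h.measurable_weighted_k hΦ
  have hm3 : Measurable fun p => Φ p * lscatter V k F p := hΦ.mul hm1
  have hm4 : Measurable fun p : Space n × Space n =>
      F p * ∫⁻ v, Φ (p.1, v) * ENNReal.ofReal (k p.1 p.2 v) ∂V.measure := hF.mul hm2
  rw [lintegral_phase_inv hm3 fun p hp => by simp [h.lscatter_zero _ hp],
    lintegral_phase_inv hm4 fun p hp => by simp [h.k_zero _ _ _ hp],
    lintegral_prod _ hm3.aemeasurable, lintegral_prod _ hm4.aemeasurable]
  refine lintegral_congr fun y => ?_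
  have hk1 : ∀ v, Measurable fun v' => ENNReal.ofReal (k y v' v) * F (y, v') := fun v => by
    have : Measurable fun v' => k y v' v :=
      h.k_measurable.comp (f := fun v' => (y, v', v)) (by fun_prop)
    exact this.ennreal_ofReal.mul (hF.comp (by fun_prop))
  have hk2 : ∀ v', Measurable fun v => Φ (y, v) * ENNReal.ofReal (k y v' v) := fun v' => by
    have : Measurable fun v => k y v' v :=
      h.k_measurable.comp (f := fun v => (y, v', v)) (by fun_prop)
    exact (hΦ.comp (by fun_prop)).mul this.ennreal_ofReal
  calc ∫⁻ v, Φ (y, v) * lscatter V k F (y, v) ∂V.measure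
      = ∫⁻ v, ∫⁻ v', Φ (y, v) * (ENNReal.ofReal (k y v' v) * F (y, v')) ∂V.measure
          ∂V.measure := lintegral_congr fun v => (lintegral_const_mul _ (hk1 v)).symm
    _ = ∫⁻ v', ∫⁻ v, F (y, v') * (Φ (y, v) * ENNReal.ofReal (k y v' v)) ∂V.measure
          ∂V.measure := ?_
    _ = _ := lintegral_congr fun v' => lintegral_const_mul _ (hk2 v')
  rw [lintegral_lintegral_swap]
  · refine lintegral_congr fun v' => lintegral_congr fun v => ?_
    ring
  · have : Measurable fun q : Space n × Space n => k y q.2 q.1 :=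
      h.k_measurable.comp (f := fun q : Space n × Space n => (y, q.2, q.1)) (by fun_prop)
    exact ((hΦ.comp (f := fun q : Space n × Space n => (y, q.1)) (by fun_prop)).mul
      (this.ennreal_ofReal.mul
        (hF.comp (f := fun q : Space n × Space n => (y, q.2)) (by fun_prop)))).aemeasurable

/-- The integral of a scattered density along a whole characteristic line. -/
theorem enorm_opK_alongLine_le (h : Regular R V σ k M) (f : Space n × Space n → ℝ)
    {q : Space n × Space n} (hq : q ∈ discBundle R V) {t : ℝ} (ht : t ∈ Icc (-R) R) :
    ‖opK R V σ k f (alongLine (q, t))‖ₑ ≤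
      ‖q.2‖ₑ⁻¹ * ∫⁻ r in Ioo (-R) R, lscatter V k (fun p => ‖f p‖ₑ) (alongLine (q, r)) := by
  have hv := VelocityDomain.ne_zero hq.1
  rw [opK_alongLine R V σ k f hv hq.2.1, enorm_neg, enorm_mul, enorm_inv (by simpa using hv),
    enorm_norm, intervalIntegral.integral_of_le ht.1]
  gcongr
  refine (enorm_integral_le_lintegral_enorm _).trans ?_
  rw [restrict_Ioo_eq_restrict_Ioc]
  refine (lintegral_mono_ae ?_).trans (lintegral_mono_set (Ioc_subset_Ioc_right ht.2))
  filter_upwards [ae_restrict_mem measurableSet_Ioc] with r hr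
  rw [enorm_mul]
  refine le_trans ?_ (h.enorm_scatter_le f _)
  refine mul_le_of_le_one_left (zero_le) ?_
  rw [Real.enorm_of_nonneg (Real.exp_nonneg _), ENNReal.ofReal_le_one, Real.exp_le_one_iff,
    neg_nonpos]
  exact mul_nonneg (by positivity)
    (intervalIntegral.integral_nonneg hr.2 fun s _ => h.sigma_nonneg _ _)

end Regular

/-! ### Bounds for the operators -/

/-- A linear operation on integrable functions with an `L¹` bound defines an operator between
`L¹` spaces. -/
theorem exists_operator_L1 {α β : Type*} [MeasurableSpace α] [MeasurableSpace β]
    {μ : Measure α} {ν : Measure β} (Φ : (α → ℝ) → β → ℝ) {C : ℝ} (hC : 0 ≤ C)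
    (hmeas : ∀ f, Measurable f → Integrable f μ → AEStronglyMeasurable (Φ f) ν)
    (hadd : ∀ f g, Measurable f → Integrable f μ → Measurable g → Integrable g μ →
      Φ (f + g) =ᵐ[ν] Φ f + Φ g)
    (hsmul : ∀ (c : ℝ) f, Φ (c • f) =ᵐ[ν] c • Φ f)
    (hbound : ∀ f, Measurable f → Integrable f μ →
      ∫⁻ y, ‖Φ f y‖ₑ ∂ν ≤ ENNReal.ofReal C * ∫⁻ x, ‖f x‖ₑ ∂μ) :
    ∃ T : Lp ℝ 1 μ →L[ℝ] Lp ℝ 1 ν, ∀ (f : Lp ℝ 1 μ) (g : α → ℝ), Measurable g → f =ᵐ[μ] g →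
      T f =ᵐ[ν] Φ g := by
  have hm : ∀ f : Lp ℝ 1 μ, Measurable f := fun f => (Lp.stronglyMeasurable f).measurable
  have hi : ∀ f : Lp ℝ 1 μ, Integrable f μ := fun f => L1.integrable_coeFn f
  -- The bound makes `Φ` vanish almost everywhere on a null difference, and additivity then shows
  -- that `Φ` respects almost everywhere equality.
  have hcongr : ∀ f g, Measurable f → Measurable g → Integrable f μ → f =ᵐ[μ] g →
      Φ f =ᵐ[ν] Φ g := by
    intro f g hf hg hfi hfg
    have h0 : g - f =ᵐ[μ] 0 := by
      filter_upwards [hfg] with x hx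
      simp [hx]
    have hgi : Integrable g μ := hfi.congr hfg
    have h1 := hadd f (g - f) hf hfi (hg.sub hf) (hgi.sub hfi)
    have h2 : Φ (g - f) =ᵐ[ν] 0 := by
      have := hbound (g - f) (hg.sub hf) (hgi.sub hfi)
      have h3 : ∫⁻ x, ‖(g - f) x‖ₑ ∂μ = 0 := by
        rw [lintegral_eq_zero_iff (hg.sub hf).enorm]
        filter_upwards [h0] with x hx
        simp [hx]
      rw [h3, mul_zero, nonpos_iff_eq_zero,
        lintegral_eq_zero_iff' (hmeas _ (hg.sub hf) (hgi.sub hfi)).enorm] at this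
      filter_upwards [this] with y hy
      simpa using hy
    rw [add_sub_cancel] at h1
    filter_upwards [h1, h2] with y h1 h2
    simp [h1, h2]
  have h_int : ∀ f : Lp ℝ 1 μ, Integrable (Φ f) ν := fun f =>
    ⟨hmeas f (hm f) (hi f), (hbound f (hm f) (hi f)).trans_lt
      (ENNReal.mul_lt_top ENNReal.ofReal_lt_top (hi f).2)⟩
  let T₀ : Lp ℝ 1 μ →ₗ[ℝ] Lp ℝ 1 ν :=
    { toFun := fun f => (h_int f).toL1 (Φ f)
      map_add' := fun f g => by
        rw [← Integrable.toL1_add]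
        refine (Integrable.toL1_eq_toL1_iff _ _ _ _).2 ?_
        exact (hcongr _ _ (hm _) ((hm f).add (hm g)) (hi _) (Lp.coeFn_add f g)).trans
          (hadd f g (hm f) (hi f) (hm g) (hi g))
      map_smul' := fun c f => by
        rw [RingHom.id_apply, ← Integrable.toL1_smul]
        refine (Integrable.toL1_eq_toL1_iff _ _ _ _).2 ?_
        exact (hcongr _ _ (hm _) ((hm f).const_smul c) (hi _) (Lp.coeFn_smul c f)).trans
          (hsmul c f) }
  refine ⟨T₀.mkContinuous C fun f => ?_, fun f g hg hfg => ?_⟩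
  · change ‖(h_int f).toL1 (Φ f)‖ ≤ _
    have h1 := hbound f (hm f) (hi f)
    rw [Integrable.norm_toL1_eq_lintegral_norm, L1.norm_def]
    refine ENNReal.toReal_le_of_le_ofReal (by positivity) ?_
    rw [ENNReal.ofReal_mul hC, ENNReal.ofReal_toReal (hi f).2.ne]
    simpa only [ofReal_norm] using h1
  · exact ((h_int f).coeFn_toL1).trans (hcongr _ _ (hm f) hg (hi f) hfg)

theorem mem_line_of_mem_phase {R : ℝ} {V : VelocityDomain n} {p : Space n × Space n}
    (hp : p ∈ phaseSpace R V) :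
    foot p ∈ discBundle R V ∧ ⟪p.1, dir p.2⟫ ∈ Icc (-R) R ∧
      alongLine (foot p, ⟪p.1, dir p.2⟫) = p := by
  have hv := VelocityDomain.ne_zero hp.1
  refine ⟨⟨hp.1, ?_, hp.2.2⟩, ?_, ?_⟩
  · have := inner_perp_dir hv p.1
    rw [dir, inner_smul_right] at this
    simpa [hv, foot] using this
  · exact abs_le.1 hp.2.1.le
  · simp [alongLine, foot, perp_add_inner_smul]

theorem foot_shift {p : Space n × Space n} (hv : p.2 ≠ 0) (c : ℝ) :
    foot (shift c p) = foot p := by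
  simp [foot, shift, perp_add_smul hv]

theorem foot_alongLine {p : Space n × Space n} (hv : p.2 ≠ 0) (t : ℝ) :
    foot (alongLine (p, t)) = foot p := by
  simp [foot, alongLine, perp_add_smul hv]

theorem foot_eq_self {R : ℝ} {V : VelocityDomain n} {p : Space n × Space n}
    (hp : p ∈ discBundle R V) : foot p = p := by
  simp [foot, perp_eq_self (inner_dir_of_inner hp.2.1)]

theorem alongLine_eq_shift (p : Space n × Space n) (t : ℝ) : alongLine (p, t) = shift t p := rfl

theorem measurable_lineIntegral {R : ℝ} {G : Space n × Space n → ℝ≥0∞} (hG : Measurable G) :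
    Measurable fun q : Space n × Space n => ∫⁻ r in Ioo (-R) R, G (alongLine (q, r)) :=
  Measurable.lintegral_prod_right' (f := fun q => G (alongLine q)) (hG.comp measurable_alongLine)

/-- The weight `W` depends on the line only, so it can be moved inside the line integral; Tonelli
then yields an integral over phase space. -/
theorem lintegral_flux_line {R : ℝ} (hR : 0 < R) (V : VelocityDomain n) (c : ℝ)
    {W G : Space n × Space n → ℝ≥0∞} (hW : Measurable W) (hG : Measurable G) :
    ∫⁻ q, W (shift c q) * (‖q.2‖ₑ⁻¹ * ∫⁻ r in Ioo (-R) R, G (alongLine (q, r)))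
        ∂fluxMeasure R V 0 =
      ∫⁻ p, ‖p.2‖ₑ⁻¹ * (W (shift c (foot p)) * G p) ∂phaseMeasure R V := by
  have hW' := hW.comp ((measurable_shift c).comp measurable_foot)
  rw [lintegral_phase_line hR V (f := fun p => ‖p.2‖ₑ⁻¹ * (W (shift c (foot p)) * G p))
    ((by fun_prop : Measurable fun p : Space n × Space n => ‖p.2‖ₑ⁻¹).mul (hW'.mul hG))]
  refine lintegral_congr_ae ?_
  filter_upwards [ae_flux_zero_mem hR V] with q hq
  have hv := VelocityDomain.ne_zero hq.1
  have hm : Measurable fun r => G (alongLine (q, r)) :=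
    hG.comp (measurable_alongLine.comp measurable_prodMk_left)
  simp only [foot_alongLine hv, foot_eq_self hq]
  simp only [alongLine] at hm ⊢
  rw [← mul_assoc, ← lintegral_const_mul _ hm]
  refine lintegral_congr fun r => ?_
  ring

namespace Regular

variable {R M : ℝ} {V : VelocityDomain n} {σ : Space n → Space n → ℝ}
  {k : Space n → Space n → Space n → ℝ}

theorem enorm_opK_le (h : Regular R V σ k M) (f : Space n × Space n → ℝ)
    {p : Space n × Space n} (hp : p ∈ phaseSpace R V) :
    ‖opK R V σ k f p‖ₑ ≤ ‖p.2‖ₑ⁻¹ *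
      ∫⁻ r in Ioo (-R) R, lscatter V k (fun p => ‖f p‖ₑ) (alongLine (foot p, r)) := by
  obtain ⟨h1, h2, h3⟩ := mem_line_of_mem_phase hp
  have := h.enorm_opK_alongLine_le f h1 h2
  rwa [h3] at this

/-- The weighted `L¹(F₊)` bound for the outgoing trace of the scattered density. -/
theorem lintegral_flux_opK_le (h : Regular R V σ k M) (hR : 0 < R)
    {f : Space n × Space n → ℝ} (hf : Measurable f) {W : Space n × Space n → ℝ≥0∞}
    (hW : Measurable W) :
    ∫⁻ p, W p * ‖opK R V σ k f p‖ₑ ∂fluxMeasure R V R ≤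
      ∫⁻ p, ‖p.2‖ₑ⁻¹ * (‖f p‖ₑ * ∫⁻ v, W (shift R (foot (p.1, v))) *
        ENNReal.ofReal (k p.1 p.2 v) ∂V.measure) ∂phaseMeasure R V := by
  have hG := h.measurable_lscatter hf.enorm
  have hN : Measurable fun q : Space n × Space n => ‖q.2‖ₑ⁻¹ *
      ∫⁻ r in Ioo (-R) R, lscatter V k (fun p => ‖f p‖ₑ) (alongLine (q, r)) :=
    (by fun_prop : Measurable fun p : Space n × Space n => ‖p.2‖ₑ⁻¹).mul
      (measurable_lineIntegral hG)
  -- Duality transfers the weight from the outgoing line to the particle before its collision.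
  rw [← h.lintegral_lscatter (Φ := fun p => W (shift R (foot p)))
    (hW.comp ((measurable_shift R).comp measurable_foot)) hf.enorm]
  refine le_trans ?_ (lintegral_flux_line hR V R hW hG).le
  have hle : ∀ᵐ p ∂fluxMeasure R V R, W p * ‖opK R V σ k f p‖ₑ ≤ W p * (‖(foot p).2‖ₑ⁻¹ *
      ∫⁻ r in Ioo (-R) R, lscatter V k (fun p => ‖f p‖ₑ) (alongLine (foot p, r))) := by
    rw [ae_flux_iff hR]
    filter_upwards [ae_flux_zero_mem hR V] with q hq
    have hv := VelocityDomain.ne_zero hq.1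
    rw [foot_shift hv, foot_eq_self hq]
    gcongr
    exact h.enorm_opK_alongLine_le f hq ⟨by linarith, le_rfl⟩
  refine (lintegral_mono_ae hle).trans ?_
  refine ((measurePreserving_shift hR V R (zero_add R)).lintegral_comp
    (hW.mul (hN.comp measurable_foot))).symm.le.trans ?_
  refine (lintegral_congr_ae ?_).le
  filter_upwards [ae_flux_zero_mem hR V] with q hq
  have hv := VelocityDomain.ne_zero hq.1
  simp only [Pi.mul_apply, Function.comp_apply]
  rw [foot_shift hv, foot_eq_self hq]

/-- The weighted `L¹(O)` bound for the scattered density. -/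
theorem lintegral_phase_opK_le (h : Regular R V σ k M) (hR : 0 < R)
    {f : Space n × Space n → ℝ} (hf : Measurable f) {W : Space n × Space n → ℝ≥0∞}
    (hW : Measurable W) :
    ∫⁻ p, W p * ‖opK R V σ k f p‖ₑ ∂phaseMeasure R V ≤
      ∫⁻ p, ‖p.2‖ₑ⁻¹ * (‖f p‖ₑ * ∫⁻ v, (∫⁻ t in Ioo (-R) R, W (alongLine (foot (p.1, v), t))) *
        ENNReal.ofReal (k p.1 p.2 v) ∂V.measure) ∂phaseMeasure R V := by
  have hG := h.measurable_lscatter hf.enorm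
  have hN : Measurable fun q : Space n × Space n => ‖q.2‖ₑ⁻¹ *
      ∫⁻ r in Ioo (-R) R, lscatter V k (fun p => ‖f p‖ₑ) (alongLine (q, r)) :=
    (by fun_prop : Measurable fun p : Space n × Space n => ‖p.2‖ₑ⁻¹).mul
      (measurable_lineIntegral hG)
  have hWl := measurable_lineIntegral (R := R) hW
  rw [← h.lintegral_lscatter (Φ := fun p => ∫⁻ t in Ioo (-R) R, W (alongLine (foot p, t)))
    (hWl.comp measurable_foot) hf.enorm]
  have key := lintegral_flux_line hR V 0 hWl hG
  simp only [shift_zero] at key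
  refine le_trans ?_ key.le
  have hle : ∀ᵐ p ∂phaseMeasure R V, W p * ‖opK R V σ k f p‖ₑ ≤ W p * (‖(foot p).2‖ₑ⁻¹ *
      ∫⁻ r in Ioo (-R) R, lscatter V k (fun p => ‖f p‖ₑ) (alongLine (foot p, r))) := by
    filter_upwards [ae_phase_mem R V] with p hp
    gcongr
    exact h.enorm_opK_le f hp
  refine (lintegral_mono_ae hle).trans ?_
  refine (lintegral_phase_line hR V (hW.mul (hN.comp measurable_foot))).le.trans ?_
  refine (lintegral_congr_ae ?_).le
  filter_upwards [ae_flux_zero_mem hR V] with q hq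
  have hv := VelocityDomain.ne_zero hq.1
  have hm : Measurable fun r => W (alongLine (q, r)) :=
    hW.comp (measurable_alongLine.comp measurable_prodMk_left)
  simp only [Pi.mul_apply, Function.comp_apply, foot_alongLine hv, foot_eq_self hq]
  rw [← lintegral_mul_const _ hm]

end Regular

/-! ### Absorption and scattering along lines -/

/-- The attenuation from `y` forward to the exit point in the direction `v`. -/
def outAtt (R : ℝ) (σ : Space n → Space n → ℝ) (p : Space n × Space n) : ℝ :=
  Real.exp (-(‖p.2‖⁻¹ * ∫ s in (0 : ℝ)..(2 * R), σ (p.1 + s • dir p.2) p.2))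

/-- The attenuation from the entrance point in the direction `v` to `y`. -/
def inAtt (R : ℝ) (σ : Space n → Space n → ℝ) (p : Space n × Space n) : ℝ :=
  Real.exp (-(‖p.2‖⁻¹ * ∫ s in (0 : ℝ)..(2 * R), σ (p.1 - s • dir p.2) p.2))

theorem outAtt_pos (R : ℝ) (σ : Space n → Space n → ℝ) (p : Space n × Space n) :
    0 < outAtt R σ p := Real.exp_pos _

theorem inAtt_pos (R : ℝ) (σ : Space n → Space n → ℝ) (p : Space n × Space n) :
    0 < inAtt R σ p := Real.exp_pos _

theorem ofReal_inv_norm_le {V : VelocityDomain n} {c : ℝ} (hc : 0 < c)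
    (hcV : ∀ v ∈ V.carrier, c ≤ ‖v‖) {v : Space n} (hv : v ∈ V.carrier) :
    ‖v‖ₑ⁻¹ ≤ ENNReal.ofReal c⁻¹ := by
  rw [ENNReal.ofReal_inv_of_pos hc, ENNReal.inv_le_inv, ← ofReal_norm]
  exact ENNReal.ofReal_le_ofReal (hcV v hv)

namespace Regular

variable {R M : ℝ} {V : VelocityDomain n} {σ : Space n → Space n → ℝ}
  {k : Space n → Space n → Space n → ℝ}

theorem intervalIntegrable_sigma (h : Regular R V σ k M) (x e v : Space n) (a b : ℝ) :
    IntervalIntegrable (fun s => σ (x + s • e) v) volume a b := by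
  have hm : Measurable fun s : ℝ => σ (x + s • e) v :=
    h.sigma_measurable.comp (f := fun s : ℝ => (x + s • e, v)) (by fun_prop)
  refine (intervalIntegrable_const (c := M)).mono_fun hm.aestronglyMeasurable
    (Eventually.of_forall fun s => ?_)
  simp only
  rw [Real.norm_of_nonneg (h.sigma_nonneg _ _), Real.norm_of_nonneg h.bound_nonneg]
  exact h.sigma_le _ _

theorem sigma_line_zero (h : Regular R V σ k M) {q : Space n × Space n}
    (hq : q ∈ discBundle R V) {s : ℝ} (hs : R ≤ |s|) : σ (q.1 + s • dir q.2) q.2 = 0 := by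
  have hv := VelocityDomain.ne_zero hq.1
  refine h.sigma_zero _ _ (hs.trans ?_)
  have := abs_inner_dir_le hv (q.1 + s • dir q.2)
  rwa [inner_add_smul_dir hv, inner_dir_of_inner hq.2.1, zero_add] at this

/-- The fixed length `2 R` in the definition overshoots the entrance point, but the surplus lies at
parameters with `|s| ≥ R`, where `σ` vanishes. Thus the attenuation can be treated as a function of
the point and the velocity alone. -/
theorem inAtt_alongLine (h : Regular R V σ k M) {q : Space n × Space n}
    (hq : q ∈ discBundle R V) {t : ℝ} (ht : t ∈ Icc (-R) R) :
    inAtt R σ (alongLine (q, t)) =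
      Real.exp (-(‖q.2‖⁻¹ * ∫ s in (-R)..t, σ (q.1 + s • dir q.2) q.2)) := by
  simp only [inAtt, alongLine]
  rw [integral_backward (fun y => σ y q.2), ← intervalIntegral.integral_add_adjacent_intervals
    (h.intervalIntegrable_sigma _ _ _ _ (-R)) (h.intervalIntegrable_sigma _ _ _ _ _),
    intervalIntegral.integral_zero_ae, zero_add]
  refine Eventually.of_forall fun s hs => h.sigma_line_zero hq ?_
  rw [uIoc_of_le (by linarith [ht.2])] at hs
  exact le_abs.2 (Or.inr (by linarith [hs.2]))

theorem outAtt_alongLine (h : Regular R V σ k M) {q : Space n × Space n}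
    (hq : q ∈ discBundle R V) {t : ℝ} (ht : t ∈ Icc (-R) R) :
    outAtt R σ (alongLine (q, t)) =
      Real.exp (-(‖q.2‖⁻¹ * ∫ s in t..R, σ (q.1 + s • dir q.2) q.2)) := by
  simp only [outAtt, alongLine]
  have := intervalIntegral.integral_comp_add_left (a := 0) (b := 2 * R)
    (fun s => σ (q.1 + s • dir q.2) q.2) t
  simp only [add_smul, ← add_assoc, add_zero] at this
  rw [this, ← intervalIntegral.integral_add_adjacent_intervals (b := R)
    (h.intervalIntegrable_sigma _ _ _ _ _) (h.intervalIntegrable_sigma _ _ _ _ _),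
    intervalIntegral.integral_zero_ae (b := t + 2 * R), add_zero]
  refine Eventually.of_forall fun s hs => h.sigma_line_zero hq ?_
  rw [uIoc_of_le (by linarith [ht.1])] at hs
  exact le_abs.2 (Or.inl (by linarith [hs.1]))

theorem measurable_inAtt (h : Regular R V σ k M) (hR : 0 < R) : Measurable (inAtt R σ) := by
  have hd := measurable_dir (n := n)
  have h1 : Measurable fun q : (Space n × Space n) × ℝ => σ (q.1.1 - q.2 • dir q.1.2) q.1.2 :=
    h.sigma_measurable.comp (f := fun q : (Space n × Space n) × ℝ =>
      (q.1.1 - q.2 • dir q.1.2, q.1.2)) (by fun_prop)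
  have h2 : Measurable fun p : Space n × Space n =>
      ∫ s in (0 : ℝ)..(2 * R), σ (p.1 - s • dir p.2) p.2 := by
    simp_rw [intervalIntegral.integral_of_le (show 0 ≤ 2 * R by linarith)]
    exact h1.stronglyMeasurable.integral_prod_right'.measurable
  unfold inAtt
  fun_prop

theorem measurable_outAtt (h : Regular R V σ k M) (hR : 0 < R) : Measurable (outAtt R σ) := by
  have hd := measurable_dir (n := n)
  have h1 : Measurable fun q : (Space n × Space n) × ℝ => σ (q.1.1 + q.2 • dir q.1.2) q.1.2 :=
    h.sigma_measurable.comp (f := fun q : (Space n × Space n) × ℝ =>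
      (q.1.1 + q.2 • dir q.1.2, q.1.2)) (by fun_prop)
  have h2 : Measurable fun p : Space n × Space n =>
      ∫ s in (0 : ℝ)..(2 * R), σ (p.1 + s • dir p.2) p.2 := by
    simp_rw [intervalIntegral.integral_of_le (show 0 ≤ 2 * R by linarith)]
    exact h1.stronglyMeasurable.integral_prod_right'.measurable
  unfold outAtt
  fun_prop

theorem inAtt_le_one (h : Regular R V σ k M) (hR : 0 < R) (p : Space n × Space n) :
    inAtt R σ p ≤ 1 := by
  rw [inAtt, Real.exp_le_one_iff, neg_nonpos]
  exact mul_nonneg (by positivity)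
    (intervalIntegral.integral_nonneg (by linarith) fun s _ => h.sigma_nonneg _ _)

theorem outAtt_le_one (h : Regular R V σ k M) (hR : 0 < R) (p : Space n × Space n) :
    outAtt R σ p ≤ 1 := by
  rw [outAtt, Real.exp_le_one_iff, neg_nonpos]
  exact mul_nonneg (by positivity)
    (intervalIntegral.integral_nonneg (by linarith) fun s _ => h.sigma_nonneg _ _)

theorem opJ_line (h : Regular R V σ k M) (g : Space n × Space n → ℝ)
    {q : Space n × Space n} (hq : q ∈ discBundle R V) {t : ℝ} (ht : t ∈ Icc (-R) R) :
    opJ R σ g (alongLine (q, t)) = inAtt R σ (alongLine (q, t)) * g (shift (-R) q) := by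
  rw [opJ_alongLine R σ g (VelocityDomain.ne_zero hq.1) hq.2.1, h.inAtt_alongLine hq ht]

theorem opJ_phase (h : Regular R V σ k M) (g : Space n × Space n → ℝ)
    {p : Space n × Space n} (hp : p ∈ phaseSpace R V) :
    opJ R σ g p = inAtt R σ p * g (shift (-R) (foot p)) := by
  obtain ⟨h1, h2, h3⟩ := mem_line_of_mem_phase hp
  have := h.opJ_line g h1 h2
  rwa [h3] at this

theorem opK_exit (h : Regular R V σ k M) (hR : 0 < R) (f : Space n × Space n → ℝ)
    {q : Space n × Space n} (hq : q ∈ discBundle R V) :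
    opK R V σ k f (shift R q) = -(‖q.2‖⁻¹ * ∫ r in Ioo (-R) R,
      outAtt R σ (alongLine (q, r)) * scatter V k f (alongLine (q, r))) := by
  rw [← alongLine_eq_shift, opK_alongLine R V σ k f (VelocityDomain.ne_zero hq.1) hq.2.1,
    intervalIntegral.integral_of_le (by linarith), integral_Ioc_eq_integral_Ioo]
  congr 2
  refine setIntegral_congr_fun measurableSet_Ioo fun r hr => ?_
  rw [h.outAtt_alongLine hq ⟨hr.1.le, hr.2.le⟩]

/-- The attenuation between `r` and `t` is a quotient of attenuations counted from `-R`. After this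
factorization, `t` occurs only in a continuous factor and as an endpoint of an integral, which gives
continuity along the line. -/
theorem opK_line_factor (h : Regular R V σ k M) (f : Space n × Space n → ℝ)
    {q : Space n × Space n} (hq : q ∈ discBundle R V) (t : ℝ) :
    opK R V σ k f (alongLine (q, t)) =
      -(‖q.2‖⁻¹ * (Real.exp (-(‖q.2‖⁻¹ * ∫ s in (-R)..t, σ (q.1 + s • dir q.2) q.2)) *
        ∫ r in (-R)..t, Real.exp (‖q.2‖⁻¹ * ∫ s in (-R)..r, σ (q.1 + s • dir q.2) q.2) *
          scatter V k f (alongLine (q, r)))) := by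
  rw [opK_alongLine R V σ k f (VelocityDomain.ne_zero hq.1) hq.2.1]
  congr 2
  rw [← intervalIntegral.integral_const_mul]
  refine intervalIntegral.integral_congr fun r _ => ?_
  rw [← mul_assoc, ← Real.exp_add]
  congr 2
  rw [← intervalIntegral.integral_add_adjacent_intervals
    (h.intervalIntegrable_sigma q.1 _ _ (-R) r) (h.intervalIntegrable_sigma _ _ _ r t)]
  ring

theorem continuous_depth (h : Regular R V σ k M) (q : Space n × Space n) :
    Continuous fun t => ∫ s in (-R)..t, σ (q.1 + s • dir q.2) q.2 :=
  intervalIntegral.continuous_primitive (fun a b => h.intervalIntegrable_sigma _ _ _ a b) _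

/-- Scattered densities are integrable along almost every characteristic line. -/
theorem ae_line_lscatter_lt_top (h : Regular R V σ k M) (hR : 0 < R)
    {f : Space n × Space n → ℝ} (hf : Measurable f) (hfi : Integrable f (phaseMeasure R V)) :
    ∀ᵐ q ∂fluxMeasure R V 0,
      ∫⁻ r in Ioo (-R) R, lscatter V k (fun p => ‖f p‖ₑ) (alongLine (q, r)) < ∞ := by
  obtain ⟨c, hc, hcV⟩ := V.exists_le_norm
  have hG := h.measurable_lscatter hf.enorm
  -- For constant weights, duality reduces the finiteness to the bounds `σ_p ≤ M` and `|v| ≥ c`.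
  have h1 := lintegral_flux_line hR V 0 (W := 1) measurable_one hG
  have h2 := h.lintegral_lscatter (Φ := 1) measurable_one hf.enorm
  simp only [Pi.one_apply, one_mul] at h1 h2
  rw [h2] at h1
  have h3 : ∫⁻ p, ‖p.2‖ₑ⁻¹ * (‖f p‖ₑ * ∫⁻ v, ENNReal.ofReal (k p.1 p.2 v) ∂V.measure)
      ∂phaseMeasure R V < ∞ := by
    refine lt_of_le_of_lt (b := ∫⁻ p, ENNReal.ofReal c⁻¹ * (‖f p‖ₑ * ENNReal.ofReal M)
      ∂phaseMeasure R V) (lintegral_mono_ae ?_) ?_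
    · filter_upwards [ae_phase_mem R V] with p hp
      gcongr
      · exact ofReal_inv_norm_le hc hcV hp.1
      · exact h.lintegral_k_le _ _
    · rw [lintegral_const_mul' _ _ ENNReal.ofReal_ne_top,
        lintegral_mul_const' _ _ ENNReal.ofReal_ne_top]
      exact ENNReal.mul_lt_top ENNReal.ofReal_lt_top
        (ENNReal.mul_lt_top hfi.2 ENNReal.ofReal_lt_top)
  have h4 := ae_lt_top ((by fun_prop : Measurable fun p : Space n × Space n => ‖p.2‖ₑ⁻¹).mul
    (measurable_lineIntegral hG)) (h1.trans_lt h3).ne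
  filter_upwards [h4] with q hq
  simp only [Pi.mul_apply] at hq
  by_contra! htop
  rw [top_le_iff.1 htop, ENNReal.mul_top (by simp)] at hq
  exact lt_irrefl _ hq

theorem integrableOn_scatter_line (h : Regular R V σ k M) {f : Space n × Space n → ℝ}
    (hf : Measurable f) {q : Space n × Space n}
    (hq : ∫⁻ r in Ioo (-R) R, lscatter V k (fun p => ‖f p‖ₑ) (alongLine (q, r)) < ∞) :
    IntegrableOn (fun r => scatter V k f (alongLine (q, r))) (Ioo (-R) R) := by
  refine ⟨((h.stronglyMeasurable_scatter hf).measurable.comp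
    (measurable_alongLine.comp measurable_prodMk_left)).aestronglyMeasurable, ?_⟩
  exact (lintegral_mono fun r => h.enorm_scatter_le f _).trans_lt hq

theorem ae_integrable_scatter (h : Regular R V σ k M) {f : Space n × Space n → ℝ}
    (hf : Measurable f) {q : Space n × Space n}
    (hq : ∫⁻ r in Ioo (-R) R, lscatter V k (fun p => ‖f p‖ₑ) (alongLine (q, r)) < ∞) :
    ∀ᵐ r ∂(volume : Measure ℝ).restrict (Ioo (-R) R), Integrable (fun v' =>
      k (alongLine (q, r)).1 v' (alongLine (q, r)).2 * f ((alongLine (q, r)).1, v'))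
        V.measure := by
  filter_upwards [ae_lt_top ((h.measurable_lscatter hf.enorm).comp
    (measurable_alongLine.comp measurable_prodMk_left)) hq.ne] with r hr
  have hk : Measurable fun v' => k (alongLine (q, r)).1 v' (alongLine (q, r)).2 :=
    h.k_measurable.comp (f := fun v' => ((alongLine (q, r)).1, v', (alongLine (q, r)).2))
      (by fun_prop)
  refine ⟨(hk.mul (hf.comp (f := fun v' => ((alongLine (q, r)).1, v'))
    (by fun_prop))).aestronglyMeasurable, lt_of_le_of_lt (lintegral_mono fun v' => ?_) hr⟩
  rw [enorm_mul, Real.enorm_of_nonneg (h.k_nonneg _ _ _)]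
  exact le_rfl

theorem integrableOn_outAtt_mul (h : Regular R V σ k M) (hR : 0 < R)
    {f : Space n × Space n → ℝ} (hf : Measurable f) {q : Space n × Space n}
    (hq : ∫⁻ r in Ioo (-R) R, lscatter V k (fun p => ‖f p‖ₑ) (alongLine (q, r)) < ∞) :
    IntegrableOn (fun r => outAtt R σ (alongLine (q, r)) * scatter V k f (alongLine (q, r)))
      (Ioo (-R) R) := by
  refine (h.integrableOn_scatter_line hf hq).bdd_mul (c := 1)
    ((h.measurable_outAtt hR).comp
      (measurable_alongLine.comp measurable_prodMk_left)).aestronglyMeasurable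
    (Eventually.of_forall fun r => ?_)
  rw [Real.norm_of_nonneg (outAtt_pos _ _ _).le]
  exact h.outAtt_le_one hR _

theorem continuousOn_opK_line (h : Regular R V σ k M) (hR : 0 < R)
    {f : Space n × Space n → ℝ} (hf : Measurable f) {q : Space n × Space n}
    (hqF : q ∈ discBundle R V)
    (hq : ∫⁻ r in Ioo (-R) R, lscatter V k (fun p => ‖f p‖ₑ) (alongLine (q, r)) < ∞) :
    ContinuousOn (fun t => opK R V σ k f (alongLine (q, t))) (Icc (-R) R) := by
  simp_rw [h.opK_line_factor f hqF]
  have hS := h.continuous_depth q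
  have h_int : IntegrableOn (fun r =>
      Real.exp (‖q.2‖⁻¹ * ∫ s in (-R)..r, σ (q.1 + s • dir q.2) q.2) *
        scatter V k f (alongLine (q, r))) (Icc (-R) R) := by
    have hi : IntegrableOn (fun r => scatter V k f (alongLine (q, r))) (Icc (-R) R) := by
      rw [integrableOn_Icc_iff_integrableOn_Ioo]
      exact h.integrableOn_scatter_line hf hq
    exact hi.continuousOn_mul (by fun_prop) isCompact_Icc
  have hc := intervalIntegral.continuousOn_primitive_interval (a := -R) (b := R)
    (by rwa [uIcc_of_le (by linarith)])
  rw [uIcc_of_le (by linarith)] at hc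
  refine ((ContinuousOn.mul ?_ hc).const_mul _).neg
  exact (Continuous.continuousOn (by fun_prop))

theorem continuous_opJ_line (h : Regular R V σ k M) (g : Space n × Space n → ℝ)
    {q : Space n × Space n} (hq : q ∈ discBundle R V) :
    Continuous fun t => opJ R σ g (alongLine (q, t)) := by
  simp_rw [opJ_alongLine R σ g (VelocityDomain.ne_zero hq.1) hq.2.1]
  have hS := h.continuous_depth q
  fun_prop

end Regular

/-! ### The albedo operator -/

theorem lintegral_phase_foot {R : ℝ} (hR : 0 < R) (V : VelocityDomain n) (c : ℝ)
    {G : Space n × Space n → ℝ≥0∞} (hG : Measurable G) :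
    ∫⁻ p, G (shift c (foot p)) ∂phaseMeasure R V =
      ENNReal.ofReal (2 * R) * ∫⁻ p, G p ∂fluxMeasure R V c := by
  rw [fluxMeasure_eq_map hR, lintegral_smul_measure, smul_eq_mul, ← mul_assoc,
    ENNReal.mul_inv_cancel (by simpa using hR) ENNReal.ofReal_ne_top, one_mul]
  exact (lintegral_map hG ((measurable_shift c).comp measurable_foot)).symm

/-- The extension of an incoming condition into phase space by absorption only. -/
def ballistic (R : ℝ) (σ : Space n → Space n → ℝ) (g : Space n × Space n → ℝ)
    (p : Space n × Space n) : ℝ :=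
  inAtt R σ p * g (shift (-R) (foot p))

theorem scatter_smul (V : VelocityDomain n) (k : Space n → Space n → Space n → ℝ) (c : ℝ)
    (f : Space n × Space n → ℝ) (p : Space n × Space n) :
    scatter V k (c • f) p = c * scatter V k f p := by
  simp only [scatter, Pi.smul_apply, smul_eq_mul]
  rw [← integral_const_mul]
  congr 1
  funext v'
  ring

theorem opK_smul (R : ℝ) (V : VelocityDomain n) (σ : Space n → Space n → ℝ)
    (k : Space n → Space n → Space n → ℝ) (c : ℝ)
    (f : Space n × Space n → ℝ) (p : Space n × Space n) :
    opK R V σ k (c • f) p = c * opK R V σ k f p := by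
  simp only [opK, scatter_smul]
  rw [mul_neg, mul_left_comm c]
  congr 2
  rw [← intervalIntegral.integral_const_mul]
  refine intervalIntegral.integral_congr fun t _ => ?_
  ring

namespace Regular

variable {R M : ℝ} {V : VelocityDomain n} {σ : Space n → Space n → ℝ}
  {k : Space n → Space n → Space n → ℝ}

theorem measurable_ballistic (h : Regular R V σ k M) (hR : 0 < R) {g : Space n × Space n → ℝ}
    (hg : Measurable g) : Measurable (ballistic R σ g) :=
  (h.measurable_inAtt hR).mul (hg.comp ((measurable_shift _).comp measurable_foot))

theorem opJ_ae_phase (h : Regular R V σ k M) (g : Space n × Space n → ℝ) :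
    opJ R σ g =ᵐ[phaseMeasure R V] ballistic R σ g := by
  filter_upwards [ae_phase_mem R V] with p hp
  exact h.opJ_phase g hp

theorem opJ_ae_flux (h : Regular R V σ k M) (hR : 0 < R) (g : Space n × Space n → ℝ) :
    opJ R σ g =ᵐ[fluxMeasure R V R] ballistic R σ g := by
  refine (ae_flux_iff hR R).2 ?_
  filter_upwards [ae_flux_zero_mem hR V] with q hq
  have := h.opJ_line g hq (t := R) ⟨by linarith, le_rfl⟩
  rw [alongLine_eq_shift] at this
  rw [this, ballistic, foot_shift (VelocityDomain.ne_zero hq.1), foot_eq_self hq]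

theorem enorm_ballistic_le (h : Regular R V σ k M) (hR : 0 < R) (g : Space n × Space n → ℝ)
    (p : Space n × Space n) : ‖ballistic R σ g p‖ₑ ≤ ‖g (shift (-R) (foot p))‖ₑ := by
  rw [ballistic, enorm_mul]
  refine mul_le_of_le_one_left zero_le ?_
  rw [Real.enorm_of_nonneg (inAtt_pos _ _ _).le, ENNReal.ofReal_le_one]
  exact h.inAtt_le_one hR p

/-- The constant `2 * R` is the length of a characteristic line inside `O`; absorption only
decreases the density. -/
theorem exists_operator_ballistic (h : Regular R V σ k M) (hR : 0 < R) :
    ∃ J : L1In R V →L[ℝ] L1O R V, ∀ (g : L1In R V) (g' : Space n × Space n → ℝ),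
      Measurable g' → g =ᵐ[fluxMeasure R V (-R)] g' →
        J g =ᵐ[phaseMeasure R V] ballistic R σ g' := by
  exact exists_operator_L1 (μ := fluxMeasure R V (-R)) (ν := phaseMeasure R V)
    (ballistic R σ) (C := 2 * R) (by linarith)
    (fun g hg _ => (h.measurable_ballistic hR hg).aestronglyMeasurable)
    (fun f g _ _ _ _ => Eventually.of_forall fun p => by simp [ballistic, mul_add])
    (fun c f => Eventually.of_forall fun p => by simp [ballistic, mul_left_comm])
    (fun g hg _ => by
      rw [← lintegral_phase_foot hR V (-R) hg.enorm]
      exact lintegral_mono fun p => h.enorm_ballistic_le hR g p)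

theorem exists_operator_ballistic_exit (h : Regular R V σ k M) (hR : 0 < R) :
    ∃ J : L1In R V →L[ℝ] L1Out R V,
      ∀ (g : L1In R V) (g' : Space n × Space n → ℝ),
        Measurable g' → g =ᵐ[fluxMeasure R V (-R)] g' →
          J g =ᵐ[fluxMeasure R V R] ballistic R σ g' := by
  exact exists_operator_L1 (μ := fluxMeasure R V (-R)) (ν := fluxMeasure R V R)
    (ballistic R σ) (C := 1) zero_le_one
    (fun g hg _ => (h.measurable_ballistic hR hg).aestronglyMeasurable)
    (fun f g _ _ _ _ => Eventually.of_forall fun p => by simp [ballistic, mul_add])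
    (fun c f => Eventually.of_forall fun p => by simp [ballistic, mul_left_comm])
    (fun g hg _ => by
      have hle : ∀ᵐ p ∂fluxMeasure R V R, ‖ballistic R σ g p‖ₑ ≤ ‖g (shift (-(2 * R)) p)‖ₑ := by
        refine (ae_flux_iff hR R).2 ?_
        filter_upwards [ae_flux_zero_mem hR V] with q hq
        refine (h.enorm_ballistic_le hR g _).trans ?_
        rw [foot_shift (VelocityDomain.ne_zero hq.1), foot_eq_self hq, shift_shift]
        ring_nf
        exact le_rfl
      refine (lintegral_mono_ae hle).trans ?_
      rw [(measurePreserving_shift hR V (-(2 * R)) (by ring : R + -(2 * R) = -R)).lintegral_comp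
        hg.enorm]
      simp)

/-- The Bochner integral is additive only on integrable functions, so additivity is claimed for
almost every line: those on which both scattered densities have a finite integral. -/
theorem opK_add (h : Regular R V σ k M) (hR : 0 < R) {f g : Space n × Space n → ℝ}
    (hf : Measurable f) (hfi : Integrable f (phaseMeasure R V)) (hg : Measurable g)
    (hgi : Integrable g (phaseMeasure R V)) :
    opK R V σ k (f + g) =ᵐ[fluxMeasure R V R] opK R V σ k f + opK R V σ k g := by
  refine (ae_flux_iff hR R).2 ?_
  filter_upwards [ae_flux_zero_mem hR V, h.ae_line_lscatter_lt_top hR hf hfi,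
    h.ae_line_lscatter_lt_top hR hg hgi] with q hq hqf hqg
  rw [Pi.add_apply, h.opK_exit hR _ hq, h.opK_exit hR _ hq, h.opK_exit hR _ hq, ← neg_add,
    ← mul_add, ← integral_add (h.integrableOn_outAtt_mul hR hf hqf)
      (h.integrableOn_outAtt_mul hR hg hqg)]
  congr 2
  refine integral_congr_ae ?_
  filter_upwards [h.ae_integrable_scatter hf hqf, h.ae_integrable_scatter hg hqg] with r hrf hrg
  rw [← mul_add]
  congr 1
  simp only [scatter, Pi.add_apply, mul_add]
  exact integral_add hrf hrg

/-- At the exit point the line integral runs over the fixed interval `(-R, R)` with the weight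
`outAtt`, and such a parametric integral is measurable. -/
theorem aestronglyMeasurable_opK (h : Regular R V σ k M) (hR : 0 < R)
    {f : Space n × Space n → ℝ} (hf : Measurable f) :
    AEStronglyMeasurable (opK R V σ k f) (fluxMeasure R V R) := by
  have h1 : Measurable fun p : Space n × Space n =>
      outAtt R σ p * scatter V k f p :=
    (h.measurable_outAtt hR).mul (h.stronglyMeasurable_scatter hf).measurable
  have h2 : Measurable fun q : Space n × Space n => ∫ r in Ioo (-R) R,
      outAtt R σ (alongLine (q, r)) * scatter V k f (alongLine (q, r)) :=
    (h1.comp measurable_alongLine).stronglyMeasurable.integral_prod_right'.measurable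
  have h3 : Measurable fun p : Space n × Space n => -(‖p.2‖⁻¹ * ∫ r in Ioo (-R) R,
      outAtt R σ (alongLine (foot p, r)) * scatter V k f (alongLine (foot p, r))) :=
    ((by fun_prop : Measurable fun p : Space n × Space n => ‖p.2‖⁻¹).mul
      (h2.comp measurable_foot)).neg
  refine h3.aestronglyMeasurable.congr ?_
  refine (ae_flux_iff hR R).2 ?_
  filter_upwards [ae_flux_zero_mem hR V] with q hq
  rw [h.opK_exit hR f hq, foot_shift (VelocityDomain.ne_zero hq.1), foot_eq_self hq]
  rfl

/-- The trace of `K f` on `F₊` depends boundedly on `f ∈ L¹(O)`, with constant `M / c`: the total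
scattering is at most `M`, and speeds are at least `c`. -/
theorem exists_operator_exit (h : Regular R V σ k M) (hR : 0 < R) :
    ∃ T : L1O R V →L[ℝ] L1Out R V, ∀ (f : L1O R V) (g : Space n × Space n → ℝ), Measurable g →
      f =ᵐ[phaseMeasure R V] g → T f =ᵐ[fluxMeasure R V R] opK R V σ k g := by
  obtain ⟨c, hc, hcV⟩ := V.exists_le_norm
  have hM := h.bound_nonneg
  refine exists_operator_L1 (opK R V σ k) (C := c⁻¹ * M) (by positivity)
    (fun f hf _ => h.aestronglyMeasurable_opK hR hf)
    (fun f g hf hfi hg hgi => h.opK_add hR hf hfi hg hgi)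
    (fun c f => Eventually.of_forall fun p => opK_smul R V σ k c f p) fun f hf _ => ?_
  have h1 := h.lintegral_flux_opK_le hR hf (W := 1) measurable_one
  simp only [Pi.one_apply, one_mul] at h1
  refine h1.trans ?_
  rw [← lintegral_const_mul' _ _ ENNReal.ofReal_ne_top]
  refine lintegral_mono_ae ?_
  filter_upwards [ae_phase_mem R V] with p hp
  rw [ENNReal.ofReal_mul (by positivity), mul_assoc, mul_comm (ENNReal.ofReal M)]
  gcongr
  · exact ofReal_inv_norm_le hc hcV hp.1
  · exact h.lintegral_k_le _ _

/-- The outgoing trace of a solution of the transport equation. -/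
theorem isOutgoingTrace_iff (h : Regular R V σ k M) (hR : 0 < R)
    {f g G : Space n × Space n → ℝ} (hf : Measurable f)
    (hfi : Integrable f (phaseMeasure R V))
    (heq : (fun p => f p + opK R V σ k f p) =ᵐ[phaseMeasure R V] opJ R σ g) :
    IsOutgoingTrace R V f G ↔
      G =ᵐ[fluxMeasure R V R] fun p => opJ R σ g p - opK R V σ k f p := by
  have hcont : ∀ᵐ q ∂fluxMeasure R V 0,
      ContinuousOn (fun t => opJ R σ g (alongLine (q, t)) - opK R V σ k f (alongLine (q, t)))
        (Icc (-R) R) ∧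
      ∀ᵐ t ∂(volume : Measure ℝ).restrict (Ioo (-R) R), f (alongLine (q, t)) =
        opJ R σ g (alongLine (q, t)) - opK R V σ k f (alongLine (q, t)) := by
    filter_upwards [ae_flux_zero_mem hR V, h.ae_line_lscatter_lt_top hR hf hfi,
      ae_line_of_ae_phase hR heq] with q hq hqf hqe
    refine ⟨(h.continuous_opJ_line g hq).continuousOn.sub
      (h.continuousOn_opK_line hR hf hq hqf), ?_⟩
    filter_upwards [hqe] with t ht
    rw [← ht]
    ring
  refine Iff.trans ?_ (ae_flux_iff hR R).symm
  constructor
  · intro htr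
    filter_upwards [hcont, htr] with q hq ⟨φ, hφ, hφf, hφR⟩
    -- Two functions that are continuous on `[-R, R]` and agree almost everywhere also agree at the
    -- endpoint `R`, so the trace is unambiguous.
    have hEq : EqOn φ (fun t => opJ R σ g (alongLine (q, t)) - opK R V σ k f (alongLine (q, t)))
        (Icc (-R) R) := by
      refine Measure.eqOn_Icc_of_ae_eq volume (by linarith : -R ≠ R) ?_ hφ hq.1
      rw [← restrict_Ioo_eq_restrict_Icc]
      filter_upwards [hφf, hq.2] with t h1 h2
      rw [← h1, ← h2]
      rfl
    exact hφR.trans (hEq ⟨by linarith, le_rfl⟩)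
  · intro hG
    filter_upwards [hcont, hG] with q hq hGq
    exact ⟨_, hq.1, hq.2, hGq⟩

/-- Existence and uniqueness of the albedo operator, and the expansion of its values with respect
to the number of scattering events. -/
theorem exists_albedo (h : Regular R V σ k M) (hR : 0 < R) (hsub : Subcritical R V σ k) :
    ∃ A : L1In R V →L[ℝ] L1Out R V, IsAlbedo R V σ k A ∧ (∀ A', IsAlbedo R V σ k A' → A' = A) ∧
      ∃ C : ℝ, 0 ≤ C ∧ ∀ (g : L1In R V) (g' : Space n × Space n → ℝ), Measurable g' →
        g =ᵐ[fluxMeasure R V (-R)] g' → ∃ u w : Space n × Space n → ℝ,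
        Measurable u ∧ Measurable w ∧
        ∫⁻ p, ‖u p‖ₑ ∂phaseMeasure R V ≤ ENNReal.ofReal (C * ‖g‖) ∧
        w =ᵐ[phaseMeasure R V] opK R V σ k u ∧
        A g =ᵐ[fluxMeasure R V R] (fun p => ballistic R σ g' p - opK R V σ k u p) ∧
        A g =ᵐ[fluxMeasure R V R] (fun p => ballistic R σ g' p -
          opK R V σ k (ballistic R σ g') p + opK R V σ k w p) := by
  obtain ⟨B, hB⟩ := hsub
  obtain ⟨J, hJ⟩ := h.exists_operator_ballistic hR
  obtain ⟨Jp, hJp⟩ := h.exists_operator_ballistic_exit hR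
  obtain ⟨T, hT⟩ := h.exists_operator_exit hR
  have hm : ∀ f : L1O R V, Measurable f := fun f => (Lp.stronglyMeasurable f).measurable
  have hmIn : ∀ g : L1In R V, Measurable g := fun g => (Lp.stronglyMeasurable g).measurable
  have hJ' := fun g : L1In R V => hJ g g (hmIn g) EventuallyEq.rfl
  have hsol : ∀ g : L1In R V, (fun p => B (J g) p + opK R V σ k (B (J g)) p)
      =ᵐ[phaseMeasure R V] opJ R σ g := fun g =>
    ((hB (B (J g)) (J g)).2 rfl).trans ((hJ' g).trans (h.opJ_ae_phase g).symm)
  -- The solution for `g` is `f = B (J g)`, and its trace is the trace of `J g - K f`.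
  let A := Jp - T.comp (B.comp J)
  have hA' : ∀ (g : L1In R V) (g' : Space n × Space n → ℝ), Measurable g' →
      g =ᵐ[fluxMeasure R V (-R)] g' → A g =ᵐ[fluxMeasure R V R]
      fun p => ballistic R σ g' p - opK R V σ k (B (J g)) p := fun g g' hg' hgg' => by
    filter_upwards [Lp.coeFn_sub (Jp g) (T (B (J g))), hJp g g' hg' hgg',
      hT (B (J g)) _ (hm _) EventuallyEq.rfl] with p h1 h2 h3
    rw [← h2, ← h3]
    exact h1
  have hA := fun g : L1In R V => hA' g g (hmIn g) EventuallyEq.rfl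
  -- The expansion uses `u = B (J g)`, the full solution, and `w = J g - u`, which equals `K u` by
  -- the equation.
  refine ⟨A, fun g => ⟨B (J g), hsol g, ?_⟩, fun A₁ hA₁ => ?_, ‖B‖ * ‖J‖, by positivity,
    fun g g' hg' hgg' => ⟨B (J g), fun p => J g p - B (J g) p, hm _, (hm _).sub (hm _), ?_, ?_,
      hA' g g' hg' hgg', ?_⟩⟩
  · rw [h.isOutgoingTrace_iff hR (hm _) (L1.integrable_coeFn _) (hsol g)]
    filter_upwards [hA g, h.opJ_ae_flux hR g] with p h1 h2
    rw [h1, h2]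
  · ext1 g
    obtain ⟨f, hf, htr⟩ := hA₁ g
    have hfB : f = B (J g) :=
      (hB f (J g)).1 (hf.trans ((h.opJ_ae_phase g).trans (hJ' g).symm))
    rw [h.isOutgoingTrace_iff hR (hm _) (L1.integrable_coeFn _) hf] at htr
    refine Lp.ext ?_
    filter_upwards [hA g, htr, h.opJ_ae_flux hR g] with p h1 h2 h3
    rw [h1, h2, h3, hfB]
  · have h1 : ‖B (J g)‖ ≤ ‖B‖ * ‖J‖ * ‖g‖ := by
      refine (B.le_opNorm _).trans ?_
      rw [mul_assoc]
      gcongr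
      exact J.le_opNorm g
    refine le_trans ?_ (ENNReal.ofReal_le_ofReal h1)
    rw [L1.norm_def, ENNReal.ofReal_toReal (L1.integrable_coeFn (B (J g))).2.ne]
  · filter_upwards [(hsol g).trans ((h.opJ_ae_phase g).trans (hJ' g).symm)] with p hp
    rw [← hp]
    ring
  · have h1 := hT (J g) _ (h.measurable_ballistic hR hg') (hJ g g' hg' hgg')
    have h2 := hT (J g - B (J g)) (fun p => J g p - B (J g) p) ((hm _).sub (hm _))
      (Lp.coeFn_sub _ _)
    have h3 := hT (B (J g)) _ (hm _) EventuallyEq.rfl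
    rw [map_sub] at h2
    filter_upwards [hA' g g' hg' hgg', h1, h2, h3, Lp.coeFn_sub (T (J g)) (T (B (J g)))] with p a1 a2 a3 a4 a5
    rw [a1, ← a2, ← a3, ← a4, a5, Pi.sub_apply]
    ring

end Regular

/-! ### Distance of characteristic lines from a fixed line -/

/-- The parameter of the point of the line `x₀ + ℝ e` nearest to the line through `x` in the
direction `v`. -/
def nearParam (x₀ e : Space n) (p : Space n × Space n) : ℝ :=
  ⟪perp p.2 (p.1 - x₀), perp p.2 e⟫ / ‖perp p.2 e‖ ^ 2

/-- The distance between the line `x₀ + ℝ e` and the line through `x` in the direction `v`. -/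
def nearDist (x₀ e : Space n) (p : Space n × Space n) : ℝ :=
  ‖perp p.2 (p.1 - x₀) - nearParam x₀ e p • perp p.2 e‖

theorem perp_sub (v x y : Space n) : perp v (x - y) = perp v x - perp v y := by
  simp only [perp, inner_sub_left, sub_smul]
  abel

theorem perp_smul (v x : Space n) (t : ℝ) : perp v (t • x) = t • perp v x := by
  simp only [perp, inner_smul_left, smul_sub, mul_smul]
  simp

theorem continuous_perp (v : Space n) : Continuous (perp v) := by
  unfold perp; fun_prop

theorem measurable_nearParam (x₀ e : Space n) : Measurable (nearParam x₀ e) := by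
  have hd := measurable_dir (n := n)
  unfold nearParam perp; fun_prop

theorem measurable_nearDist (x₀ e : Space n) : Measurable (nearDist x₀ e) := by
  have hd := measurable_dir (n := n)
  have hn := measurable_nearParam x₀ e
  unfold nearDist perp; fun_prop

theorem continuous_nearParam (x₀ e v : Space n) : Continuous fun x => nearParam x₀ e (x, v) := by
  have h : Continuous fun x => perp v (x - x₀) :=
    (continuous_perp v).comp (continuous_id.sub continuous_const)
  exact (h.inner (𝕜 := ℝ) (continuous_const (y := perp v e))).div_const (‖perp v e‖ ^ 2)

theorem continuous_nearDist (x₀ e v : Space n) : Continuous fun x => nearDist x₀ e (x, v) := by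
  have h : Continuous fun x => perp v (x - x₀) :=
    (continuous_perp v).comp (continuous_id.sub continuous_const)
  have h2 : Continuous fun x => nearParam x₀ e (x, v) • perp v e :=
    (continuous_nearParam x₀ e v).smul continuous_const
  exact (h.sub h2).norm

theorem perp_shift_foot {v : Space n} (hv : v ≠ 0) (c : ℝ) (x x₀ : Space n) :
    perp v ((shift c (foot (x, v))).1 - x₀) = perp v (x - x₀) := by
  have h1 : perp v x = x + (-⟪x, dir v⟫) • dir v := by
    rw [perp, neg_smul, sub_eq_add_neg]
  simp only [shift, foot, perp_sub, perp_add_smul hv, h1]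

theorem nearParam_shift_foot {v : Space n} (hv : v ≠ 0) (c : ℝ) (x x₀ e : Space n) :
    nearParam x₀ e (shift c (foot (x, v))) = nearParam x₀ e (x, v) := by
  have := perp_shift_foot hv c x x₀
  simp only [nearParam, shift, foot] at this ⊢
  rw [this]

/-- Only the line through the point matters. A weight on `F₊` can therefore be evaluated at the
collision point instead of the exit point. -/
theorem nearDist_shift_foot {v : Space n} (hv : v ≠ 0) (c : ℝ) (x x₀ e : Space n) :
    nearDist x₀ e (shift c (foot (x, v))) = nearDist x₀ e (x, v) := by
  have h1 := perp_shift_foot hv c x x₀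
  have h2 := nearParam_shift_foot hv c x x₀ e
  simp only [nearDist]
  rw [h2]
  simp only [shift, foot] at h1 ⊢
  rw [h1]

theorem perp_eq_zero_iff {v : Space n} (hv : v ≠ 0) (x : Space n) :
    perp v x = 0 ↔ ∃ a : ℝ, x = a • v := by
  constructor
  · intro h
    refine ⟨⟪x, dir v⟫ * ‖v‖⁻¹, ?_⟩
    rw [perp, sub_eq_zero] at h
    rw [mul_smul]
    exact h
  · rintro ⟨a, rfl⟩
    have : a • v = 0 + (a * ‖v‖) • dir v := by
      rw [zero_add, dir, smul_smul, mul_assoc, mul_inv_cancel₀ (by simpa using hv), mul_one]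
    rw [this, perp_add_smul hv]
    simp [perp]

/-- Since `e` is not parallel to `v`, the outgoing line has a unique intersection with `x₀ + ℝ e`.
This recovers the position of the collision from the outgoing line. -/
theorem nearParam_of_mem_line {e v : Space n} (hev : perp v e ≠ 0) (x₀ : Space n) (t : ℝ) :
    nearParam x₀ e (x₀ + t • e, v) = t := by
  have h : ‖perp v e‖ ≠ 0 := by simpa using hev
  simp only [nearParam, add_sub_cancel_left, perp_smul, inner_smul_left,
    real_inner_self_eq_norm_sq]
  simp [h]

theorem nearDist_of_mem_line {e v : Space n} (hev : perp v e ≠ 0) (x₀ : Space n) (t : ℝ) :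
    nearDist x₀ e (x₀ + t • e, v) = 0 := by
  simp [nearDist, nearParam_of_mem_line hev, perp_smul]

theorem nearDist_nonneg (x₀ e : Space n) (p : Space n × Space n) : 0 ≤ nearDist x₀ e p :=
  norm_nonneg _

/-- At distance zero, `y - x₀ - s e = a v` for some `s` and `a`. If `a = 0`, the point `y` is on the
fixed line; otherwise `v` lies in the span of `e` and `y - x₀`. -/
theorem nearDist_pos {x₀ e y v : Space n} (hv : v ≠ 0)
    (hy : y - x₀ ∉ Submodule.span ℝ {e, e}) (hvy : v ∉ Submodule.span ℝ {e, y - x₀}) :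
    0 < nearDist x₀ e (y, v) := by
  refine (nearDist_nonneg _ _ _).lt_of_ne' fun h => ?_
  rw [nearDist, norm_eq_zero] at h
  simp only at h
  rw [← perp_smul, ← perp_sub, perp_eq_zero_iff hv] at h
  obtain ⟨a, ha⟩ := h
  by_cases ha0 : a = 0
  · rw [ha0, zero_smul, sub_eq_zero] at ha
    rw [ha] at hy
    exact hy (Submodule.smul_mem _ _ (Submodule.subset_span (by simp)))
  · refine hvy ?_
    have : v = a⁻¹ • (y - x₀ - nearParam x₀ e (y, v) • e) := by
      rw [ha, smul_smul, inv_mul_cancel₀ ha0, one_smul]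
    rw [this]
    exact Submodule.smul_mem _ _ (Submodule.sub_mem _ (Submodule.subset_span (by simp))
      (Submodule.smul_mem _ _ (Submodule.subset_span (by simp))))

/-- If a point of the line through `z` other than `z` itself were on `x₀ + ℝ e`, the difference of
the two points would put `v` in the span of `e` and `z - x₀`. The excluded parameter is that of `z`,
which may lie on the fixed line. -/
theorem line_notMem_span {x₀ e z v : Space n} (hv : v ≠ 0)
    (hvz : v ∉ Submodule.span ℝ {e, z - x₀}) {t : ℝ} (ht : t ≠ ⟪z, dir v⟫) :
    perp v z + t • dir v - x₀ ∉ Submodule.span ℝ {e, e} := by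
  intro h
  refine hvz ?_
  have hle : Submodule.span ℝ {e, e} ≤ Submodule.span ℝ {e, z - x₀} :=
    Submodule.span_mono (by intro a; simp +contextual)
  have h1 : (t - ⟪z, dir v⟫) • dir v ∈ Submodule.span ℝ {e, z - x₀} := by
    have h2 := Submodule.sub_mem _ (hle h)
      (Submodule.subset_span (by simp) : z - x₀ ∈ Submodule.span ℝ {e, z - x₀})
    have h3 : perp v z + t • dir v - x₀ - (z - x₀) = (t - ⟪z, dir v⟫) • dir v := by
      rw [perp, sub_smul]; abel
    rwa [h3] at h2
  have h4 := Submodule.smul_mem _ (‖v‖ * (t - ⟪z, dir v⟫)⁻¹) h1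
  rw [smul_smul, mul_assoc, inv_mul_cancel₀ (sub_ne_zero.2 ht), mul_one, dir, smul_smul,
    mul_inv_cancel₀ (by simpa using hv), one_smul] at h4
  exact h4

/-- The measure of the set of velocities of norm at most `N` for which the characteristic line
through `y` has distance less than `δ` from the line `x₀ + ℝ e`. -/
def nearMass (V : VelocityDomain n) (x₀ e : Space n) (N δ : ℝ) (y : Space n) : ℝ≥0∞ :=
  ∫⁻ v in closedBall 0 N, (Iio δ).indicator 1 (nearDist x₀ e (y, v)) ∂V.measure

theorem measurable_nearMass (V : VelocityDomain n) (x₀ e : Space n) (N δ : ℝ) :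
    Measurable (nearMass V x₀ e N δ) :=
  Measurable.lintegral_prod_right' (f := fun q : Space n × Space n =>
    (Iio δ).indicator (1 : ℝ → ℝ≥0∞) (nearDist x₀ e q))
    ((measurable_one.indicator measurableSet_Iio).comp (measurable_nearDist x₀ e))

theorem VelocityDomain.measure_closedBall_lt_top (V : VelocityDomain n) (N : ℝ) :
    V.measure (closedBall 0 N) < ∞ := (isCompact_closedBall 0 N).measure_lt_top

theorem nearMass_le (V : VelocityDomain n) (x₀ e : Space n) (N δ : ℝ) (y : Space n) :
    nearMass V x₀ e N δ y ≤ V.measure (closedBall 0 N) := by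
  refine (lintegral_mono (g := fun _ => 1) fun v => ?_).trans (by simp)
  exact indicator_le_self' (by simp) _

theorem tendsto_lintegral_of_bounded {α ι : Type*} [MeasurableSpace α] {μ : Measure α}
    [IsFiniteMeasure μ] {l : Filter ι} [l.IsCountablyGenerated] {F : ι → α → ℝ≥0∞} {C : ℝ≥0∞}
    {f : α → ℝ≥0∞} (hC : C ≠ ∞) (hF : ∀ i, Measurable (F i)) (hle : ∀ i a, F i a ≤ C)
    (hlim : ∀ᵐ a ∂μ, Tendsto (fun i => F i a) l (𝓝 (f a))) :
    Tendsto (fun i => ∫⁻ a, F i a ∂μ) l (𝓝 (∫⁻ a, f a ∂μ)) :=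
  tendsto_lintegral_filter_of_dominated_convergence (fun _ => C) (Eventually.of_forall hF)
    (Eventually.of_forall fun i => Eventually.of_forall fun a => hle i a)
    (by rw [lintegral_const]; exact ENNReal.mul_ne_top hC (measure_ne_top _ _)) hlim

theorem tendsto_lintegral_zero_of_bounded {α ι : Type*} [MeasurableSpace α] {μ : Measure α}
    [IsFiniteMeasure μ] {l : Filter ι} [l.IsCountablyGenerated] {F : ι → α → ℝ≥0∞} {C : ℝ≥0∞}
    (hC : C ≠ ∞) (hF : ∀ i, Measurable (F i)) (hle : ∀ i a, F i a ≤ C)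
    (hlim : ∀ᵐ a ∂μ, Tendsto (fun i => F i a) l (𝓝 0)) :
    Tendsto (fun i => ∫⁻ a, F i a ∂μ) l (𝓝 0) := by
  simpa using tendsto_lintegral_of_bounded (f := fun _ => 0) hC hF hle hlim

/-- For `y₀` off the fixed line, almost every velocity gives a line at positive distance from it, so
the indicator is eventually zero and dominated convergence applies. The limit is joint in the point
and `δ`, as the compactness argument below requires. -/
theorem tendsto_nearMass (hn : 3 ≤ n) (V : VelocityDomain n) {x₀ e : Space n} (N : ℝ)
    {ι : Type*} {l : Filter ι} [l.IsCountablyGenerated] {y : ι → Space n} {δ : ι → ℝ}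
    {y₀ : Space n} (hy₀ : y₀ - x₀ ∉ Submodule.span ℝ {e, e}) (hy : Tendsto y l (𝓝 y₀))
    (hδ : Tendsto δ l (𝓝 0)) :
    Tendsto (fun i => nearMass V x₀ e N (δ i) (y i)) l (𝓝 0) := by
  have : IsFiniteMeasure (V.measure.restrict (closedBall 0 N)) :=
    ⟨by simpa using V.measure_closedBall_lt_top N⟩
  refine tendsto_lintegral_zero_of_bounded (C := 1) (by simp)
    (fun i => (measurable_one.indicator measurableSet_Iio).comp
      ((measurable_nearDist x₀ e).comp measurable_prodMk_left))
    (fun i v => indicator_le_self' (by simp) _) (ae_restrict_of_ae ?_)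
  filter_upwards [V.ae_notMem_span_pair hn e (y₀ - x₀), V.ae_mem] with v hv hvV
  have hpos := nearDist_pos (VelocityDomain.ne_zero hvV) hy₀ hv
  have hcont := ((continuous_nearDist x₀ e v).tendsto y₀).comp hy
  refine tendsto_const_nhds.congr' ?_
  filter_upwards [hδ.eventually_lt hcont hpos] with i hi
  rw [indicator_of_notMem]
  simpa using hi.le

theorem measurable_nearMass_line (V : VelocityDomain n) (x₀ e : Space n) (N δ : ℝ) (z : Space n) :
    Measurable fun a : Space n × ℝ => nearMass V x₀ e N δ (perp a.1 z + a.2 • dir a.1) := by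
  have hd := measurable_dir (n := n)
  exact (measurable_nearMass V x₀ e N δ).comp (by unfold perp; fun_prop)

theorem measurable_nearMass_fixed (V : VelocityDomain n) (x₀ e : Space n) (N δ : ℝ)
    (z v : Space n) : Measurable fun t : ℝ => nearMass V x₀ e N δ (perp v z + t • dir v) := by
  have hl : Measurable fun t : ℝ => perp v z + t • dir v := by fun_prop
  exact (measurable_nearMass V x₀ e N δ).comp hl

/-- For a velocity outside the exceptional plane, the line through `z₀` meets the fixed line at most
at `z₀`. Hence `tendsto_nearMass` applies at almost every `t`. -/
theorem tendsto_lintegral_nearMass_line (hn : 3 ≤ n) (V : VelocityDomain n) {x₀ e : Space n}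
    (R N : ℝ) {z₀ v : Space n} (hv : v ∉ Submodule.span ℝ {e, z₀ - x₀}) (hvV : v ∈ V.carrier) :
    Tendsto (fun q : Space n × ℝ => ∫⁻ t in Ioo (-R) R,
      nearMass V x₀ e N q.2 (perp v q.1 + t • dir v)) (𝓝 z₀ ×ˢ 𝓝[>] 0) (𝓝 0) := by
  refine tendsto_lintegral_zero_of_bounded (V.measure_closedBall_lt_top N).ne
    (fun q => measurable_nearMass_fixed V x₀ e N q.2 q.1 v)
    (fun q t => nearMass_le V x₀ e N q.2 _) (ae_restrict_of_ae ?_)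
  have hne : ∀ᵐ t : ℝ, t ≠ ⟪z₀, dir v⟫ := by simp [ae_iff]
  filter_upwards [hne] with t ht
  have hc : Continuous fun z => perp v z + t • dir v := (continuous_perp v).add continuous_const
  have hy : Tendsto (fun q : Space n × ℝ => perp v q.1 + t • dir v) (𝓝 z₀ ×ˢ 𝓝[>] (0 : ℝ))
      (𝓝 (perp v z₀ + t • dir v)) := (hc.tendsto z₀).comp tendsto_fst
  exact tendsto_nearMass hn V N (line_notMem_span (VelocityDomain.ne_zero hvV) hv ht) hy
    (tendsto_snd.mono_right nhdsWithin_le_nhds)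

theorem lintegral_nearMass_le (V : VelocityDomain n) (x₀ e : Space n) (R N δ : ℝ)
    (z v : Space n) : ∫⁻ t in Ioo (-R) R, nearMass V x₀ e N δ (perp v z + t • dir v) ≤
      V.measure (closedBall 0 N) * volume (Ioo (-R) R) := by
  refine (lintegral_mono fun t => nearMass_le V x₀ e N δ _).trans ?_
  rw [setLIntegral_const]

/-- The measure of the set of those lines is small near every point, in the mean along lines. -/
theorem tendsto_lintegral_nearMass (hn : 3 ≤ n) (V : VelocityDomain n) (x₀ e : Space n)
    (R N L : ℝ) (z₀ : Space n) :
    Tendsto (fun q : Space n × ℝ => ∫⁻ v in closedBall 0 L, (∫⁻ t in Ioo (-R) R,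
      nearMass V x₀ e N q.2 (perp v q.1 + t • dir v)) ∂V.measure)
      (𝓝 z₀ ×ˢ 𝓝[>] 0) (𝓝 0) := by
  have hfin := V.measure_closedBall_lt_top
  have : IsFiniteMeasure (V.measure.restrict (closedBall 0 L)) := ⟨by simpa using hfin L⟩
  have h1 : V.measure (closedBall 0 N) * volume (Ioo (-R) R) ≠ ∞ :=
    ENNReal.mul_ne_top (hfin N).ne (by simp)
  have h2 : ∀ q : Space n × ℝ, Measurable fun v => ∫⁻ t in Ioo (-R) R,
      nearMass V x₀ e N q.2 (perp v q.1 + t • dir v) := fun q =>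
    (measurable_nearMass_line V x₀ e N q.2 q.1).lintegral_prod_right'
  refine tendsto_lintegral_zero_of_bounded h1 h2
    (fun q v => lintegral_nearMass_le V x₀ e R N q.2 q.1 v) (ae_restrict_of_ae ?_)
  filter_upwards [V.ae_notMem_span_pair hn e (z₀ - x₀), V.ae_mem] with v hv hvV
  exact tendsto_lintegral_nearMass_line hn V R N hv hvV

/-- The joint limit in `(z, δ)` supplies, near each `z₀`, a range of `δ` valid on a whole
neighbourhood; compactness of the ball gives one `δ` for all `z`. -/
theorem exists_lintegral_nearMass_le (hn : 3 ≤ n) (V : VelocityDomain n) (x₀ e : Space n)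
    (R N L : ℝ) {ε : ℝ≥0∞} (hε : 0 < ε) :
    ∃ δ > 0, ∀ z ∈ closedBall (0 : Space n) R, ∫⁻ v in closedBall 0 L, (∫⁻ t in Ioo (-R) R,
      nearMass V x₀ e N δ (perp v z + t • dir v)) ∂V.measure ≤ ε := by
  let H : Space n × ℝ → ℝ≥0∞ := fun q => ∫⁻ v in closedBall 0 L, (∫⁻ t in Ioo (-R) R,
      nearMass V x₀ e N q.2 (perp v q.1 + t • dir v)) ∂V.measure
  have hH : ∀ z₀, Tendsto H (𝓝 z₀ ×ˢ 𝓝[>] 0) (𝓝 0) :=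
    tendsto_lintegral_nearMass hn V x₀ e R N L
  suffices ∃ δ > 0, ∀ z ∈ closedBall (0 : Space n) R, H (z, δ) ≤ ε from this
  clear_value H
  have key : ∀ᶠ δ in 𝓝[>] (0 : ℝ), ∀ z ∈ closedBall (0 : Space n) R, H (z, δ) ≤ ε := by
    refine (isCompact_closedBall (0 : Space n) R).induction_on
      (p := fun s => ∀ᶠ δ in 𝓝[>] (0 : ℝ), ∀ z ∈ s, H (z, δ) ≤ ε) ?_ ?_ ?_ ?_
    · simp
    · intro s t hst ht
      filter_upwards [ht] with δ hδ z hz using hδ z (hst hz)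
    · intro s t hs ht
      filter_upwards [hs, ht] with δ h1 h2 z hz using hz.elim (h1 z) (h2 z)
    · intro z₀ _
      have h := (hH z₀).eventually_le_const hε
      obtain ⟨s, hs, t, ht, hst⟩ := Filter.mem_prod_iff.1 h
      refine ⟨s, mem_nhdsWithin_of_mem_nhds hs, ?_⟩
      filter_upwards [ht] with δ hδ z hz using hst (mk_mem_prod hz hδ)
  obtain ⟨δ, h1, h2⟩ := (key.and self_mem_nhdsWithin).exists
  exact ⟨δ, h2, h1⟩

/-! ### Multiple scattering near a fixed line -/

/-- The set of pairs `(x, v)` with `|v| ≤ N` for which the characteristic line has distance less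
than `δ` from the line `x₀ + ℝ e`. -/
def nearSet (x₀ e : Space n) (N δ : ℝ) : Set (Space n × Space n) :=
  {p | p.2 ∈ closedBall 0 N ∧ nearDist x₀ e p < δ}

theorem measurableSet_nearSet (x₀ e : Space n) (N δ : ℝ) : MeasurableSet (nearSet x₀ e N δ) :=
  (measurable_snd isClosed_closedBall.measurableSet).inter
    (measurableSet_lt (measurable_nearDist x₀ e) measurable_const)

theorem indicator_nearSet {v : Space n} (hv : v ≠ 0) (x₀ e : Space n) (N δ c : ℝ)
    (y : Space n) : (nearSet x₀ e N δ).indicator (1 : Space n × Space n → ℝ≥0∞) (shift c (foot (y, v))) =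
      (closedBall 0 N).indicator (fun v => (Iio δ).indicator 1 (nearDist x₀ e (y, v))) v := by
  have h := nearDist_shift_foot hv c y x₀ e
  have h2 : (shift c (foot (y, v))).2 = v := rfl
  by_cases hN : v ∈ closedBall (0 : Space n) N
  · rw [indicator_of_mem hN]
    by_cases hδ : nearDist x₀ e (y, v) < δ
    · rw [indicator_of_mem (show shift c (foot (y, v)) ∈ nearSet x₀ e N δ from
        ⟨by rwa [h2], by rwa [h]⟩), indicator_of_mem (by exact hδ)]
      rfl
    · rw [indicator_of_notMem (s := Iio δ) (by exact hδ), indicator_of_notMem]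
      rintro ⟨-, h3⟩
      rw [h] at h3
      exact hδ h3
  · rw [indicator_of_notMem hN, indicator_of_notMem]
    rintro ⟨h3, -⟩
    exact hN h3

/-- The weight of an incoming line in the flux of the particles that are scattered once. -/
def singleWeight (R : ℝ) (V : VelocityDomain n) (σ : Space n → Space n → ℝ)
    (k : Space n → Space n → Space n → ℝ) (W : Space n × Space n → ℝ≥0∞)
    (q : Space n × Space n) : ℝ≥0∞ :=
  ‖q.2‖ₑ⁻¹ * ∫⁻ r in Ioo (-R) R, ENNReal.ofReal (inAtt R σ (alongLine (q, r))) *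
    ∫⁻ v, W (shift R (foot ((alongLine (q, r)).1, v))) *
      ENNReal.ofReal (outAtt R σ ((alongLine (q, r)).1, v)) *
        ENNReal.ofReal (k (alongLine (q, r)).1 q.2 v) ∂V.measure

namespace Regular

variable {R M : ℝ} {V : VelocityDomain n} {σ : Space n → Space n → ℝ}
  {k : Space n → Space n → Space n → ℝ}

theorem lintegral_indicator_nearSet_le (h : Regular R V σ k M) (x₀ e : Space n) (N δ : ℝ)
    (y v' : Space n) :
    ∫⁻ v, (nearSet x₀ e N δ).indicator 1 (shift R (foot (y, v))) *
      ENNReal.ofReal (k y v' v) ∂V.measure ≤ ENNReal.ofReal M * nearMass V x₀ e N δ y := by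
  rw [nearMass, ← lintegral_indicator isClosed_closedBall.measurableSet,
    ← lintegral_const_mul' _ _ ENNReal.ofReal_ne_top]
  refine lintegral_mono_ae ?_
  filter_upwards [V.ae_mem] with v hv
  rw [indicator_nearSet (VelocityDomain.ne_zero hv), mul_comm]
  gcongr
  exact h.k_le _ _ _

/-- Velocities may be unbounded. For `|v| > L` the factor `|v|⁻¹` is at most `1 / L` and the total
scattering bound controls the integral; for `|v| ≤ L` one uses `|v|⁻¹ ≤ 1 / c` and `k ≤ M`. -/
theorem lintegral_inv_norm_mul_le (h : Regular R V σ k M) {c L : ℝ} (hc : 0 < c)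
    (hcV : ∀ v ∈ V.carrier, c ≤ ‖v‖) {F : Space n → ℝ≥0∞} (hm : Measurable F) {S : ℝ≥0∞}
    (hle : ∀ v, F v ≤ S) (z v' : Space n) :
    ∫⁻ v, ‖v‖ₑ⁻¹ * F v * ENNReal.ofReal (k z v' v) ∂V.measure ≤
      (ENNReal.ofReal L)⁻¹ * S * ENNReal.ofReal M +
        ENNReal.ofReal c⁻¹ * ENNReal.ofReal M * ∫⁻ v in closedBall 0 L, F v ∂V.measure := by
  have hk : Measurable fun v => k z v' v :=
    h.k_measurable.comp (f := fun v => (z, v', v)) (by fun_prop)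
  rw [← lintegral_indicator isClosed_closedBall.measurableSet]
  calc ∫⁻ v, ‖v‖ₑ⁻¹ * F v * ENNReal.ofReal (k z v' v) ∂V.measure
      ≤ ∫⁻ v, ((ENNReal.ofReal L)⁻¹ * S * ENNReal.ofReal (k z v' v) +
          ENNReal.ofReal c⁻¹ * ENNReal.ofReal M * (closedBall 0 L).indicator F v)
            ∂V.measure := by
        refine lintegral_mono_ae ?_
        filter_upwards [V.ae_mem] with v hv
        by_cases hL : v ∈ closedBall (0 : Space n) L
        · rw [indicator_of_mem hL]
          refine le_trans ?_ le_add_self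
          rw [mul_right_comm]
          gcongr
          · exact ofReal_inv_norm_le hc hcV hv
          · exact h.k_le _ _ _
        · refine le_trans ?_ le_self_add
          gcongr
          · rw [← ofReal_norm]
            refine ENNReal.ofReal_le_ofReal ?_
            simpa using (not_le.1 (by simpa using hL)).le
          · exact hle v
    _ = (ENNReal.ofReal L)⁻¹ * S * ∫⁻ v, ENNReal.ofReal (k z v' v) ∂V.measure +
          ENNReal.ofReal c⁻¹ * ENNReal.ofReal M *
            ∫⁻ v, (closedBall 0 L).indicator F v ∂V.measure := by
        rw [lintegral_add_left (hk.ennreal_ofReal.const_mul _),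
          lintegral_const_mul _ hk.ennreal_ofReal,
          lintegral_const_mul _ (hm.indicator isClosed_closedBall.measurableSet)]
    _ ≤ _ := by
        gcongr
        exact h.lintegral_k_le _ _

/-- The part of the outgoing flux produced by at least two scattering events is small on lines
close to a fixed line. -/
theorem exists_lintegral_nearSet_le (h : Regular R V σ k M) (hn : 3 ≤ n) (hR : 0 < R)
    (x₀ e : Space n) (N : ℝ) {ε : ℝ≥0∞} (hε : 0 < ε) :
    ∃ δ > 0, ∀ u w : Space n × Space n → ℝ, Measurable u → Measurable w →
      w =ᵐ[phaseMeasure R V] opK R V σ k u →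
      ∫⁻ p in nearSet x₀ e N δ, ‖opK R V σ k w p‖ₑ ∂fluxMeasure R V R ≤
        ε * ∫⁻ p, ‖u p‖ₑ ∂phaseMeasure R V := by
  obtain ⟨c, hc, hcV⟩ := V.exists_le_norm
  set a := ENNReal.ofReal c⁻¹ with ha
  set m := ENNReal.ofReal M with hmM
  set S := V.measure (closedBall 0 N) * volume (Ioo (-R) R) with hS
  have hSt : S ≠ ∞ := ENNReal.mul_ne_top (V.measure_closedBall_lt_top N).ne (by simp)
  have hat : a ≠ ∞ := ENNReal.ofReal_ne_top
  have hmt : m ≠ ∞ := ENNReal.ofReal_ne_top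
  -- The number `r₁` is the inverse of the speed cut-off `L` and `r₂` is the bound for the averaged
  -- `nearMass`. They make the contributions of fast and slow intermediate velocities at most `ε /
  -- 2` each.
  obtain ⟨r₁, hr₁, hlt₁⟩ := ENNReal.exists_nnreal_pos_mul_lt (a := a * m * (S * m)) (b := ε / 2)
    (by finiteness) (by simpa using hε.ne')
  obtain ⟨r₂, hr₂, hlt₂⟩ := ENNReal.exists_nnreal_pos_mul_lt (a := a * m * (a * m)) (b := ε / 2)
    (by finiteness) (by simpa using hε.ne')
  have hL : (ENNReal.ofReal (r₁ : ℝ)⁻¹)⁻¹ = r₁ := by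
    rw [ENNReal.ofReal_inv_of_pos (by exact_mod_cast hr₁), inv_inv, ENNReal.ofReal_coe_nnreal]
  obtain ⟨δ, hδ, hδle⟩ := exists_lintegral_nearMass_le hn V x₀ e R N (r₁ : ℝ)⁻¹
    (ε := r₂) (by exact_mod_cast hr₂)
  refine ⟨δ, hδ, fun u w hu hw hwu => ?_⟩
  -- This weight dominates the chance that the last collision sends a particle at `p` into
  -- `nearSet`. It is small only in the mean along lines, so the earlier collision, expressed by `w
  -- = K u`, is needed for the averaging.
  let W : Space n × Space n → ℝ≥0∞ := fun p => ‖p.2‖ₑ⁻¹ * (m * nearMass V x₀ e N δ p.1)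
  have hW : Measurable W := by
    have := measurable_nearMass V x₀ e N δ
    fun_prop
  have hind : Measurable ((nearSet x₀ e N δ).indicator (1 : Space n × Space n → ℝ≥0∞)) :=
    measurable_one.indicator (measurableSet_nearSet _ _ _ _)
  calc ∫⁻ p in nearSet x₀ e N δ, ‖opK R V σ k w p‖ₑ ∂fluxMeasure R V R
      = ∫⁻ p, (nearSet x₀ e N δ).indicator 1 p * ‖opK R V σ k w p‖ₑ ∂fluxMeasure R V R := by
        rw [← lintegral_indicator (measurableSet_nearSet _ _ _ _)]
        refine lintegral_congr fun p => ?_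
        by_cases hp : p ∈ nearSet x₀ e N δ <;> simp [hp]
    _ ≤ ∫⁻ p, W p * ‖w p‖ₑ ∂phaseMeasure R V := by
        refine (h.lintegral_flux_opK_le hR hw hind).trans (lintegral_mono fun p => ?_)
        simp only [W]
        rw [mul_assoc, mul_comm (m * _)]
        gcongr
        exact h.lintegral_indicator_nearSet_le x₀ e N δ p.1 p.2
    _ = ∫⁻ p, W p * ‖opK R V σ k u p‖ₑ ∂phaseMeasure R V := by
        refine lintegral_congr_ae ?_
        filter_upwards [hwu] with p hp
        rw [hp]
    _ ≤ ∫⁻ p, ‖p.2‖ₑ⁻¹ * (‖u p‖ₑ * ∫⁻ v, (∫⁻ t in Ioo (-R) R,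
          W (alongLine (foot (p.1, v), t))) * ENNReal.ofReal (k p.1 p.2 v) ∂V.measure)
            ∂phaseMeasure R V := h.lintegral_phase_opK_le hR hu hW
    _ ≤ ∫⁻ p, ε * ‖u p‖ₑ ∂phaseMeasure R V := by
        refine lintegral_mono_ae ?_
        filter_upwards [ae_phase_mem R V] with p hp
        have key : ∫⁻ v, (∫⁻ t in Ioo (-R) R, W (alongLine (foot (p.1, v), t))) *
            ENNReal.ofReal (k p.1 p.2 v) ∂V.measure ≤ m * (r₁ * S * m + a * m * r₂) := by
          by_cases hpR : R ≤ ‖p.1‖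
          · simp [h.k_zero _ _ _ hpR]
          · have h1 := h.lintegral_inv_norm_mul_le hc hcV (L := (r₁ : ℝ)⁻¹)
              (measurable_nearMass_line V x₀ e N δ p.1).lintegral_prod_right'
              (lintegral_nearMass_le V x₀ e R N δ p.1) p.1 p.2
            rw [hL] at h1
            have h2 := hδle p.1 (by simpa using (not_le.1 hpR).le)
            have h3 : ∀ v, (∫⁻ t in Ioo (-R) R, W (alongLine (foot (p.1, v), t))) *
                ENNReal.ofReal (k p.1 p.2 v) = m * (‖v‖ₑ⁻¹ * (∫⁻ t in Ioo (-R) R,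
                  nearMass V x₀ e N δ (perp v p.1 + t • dir v)) *
                    ENNReal.ofReal (k p.1 p.2 v)) := by
              intro v
              simp only [W, alongLine, foot]
              have hmeas := measurable_nearMass_fixed V x₀ e N δ p.1 v
              rw [lintegral_const_mul _ (hmeas.const_mul m), lintegral_const_mul _ hmeas]
              ring
            simp_rw [h3]
            rw [lintegral_const_mul' _ _ hmt]
            gcongr
            exact h1.trans (by gcongr)
        calc ‖p.2‖ₑ⁻¹ * (‖u p‖ₑ * _) ≤ a * (‖u p‖ₑ * (m * (r₁ * S * m + a * m * r₂))) := by
              gcongr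
              exact ofReal_inv_norm_le hc hcV hp.1
          _ = (r₁ * (a * m * (S * m)) + r₂ * (a * m * (a * m))) * ‖u p‖ₑ := by ring
          _ ≤ (ε / 2 + ε / 2) * ‖u p‖ₑ := by gcongr
          _ = ε * ‖u p‖ₑ := by rw [ENNReal.add_halves]
    _ = ε * ∫⁻ p, ‖u p‖ₑ ∂phaseMeasure R V := lintegral_const_mul _ hu.enorm

/-- For nonnegative `f` the scattered flux is `-K f`. Nonnegativity makes `ENNReal.ofReal` lossless,
so Tonelli can be used on this flux. -/
theorem ofReal_neg_opK (h : Regular R V σ k M) (hR : 0 < R)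
    {f : Space n × Space n → ℝ} (hf : Measurable f) (hf0 : ∀ p, 0 ≤ f p)
    {q : Space n × Space n} (hqF : q ∈ discBundle R V)
    (hq : ∫⁻ r in Ioo (-R) R, lscatter V k (fun p => ‖f p‖ₑ) (alongLine (q, r)) < ∞) :
    0 ≤ -opK R V σ k f (shift R q) ∧ ENNReal.ofReal (-opK R V σ k f (shift R q)) =
      ‖q.2‖ₑ⁻¹ * ∫⁻ r in Ioo (-R) R, ENNReal.ofReal (outAtt R σ (alongLine (q, r))) *
        lscatter V k (fun p => ENNReal.ofReal (f p)) (alongLine (q, r)) := by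
  have hsc : ∀ p, 0 ≤ scatter V k f p := fun p =>
    integral_nonneg fun v' => mul_nonneg (h.k_nonneg _ _ _) (hf0 _)
  have hnn : ∀ p, 0 ≤ outAtt R σ p * scatter V k f p := fun p =>
    mul_nonneg (outAtt_pos _ _ _).le (hsc p)
  rw [h.opK_exit hR f hqF, neg_neg]
  refine ⟨mul_nonneg (by positivity) (integral_nonneg fun r => hnn _), ?_⟩
  rw [ENNReal.ofReal_mul (by positivity), ENNReal.ofReal_inv_of_pos
    (by simpa using VelocityDomain.ne_zero hqF.1), ofReal_norm,
    ofReal_integral_eq_lintegral_ofReal (h.integrableOn_outAtt_mul hR hf hq)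
      (Eventually.of_forall fun r => hnn _)]
  congr 1
  refine lintegral_congr_ae ?_
  filter_upwards [h.ae_integrable_scatter hf hq] with r hr
  rw [ENNReal.ofReal_mul (outAtt_pos _ _ _).le]
  congr 1
  rw [scatter, ofReal_integral_eq_lintegral_ofReal hr
    (Eventually.of_forall fun v' => mul_nonneg (h.k_nonneg _ _ _) (hf0 _)), lscatter]
  refine lintegral_congr fun v' => ?_
  rw [ENNReal.ofReal_mul (h.k_nonneg _ _ _)]

theorem integrable_ballistic (h : Regular R V σ k M) (hR : 0 < R) {g : Space n × Space n → ℝ}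
    (hg : Measurable g) (hgi : ∫⁻ p, ‖g p‖ₑ ∂fluxMeasure R V (-R) < ∞) :
    Integrable (ballistic R σ g) (phaseMeasure R V) := by
  refine ⟨(h.measurable_ballistic hR hg).aestronglyMeasurable, ?_⟩
  refine (lintegral_mono fun p => h.enorm_ballistic_le hR g p).trans_lt ?_
  rw [lintegral_phase_foot hR V (-R) hg.enorm]
  exact ENNReal.mul_lt_top ENNReal.ofReal_lt_top hgi

/-- The flux of the particles that are scattered once. -/
theorem lintegral_single (h : Regular R V σ k M) (hR : 0 < R)
    {g : Space n × Space n → ℝ} (hg : Measurable g) (hg0 : ∀ p, 0 ≤ g p)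
    (hgi : ∫⁻ p, ‖g p‖ₑ ∂fluxMeasure R V (-R) < ∞) {W : Space n × Space n → ℝ≥0∞}
    (hW : Measurable W) :
    ∫⁻ p, W p * ENNReal.ofReal (-opK R V σ k (ballistic R σ g) p) ∂fluxMeasure R V R =
      ∫⁻ q, ENNReal.ofReal (g (shift (-R) q)) * singleWeight R V σ k W q ∂fluxMeasure R V 0 := by
  have hb0 : ∀ p, 0 ≤ ballistic R σ g p := fun p => mul_nonneg (inAtt_pos _ _ _).le (hg0 _)
  have hbm := h.measurable_ballistic hR hg
  have hout := (h.measurable_outAtt hR).ennreal_ofReal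
  have hin := (h.measurable_inAtt hR).ennreal_ofReal
  have hWm := hW.comp ((measurable_shift R).comp (measurable_foot (n := n)))
  have hG : Measurable fun p => ENNReal.ofReal (outAtt R σ p) *
      lscatter V k (fun p => ENNReal.ofReal (ballistic R σ g p)) p :=
    hout.mul (h.measurable_lscatter hbm.ennreal_ofReal)
  have hΦ : Measurable fun p => W (shift R (foot p)) * ENNReal.ofReal (outAtt R σ p) :=
    hWm.mul hout
  have e1 : ∫⁻ p, W p * ENNReal.ofReal (-opK R V σ k (ballistic R σ g) p) ∂fluxMeasure R V R =
      ∫⁻ q, W (shift R q) * (‖q.2‖ₑ⁻¹ * ∫⁻ r in Ioo (-R) R,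
        ENNReal.ofReal (outAtt R σ (alongLine (q, r))) *
          lscatter V k (fun p => ENNReal.ofReal (ballistic R σ g p)) (alongLine (q, r)))
          ∂fluxMeasure R V 0 := by
    have hN : Measurable fun q : Space n × Space n => ‖q.2‖ₑ⁻¹ * ∫⁻ r in Ioo (-R) R,
        ENNReal.ofReal (outAtt R σ (alongLine (q, r))) *
          lscatter V k (fun p => ENNReal.ofReal (ballistic R σ g p)) (alongLine (q, r)) :=
      (by fun_prop : Measurable fun p : Space n × Space n => ‖p.2‖ₑ⁻¹).mul
        (measurable_lineIntegral hG)
    have hae : ∀ᵐ p ∂fluxMeasure R V R, W p * ENNReal.ofReal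
        (-opK R V σ k (ballistic R σ g) p) = W p * (‖(foot p).2‖ₑ⁻¹ * ∫⁻ r in Ioo (-R) R,
        ENNReal.ofReal (outAtt R σ (alongLine (foot p, r))) *
          lscatter V k (fun p => ENNReal.ofReal (ballistic R σ g p)) (alongLine (foot p, r))) := by
      rw [ae_flux_iff hR]
      filter_upwards [ae_flux_zero_mem hR V,
        h.ae_line_lscatter_lt_top hR hbm (h.integrable_ballistic hR hg hgi)] with q hq hqf
      rw [(h.ofReal_neg_opK hR hbm hb0 hq hqf).2, foot_shift (VelocityDomain.ne_zero hq.1),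
        foot_eq_self hq]
    rw [lintegral_congr_ae hae]
    refine ((measurePreserving_shift hR V R (zero_add R)).lintegral_comp
      (hW.mul (hN.comp measurable_foot))).symm.trans ?_
    refine lintegral_congr_ae ?_
    filter_upwards [ae_flux_zero_mem hR V] with q hq
    simp only [Pi.mul_apply, Function.comp_apply]
    rw [foot_shift (VelocityDomain.ne_zero hq.1), foot_eq_self hq]
  have e2 := lintegral_flux_line hR V R hW hG
  have e3 := h.lintegral_lscatter hΦ hbm.ennreal_ofReal
  have hwk := h.measurable_weighted_k hΦ
  have e4 := lintegral_flux_line hR V (-R) hg.ennreal_ofReal (hin.mul hwk)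
  -- The flux is written over outgoing lines (`e1`) and then over collision points (`e2`); `e3`
  -- exchanges outgoing and incoming velocities, and `e4` regroups the result by incoming lines.
  rw [e1, e2]
  refine Eq.trans ?_ (e3.trans (Eq.trans ?_ e4.symm))
  · refine lintegral_congr fun p => ?_
    simp only [mul_assoc]
  · refine lintegral_congr fun p => ?_
    simp only [Pi.mul_apply, ballistic]
    rw [ENNReal.ofReal_mul (inAtt_pos _ _ _).le]
    ring

end Regular

/-! ### Coefficients that are continuous in a convex set -/

/-- The open segment from an interior point of a convex set to a point of its closure stays in the
interior. Each of the two rays starting at the point in `X` thus contains at most one frontier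
point. -/
theorem ae_line_notMem_frontier {X : Set (Space n)} (hX : IsOpen X) (hc : Convex ℝ X)
    {x e : Space n} (h : ∃ t : ℝ, x + t • e ∈ X) : ∀ᵐ t : ℝ, x + t • e ∉ frontier X := by
  obtain ⟨t₀, ht₀⟩ := h
  have hnf : ∀ y ∈ X, y ∉ frontier X := fun y hy hf => hf.2 (by rwa [hX.interior_eq])
  have key : ∀ s t : ℝ, x + t • e ∈ frontier X → s ∈ openSegment ℝ t₀ t →
      x + s • e ∉ frontier X := by
    intro s t ht hs hf
    have h1 := hc.openSegment_interior_closure_subset_interior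
      (by rwa [hX.interior_eq] : x + t₀ • e ∈ interior X) (frontier_subset_closure ht)
    have h2 : x + s • e ∈ openSegment ℝ (x + t₀ • e) (x + t • e) := by
      obtain ⟨a, b, ha, hb, hab, rfl⟩ := hs
      refine ⟨a, b, ha, hb, hab, ?_⟩
      simp only [smul_add, add_smul, smul_smul, smul_eq_mul]
      rw [add_add_add_comm, ← add_smul, hab, one_smul]
    have h3 := h1 h2
    rw [hX.interior_eq] at h3
    exact hnf _ h3 hf
  have hA : {t : ℝ | t₀ < t ∧ x + t • e ∈ frontier X}.Subsingleton := by
    intro s hs t ht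
    by_contra hne
    rcases lt_or_gt_of_ne hne with hlt | hlt
    · exact key s t ht.2 (by rw [openSegment_eq_Ioo ht.1]; exact ⟨hs.1, hlt⟩) hs.2
    · exact key t s hs.2 (by rw [openSegment_eq_Ioo hs.1]; exact ⟨ht.1, hlt⟩) ht.2
  have hB : {t : ℝ | t < t₀ ∧ x + t • e ∈ frontier X}.Subsingleton := by
    intro s hs t ht
    by_contra hne
    rcases lt_or_gt_of_ne hne with hlt | hlt
    · exact key t s hs.2
        (by rw [openSegment_symm, openSegment_eq_Ioo hs.1]; exact ⟨hlt, ht.1⟩) ht.2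
    · exact key s t ht.2
        (by rw [openSegment_symm, openSegment_eq_Ioo ht.1]; exact ⟨hlt, hs.1⟩) hs.2
  rw [ae_iff]
  refine measure_mono_null ?_ (measure_union_null (hA.finite.measure_zero volume)
    (hB.finite.measure_zero volume))
  intro t ht
  have htf : x + t • e ∈ frontier X := by simpa using ht
  rcases lt_trichotomy t t₀ with hlt | rfl | hlt
  · exact Or.inr ⟨hlt, htf⟩
  · exact absurd htf (hnf _ ht₀)
  · exact Or.inl ⟨hlt, htf⟩

/-- The restriction of `σ` to `X × V`, extended by zero. -/
def cutSigma (X : Set (Space n)) (V : VelocityDomain n) (σ : Space n → Space n → ℝ)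
    (x v : Space n) : ℝ :=
  (X ×ˢ V.carrier).indicator (fun p => σ p.1 p.2) (x, v)

/-- The restriction of `k` to `X × V × V`, extended by zero. -/
def cutK (X : Set (Space n)) (V : VelocityDomain n) (k : Space n → Space n → Space n → ℝ)
    (x v' v : Space n) : ℝ :=
  (X ×ˢ (V.carrier ×ˢ V.carrier)).indicator (fun p => k p.1 p.2.1 p.2.2) (x, v', v)

section Cut

variable {R : ℝ} {V : VelocityDomain n} {X : Set (Space n)} {σ : Space n → Space n → ℝ}
  {k : Space n → Space n → Space n → ℝ}

theorem cutSigma_of_mem {x v : Space n} (hx : x ∈ X) (hv : v ∈ V.carrier) :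
    cutSigma X V σ x v = σ x v := indicator_of_mem (mk_mem_prod hx hv) _

theorem cutSigma_of_notMem {x v : Space n} (hx : x ∉ X) : cutSigma X V σ x v = 0 :=
  indicator_of_notMem (fun h => hx h.1) _

theorem cutK_of_mem {x v' v : Space n} (hx : x ∈ X) (hv' : v' ∈ V.carrier)
    (hv : v ∈ V.carrier) : cutK X V k x v' v = k x v' v :=
  indicator_of_mem (mk_mem_prod hx (mk_mem_prod hv' hv)) _

theorem cutK_of_notMem {x v' v : Space n} (hx : x ∉ X) : cutK X V k x v' v = 0 :=
  indicator_of_notMem (fun h => hx h.1) _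

theorem mem_or_notMem_closure (hX : IsOpen X) {x : Space n} (hx : x ∉ frontier X) :
    x ∈ X ∨ x ∉ closure X := by
  by_contra! h
  exact hx ⟨h.2, by rw [hX.interior_eq]; exact h.1⟩

theorem cutSigma_eq (hX : IsOpen X) (h : ContinuousIn X V σ k) {x v : Space n}
    (hx : x ∉ frontier X) (hv : v ∈ V.carrier) : cutSigma X V σ x v = σ x v := by
  rcases mem_or_notMem_closure hX hx with hx | hx
  · exact cutSigma_of_mem hx hv
  · rw [cutSigma_of_notMem fun h => hx (subset_closure h), h.sigma_zero x hx v hv]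

theorem cutK_eq (hX : IsOpen X) (h : ContinuousIn X V σ k) {x v' v : Space n}
    (hx : x ∉ frontier X) (hv' : v' ∈ V.carrier) (hv : v ∈ V.carrier) :
    cutK X V k x v' v = k x v' v := by
  rcases mem_or_notMem_closure hX hx with hx | hx
  · exact cutK_of_mem hx hv' hv
  · rw [cutK_of_notMem fun h => hx (subset_closure h), h.k_zero x hx v' hv' v hv]

theorem measurable_cutSigma (hX : IsOpen X) (h : ContinuousIn X V σ k) :
    Measurable fun p : Space n × Space n => cutSigma X V σ p.1 p.2 := by
  have hs : MeasurableSet (X ×ˢ V.carrier) := hX.measurableSet.prod V.measurableSet_carrier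
  have : Measurable ((X ×ˢ V.carrier).indicator fun p => σ p.1 p.2) := by
    classical
    rw [← piecewise_eq_indicator]
    exact h.sigma_continuousOn.measurable_piecewise continuousOn_const hs
  exact this

theorem measurable_cutK (hX : IsOpen X) (h : ContinuousIn X V σ k) :
    Measurable fun p : Space n × Space n × Space n => cutK X V k p.1 p.2.1 p.2.2 := by
  have hs : MeasurableSet (X ×ˢ (V.carrier ×ˢ V.carrier)) :=
    hX.measurableSet.prod (V.measurableSet_carrier.prod V.measurableSet_carrier)
  have : Measurable ((X ×ˢ (V.carrier ×ˢ V.carrier)).indicator fun p => k p.1 p.2.1 p.2.2) := by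
    classical
    rw [← piecewise_eq_indicator]
    exact h.k_continuousOn.measurable_piecewise continuousOn_const hs
  exact this

/-- The total scattering coefficient is bounded at every point of `X × V`. -/
theorem lintegral_cutK_le (hX : IsOpen X) (ha : Admissible R V σ k) (h : ContinuousIn X V σ k)
    (x v' : Space n) :
    ∫⁻ v, ENNReal.ofReal (cutK X V k x v' v) ∂V.measure ≤
      eLpNormEssSup (fun p : Space n × Space n => sigmaP V k p.1 p.2)
        (volume.prod V.measure) := by
  set C := eLpNormEssSup (fun p : Space n × Space n => sigmaP V k p.1 p.2)
    (volume.prod V.measure) with hC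
  by_cases hx : x ∈ X
  swap
  · simp [cutK_of_notMem hx]
  by_cases hv' : v' ∈ V.carrier
  swap
  · have : ∀ v, cutK X V k x v' v = 0 := fun v => indicator_of_notMem (fun h => hv' h.2.1) _
    simp [this]
  have hae : ∀ᵐ p ∂(volume : Measure (Space n)).prod V.measure,
      ∫⁻ v, ENNReal.ofReal (k p.1 p.2 v) ∂V.measure ≤ C := by
    filter_upwards [ha.k_integrable, ae_le_eLpNormEssSup
      (f := fun p : Space n × Space n => sigmaP V k p.1 p.2)
      (μ := (volume : Measure (Space n)).prod V.measure)] with p hp hle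
    rw [← ofReal_integral_eq_lintegral_ofReal hp.2 hp.1]
    refine le_trans ?_ hle
    exact Real.ofReal_le_enorm _
  -- The bound holds at points arbitrarily close to `(x, v')`. Continuity of `k` on `X` and Fatou's
  -- lemma along a sequence of such points carry it over to `(x, v')` itself.
  have hfr := (V.frequently_of_ae hae x hv').and_eventually
    ((hX.prod isOpen_univ).mem_nhds (mk_mem_prod hx (mem_univ v')))
  obtain ⟨p, hp, hpP⟩ := exists_seq_forall_of_frequently hfr
  have hmeas : ∀ i, Measurable fun v => ENNReal.ofReal (cutK X V k (p i).1 (p i).2 v) :=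
    fun i => ((measurable_cutK hX h).comp (f := fun v => ((p i).1, (p i).2, v))
      (by fun_prop)).ennreal_ofReal
  have hlim : ∀ᵐ v ∂V.measure, ENNReal.ofReal (cutK X V k x v' v) =
      liminf (fun i => ENNReal.ofReal (cutK X V k (p i).1 (p i).2 v)) atTop := by
    filter_upwards [V.ae_mem] with v hv
    refine (Tendsto.liminf_eq ?_).symm
    refine ENNReal.tendsto_ofReal ?_
    rw [cutK_of_mem hx hv' hv]
    have hc := h.k_continuousOn (x, v', v) (mk_mem_prod hx (mk_mem_prod hv' hv))
    have ht : Tendsto (fun i => ((p i).1, (p i).2, v)) atTop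
        (𝓝[X ×ˢ (V.carrier ×ˢ V.carrier)] (x, v', v)) := by
      refine tendsto_nhdsWithin_iff.2 ⟨?_, Eventually.of_forall fun i =>
        mk_mem_prod (hpP i).2.1 (mk_mem_prod (hpP i).1.1 hv)⟩
      have h1 := (continuous_fst.tendsto (x, v')).comp hp
      have h2 := (continuous_snd.tendsto (x, v')).comp hp
      exact h1.prodMk_nhds (h2.prodMk_nhds tendsto_const_nhds)
    refine (hc.tendsto.comp ht).congr fun i => ?_
    exact (cutK_of_mem (hpP i).2.1 (hpP i).1.1 hv).symm
  rw [lintegral_congr_ae hlim]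
  refine (lintegral_liminf_le hmeas).trans ?_
  refine liminf_le_of_le (by isBoundedDefault) fun b hb => ?_
  obtain ⟨i, hi⟩ := hb.exists
  refine hi.trans (le_trans (le_of_eq ?_) (hpP i).1.2)
  refine lintegral_congr_ae ?_
  filter_upwards [V.ae_mem] with v hv
  rw [cutK_of_mem (hpP i).2.1 (hpP i).1.1 hv]

/-- The constant dominates the suprema of `σ` and `k` on `X` and the essential supremum of `σ_p`.
The closure of `X` lies in the open ball, which gives vanishing already at `|x| = R`. -/
theorem exists_regular (hX : IsOpen X) (hXR : closure X ⊆ ball 0 R) (ha : Admissible R V σ k)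
    (h : ContinuousIn X V σ k) : ∃ M, Regular R V (cutSigma X V σ) (cutK X V k) M := by
  obtain ⟨M₁, h₁⟩ := h.sigma_bounded
  obtain ⟨M₂, h₂⟩ := h.k_bounded
  set C := eLpNormEssSup (fun p : Space n × Space n => sigmaP V k p.1 p.2)
    (volume.prod V.measure) with hC
  have hCt : C ≠ ∞ := by
    have := ha.sigmaP_memLp.2
    rw [eLpNorm_exponent_top] at this
    exact this.ne
  have hout : ∀ x : Space n, R ≤ ‖x‖ → x ∉ X := fun x hx hxX => by
    have := hXR (subset_closure hxX)
    rw [mem_ball_zero_iff] at this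
    linarith
  refine ⟨max 0 (max M₁ (max M₂ C.toReal)), le_max_left _ _, measurable_cutSigma hX h, ?_, ?_,
    fun x v hx => cutSigma_of_notMem (hout x hx), measurable_cutK hX h, ?_, ?_,
    fun x v' v hx => cutK_of_notMem (hout x hx), fun x v' => ?_⟩
  · intro x v
    exact indicator_apply_nonneg fun hp => h.sigma_nonneg _ hp.1 _ hp.2
  · intro x v
    exact indicator_apply_le' (fun hp => (h₁ _ hp.1 _ hp.2).trans (by simp))
      fun _ => le_max_left _ _
  · intro x v' v
    exact indicator_apply_nonneg fun hp => h.k_nonneg _ hp.1 _ hp.2.1 _ hp.2.2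
  · intro x v' v
    exact indicator_apply_le' (fun hp => (h₂ _ hp.1 _ hp.2.1 _ hp.2.2).trans (by simp))
      fun _ => le_max_left _ _
  · refine (lintegral_cutK_le hX ha h x v').trans ((ENNReal.ofReal_toReal hCt).symm.le.trans ?_)
    exact ENNReal.ofReal_le_ofReal
      (le_max_of_le_right (le_max_of_le_right (le_max_right _ _)))

/-! ### Invariance of the transport equation under the restriction of the coefficients. -/

theorem scatter_cut (hX : IsOpen X) (h : ContinuousIn X V σ k) (f : Space n × Space n → ℝ)
    {p : Space n × Space n} (hp : p.1 ∉ frontier X) (hv : p.2 ∈ V.carrier) :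
    scatter V (cutK X V k) f p = scatter V k f p := by
  refine integral_congr_ae ?_
  filter_upwards [V.ae_mem] with v' hv'
  rw [cutK_eq hX h hp hv' hv]

theorem ae_backward {X : Set (Space n)} {x e : Space n} (h : ∀ᵐ t : ℝ, x + t • e ∉ frontier X) :
    ∀ᵐ t : ℝ, x - t • e ∉ frontier X := by
  have := (Measure.measurePreserving_neg (volume : Measure ℝ)).quasiMeasurePreserving.ae h
  simpa [sub_eq_add_neg] using this

theorem attenuation_cut (hX : IsOpen X) (h : ContinuousIn X V σ k) {p : Space n × Space n}
    (hp : ∀ᵐ t : ℝ, p.1 + t • dir p.2 ∉ frontier X) (hv : p.2 ∈ V.carrier) (t : ℝ) :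
    attenuation (cutSigma X V σ) p.1 p.2 t = attenuation σ p.1 p.2 t := by
  rw [attenuation, attenuation]
  congr 3
  refine intervalIntegral.integral_congr_ae ?_
  filter_upwards [ae_backward hp] with s hs _
  exact cutSigma_eq hX h hs hv

theorem opK_cut (hX : IsOpen X) (h : ContinuousIn X V σ k) (f : Space n × Space n → ℝ)
    {p : Space n × Space n}
    (hp : ∀ᵐ t : ℝ, p.1 + t • dir p.2 ∉ frontier X) (hv : p.2 ∈ V.carrier) :
    opK R V (cutSigma X V σ) (cutK X V k) f p = opK R V σ k f p := by
  rw [opK, opK]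
  congr 2
  refine intervalIntegral.integral_congr_ae ?_
  filter_upwards [ae_backward hp] with s hs _
  rw [attenuation_cut hX h hp hv, scatter_cut hX h f (p := (p.1 - s • dir p.2, p.2)) hs hv]

theorem opJ_cut (hX : IsOpen X) (h : ContinuousIn X V σ k) (g : Space n × Space n → ℝ)
    {p : Space n × Space n}
    (hp : ∀ᵐ t : ℝ, p.1 + t • dir p.2 ∉ frontier X) (hv : p.2 ∈ V.carrier) :
    opJ R (cutSigma X V σ) g p = opJ R σ g p := by
  rw [opJ, opJ, attenuation_cut hX h hp hv]

/-- The frontier of a convex set is Lebesgue null. For fixed `t` and `v` the map `x ↦ x + t v̂`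
preserves Lebesgue measure, so Fubini gives the claim, also for lines that miss `X`. -/
theorem ae_phase_line_notMem_frontier (hc : Convex ℝ X) :
    ∀ᵐ p ∂phaseMeasure R V, ∀ᵐ t : ℝ, p.1 + t • dir p.2 ∉ frontier X := by
  refine withDensity_absolutelyContinuous _ _ (ae_restrict_of_ae ?_)
  have hd := measurable_dir (n := n)
  have hms : MeasurableSet {q : (Space n × Space n) × ℝ |
      q.1.1 + q.2 • dir q.1.2 ∉ frontier X} := by
    have : Measurable fun q : (Space n × Space n) × ℝ => q.1.1 + q.2 • dir q.1.2 := by fun_prop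
    exact this isClosed_frontier.measurableSet.compl
  refine Measure.ae_ae_of_ae_prod (p := fun q : (Space n × Space n) × ℝ =>
    q.1.1 + q.2 • dir q.1.2 ∉ frontier X) ?_
  rw [Measure.ae_prod_iff_ae_ae hms, Measure.ae_ae_comm hms]
  refine Eventually.of_forall fun t => ?_
  have hms2 : MeasurableSet {q : Space n × Space n | q.1 + t • dir q.2 ∉ frontier X} := by
    have : Measurable fun q : Space n × Space n => q.1 + t • dir q.2 := by fun_prop
    exact this isClosed_frontier.measurableSet.compl
  rw [Measure.ae_prod_iff_ae_ae hms2, Measure.ae_ae_comm hms2]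
  refine Eventually.of_forall fun v => ?_
  have h0 : ∀ᵐ x : Space n, x ∉ frontier X :=
    measure_eq_zero_iff_ae_notMem.1 (hc.addHaar_frontier volume)
  exact (measurePreserving_add_right volume (t • dir v)).quasiMeasurePreserving.ae h0

theorem opK_cut_ae (hX : IsOpen X) (hc : Convex ℝ X) (h : ContinuousIn X V σ k)
    (f : Space n × Space n → ℝ) :
    opK R V (cutSigma X V σ) (cutK X V k) f =ᵐ[phaseMeasure R V] opK R V σ k f := by
  filter_upwards [ae_phase_line_notMem_frontier hc, ae_phase_mem R V] with p hp hO
  exact opK_cut hX h f hp hO.1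

theorem opJ_cut_ae (hX : IsOpen X) (hc : Convex ℝ X) (h : ContinuousIn X V σ k)
    (g : Space n × Space n → ℝ) :
    opJ R (cutSigma X V σ) g =ᵐ[phaseMeasure R V] opJ R σ g := by
  filter_upwards [ae_phase_line_notMem_frontier hc, ae_phase_mem R V] with p hp hO
  exact opJ_cut hX h g hp hO.1

theorem subcritical_cut (hX : IsOpen X) (hc : Convex ℝ X) (h : ContinuousIn X V σ k)
    (hs : Subcritical R V σ k) : Subcritical R V (cutSigma X V σ) (cutK X V k) := by
  obtain ⟨B, hB⟩ := hs
  refine ⟨B, fun f g => Iff.trans ?_ (hB f g)⟩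
  have : (fun p => f p + opK R V (cutSigma X V σ) (cutK X V k) f p) =ᵐ[phaseMeasure R V]
      fun p => f p + opK R V σ k f p := by
    filter_upwards [opK_cut_ae hX hc h f] with p hp
    rw [hp]
  exact ⟨fun hh => this.symm.trans hh, fun hh => this.trans hh⟩

/-- The integral equation changes only on a null set of phase space, and the trace condition does
not involve the coefficients. -/
theorem isAlbedo_cut (hX : IsOpen X) (hc : Convex ℝ X) (h : ContinuousIn X V σ k)
    (A : L1In R V →L[ℝ] L1Out R V) :
    IsAlbedo R V (cutSigma X V σ) (cutK X V k) A ↔ IsAlbedo R V σ k A := by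
  refine forall_congr' fun g => exists_congr fun f => and_congr_left fun _ => ?_
  have h1 : (fun p => f p + opK R V (cutSigma X V σ) (cutK X V k) f p) =ᵐ[phaseMeasure R V]
      fun p => f p + opK R V σ k f p := by
    filter_upwards [opK_cut_ae hX hc h f] with p hp
    rw [hp]
  have h2 := opJ_cut_ae (R := R) hX hc h g
  exact ⟨fun hh => h1.symm.trans (hh.trans h2), fun hh => h1.trans (hh.trans h2.symm)⟩

end Cut

/-! ### Incoming conditions concentrated near a line -/

theorem continuousAt_foot {p : Space n × Space n} (hv : p.2 ≠ 0) : ContinuousAt foot p := by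
  have hd : ContinuousAt (fun q : Space n × Space n => dir q.2) p :=
    (VelocityDomain.continuousAt_dir hv).comp continuousAt_snd
  have h1 : ContinuousAt (fun q : Space n × Space n => ⟪q.1, dir q.2⟫) p :=
    continuousAt_fst.inner (𝕜 := ℝ) hd
  exact (continuousAt_fst.sub (h1.smul hd)).prodMk continuousAt_snd

/-- If `U` were null, almost no phase point could project into `U`. However, the projection is
continuous at `p` and fixes `p`, so every point of `O` close enough to `p` projects into `U`. -/
theorem fluxMeasure_pos {R : ℝ} (hR : 0 < R) {V : VelocityDomain n} {p : Space n × Space n}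
    (hp : p ∈ discBundle R V) {U : Set (Space n × Space n)} (hU : U ∈ 𝓝 p)
    (hUm : MeasurableSet U) : 0 < fluxMeasure R V 0 U := by
  have hv := VelocityDomain.ne_zero hp.1
  refine pos_iff_ne_zero.2 fun h0 => ?_
  have hmap : Measurable fun q : Space n × Space n => (perp q.2 q.1 + (0 : ℝ) • dir q.2, q.2) := by
    simp only [zero_smul, add_zero]; exact measurable_foot
  rw [fluxMeasure_eq_map hR, Measure.smul_apply, Measure.map_apply hmap hUm, smul_eq_mul,
    mul_eq_zero] at h0
  rcases h0 with h0 | h0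
  · exact absurd h0 (ENNReal.inv_ne_zero.2 ENNReal.ofReal_ne_top)
  simp only [zero_smul, add_zero] at h0
  have hae : ∀ᵐ q ∂phaseMeasure R V, foot q ∉ U := measure_eq_zero_iff_ae_notMem.1 h0
  rw [phaseMeasure, ae_withDensity_iff (by fun_prop),
    ae_restrict_iff' (measurableSet_phaseSpace R V)] at hae
  have hfr := V.frequently_of_ae hae p.1 hp.1
  have hfoot : ∀ᶠ q in 𝓝 p, foot q ∈ U := by
    have := (continuousAt_foot hv).tendsto
    rw [foot_eq_self hp] at this
    exact this hU
  have hnorm : ∀ᶠ q : Space n × Space n in 𝓝 p, ‖q.1‖ < R :=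
    (continuous_fst.norm.tendsto p).eventually_lt_const hp.2.2
  obtain ⟨q, ⟨hq1, hq2⟩, hq3, hq4⟩ := (hfr.and_eventually (hfoot.and hnorm)).exists
  exact hq2 (mem_phaseSpace_of_norm_lt hq4 hq1) (enorm_ne_zero_of_mem hq1) hq3

theorem fluxMeasure_lt_top {R : ℝ} (hR : 0 < R) (V : VelocityDomain n) (B : ℝ) :
    fluxMeasure R V 0 {p | ‖p.2‖ < B} < ∞ := by
  have hms : MeasurableSet {p : Space n × Space n | ‖p.2‖ < B} :=
    measurableSet_lt (by fun_prop) measurable_const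
  have hmap : Measurable fun q : Space n × Space n => (perp q.2 q.1 + (0 : ℝ) • dir q.2, q.2) := by
    simp only [zero_smul, add_zero]; exact measurable_foot
  rw [fluxMeasure_eq_map hR, Measure.smul_apply, Measure.map_apply hmap hms, smul_eq_mul]
  refine ENNReal.mul_lt_top (by simp [hR]) ?_
  have hpre : (fun q : Space n × Space n => (perp q.2 q.1 + (0 : ℝ) • dir q.2, q.2)) ⁻¹'
      {p | ‖p.2‖ < B} = {p | ‖p.2‖ < B} := rfl
  rw [hpre, ← lintegral_indicator_one hms,
    lintegral_phaseMeasure_eq_prod R V (measurable_one.indicator hms)]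
  -- On `O` both orthogonal components of `x` are smaller than `R`, hence `|x|² < 2 R² ≤ (2 R)²`.
  refine lt_of_le_of_lt (b := ∫⁻ p in closedBall (0 : Space n) (2 * R) ×ˢ closedBall (0 : Space n) B,
    ENNReal.ofReal B ∂(volume.prod V.measure)) ?_ ?_
  · rw [← lintegral_indicator (measurableSet_phaseSpace R V), ← lintegral_indicator
      (isClosed_closedBall.measurableSet.prod isClosed_closedBall.measurableSet)]
    refine lintegral_mono fun p => ?_
    by_cases hO : p ∈ phaseSpace R V
    · by_cases hB : ‖p.2‖ < B
      · rw [indicator_of_mem hO, indicator_of_mem (by exact hB), indicator_of_mem]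
        · rw [Pi.one_apply, mul_one, ← ofReal_norm]
          exact ENNReal.ofReal_le_ofReal hB.le
        · refine ⟨?_, by simpa using hB.le⟩
          have h1 := norm_sq_eq_perp (VelocityDomain.ne_zero hO.1) p.1
          have h2 := sq_lt_sq' (by linarith [norm_nonneg (perp p.2 p.1)]) hO.2.2
          have h3 := sq_lt_sq' (abs_lt.1 hO.2.1).1 (abs_lt.1 hO.2.1).2
          rw [mem_closedBall_zero_iff]
          nlinarith [norm_nonneg p.1]
      · rw [indicator_of_mem hO, indicator_of_notMem (by exact hB), mul_zero]
        exact zero_le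
    · rw [indicator_of_notMem hO]
      exact zero_le
  · rw [setLIntegral_const, Measure.prod_prod]
    exact ENNReal.mul_lt_top ENNReal.ofReal_lt_top
      (ENNReal.mul_lt_top (isCompact_closedBall _ _).measure_lt_top
        (V.measure_closedBall_lt_top B))

/-- Normalized nonnegative incoming conditions supported near a given line. -/
theorem exists_concentrated {R : ℝ} (hR : 0 < R) {V : VelocityDomain n} {p : Space n × Space n}
    (hp : p ∈ discBundle R V) {U : Set (Space n × Space n)} (hU : U ∈ 𝓝 p) :
    ∃ (g : L1In R V) (φ : Space n × Space n → ℝ), Measurable φ ∧ (∀ q, 0 ≤ φ q) ∧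
      g =ᵐ[fluxMeasure R V (-R)] φ ∧ ‖g‖ = 1 ∧ ∫⁻ q, ‖φ q‖ₑ ∂fluxMeasure R V (-R) = 1 ∧
      ∫⁻ q, ENNReal.ofReal (φ (shift (-R) q)) ∂fluxMeasure R V 0 = 1 ∧
      ∀ q, q ∉ U → φ (shift (-R) q) = 0 := by
  obtain ⟨U₁, hU₁U, hU₁, hpU₁⟩ := _root_.mem_nhds_iff.1 hU
  -- Bounding the speed makes the neighbourhood have finite flux measure, so that its indicator can
  -- be normalized.
  let U' := U₁ ∩ {q : Space n × Space n | ‖q.2‖ < ‖p.2‖ + 1}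
  have hU'o : IsOpen U' :=
    hU₁.inter (isOpen_lt continuous_snd.norm continuous_const)
  have hpU' : p ∈ U' := ⟨hpU₁, by simp⟩
  have hU'm := hU'o.measurableSet
  have hpos := fluxMeasure_pos hR hp (hU'o.mem_nhds hpU') hU'm
  have hfin : fluxMeasure R V 0 U' < ∞ :=
    (measure_mono inter_subset_right).trans_lt (fluxMeasure_lt_top hR V (‖p.2‖ + 1))
  let b := (fluxMeasure R V 0 U').toReal⁻¹
  have hb : 0 ≤ b := by positivity
  let φ : Space n × Space n → ℝ := fun q => U'.indicator (fun _ => b) (shift R q)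
  have hφm : Measurable φ := (measurable_const.indicator hU'm).comp (measurable_shift R)
  have hφ0 : ∀ q, 0 ≤ φ q := fun q => indicator_nonneg (fun _ _ => hb) _
  have hφs : ∀ q, φ (shift (-R) q) = U'.indicator (fun _ => b) q := fun q => by
    simp only [φ, shift_shift, neg_add_cancel, shift_zero]
  have h_int : ∫⁻ q, ENNReal.ofReal (φ (shift (-R) q)) ∂fluxMeasure R V 0 = 1 := by
    have : ∀ q, ENNReal.ofReal (φ (shift (-R) q)) =
        U'.indicator (fun _ => ENNReal.ofReal b) q := fun q => by
      rw [hφs]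
      by_cases hq : q ∈ U' <;> simp [hq]
    simp_rw [this]
    rw [lintegral_indicator_const hU'm, ENNReal.ofReal_inv_of_pos
      (ENNReal.toReal_pos hpos.ne' hfin.ne), ENNReal.ofReal_toReal hfin.ne,
      ENNReal.inv_mul_cancel hpos.ne' hfin.ne]
  have h_int' : ∫⁻ q, ‖φ q‖ₑ ∂fluxMeasure R V (-R) = 1 := by
    rw [← h_int, ← (measurePreserving_shift hR V (-R) (zero_add (-R))).lintegral_comp hφm.enorm]
    refine lintegral_congr fun q => ?_
    rw [Real.enorm_of_nonneg (hφ0 _)]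
  have hI : Integrable φ (fluxMeasure R V (-R)) :=
    ⟨hφm.aestronglyMeasurable, by rw [hasFiniteIntegral_iff_enorm, h_int']; simp⟩
  refine ⟨hI.toL1 φ, φ, hφm, hφ0, hI.coeFn_toL1, ?_, h_int', h_int, fun q hq => ?_⟩
  · rw [Integrable.norm_toL1_eq_lintegral_norm]
    simp only [ofReal_norm]
    rw [h_int', ENNReal.toReal_one]
  · rw [hφs, indicator_of_notMem fun h => hq (hU₁U h.1)]

/-! ### Continuity near a line that meets the convex set -/

section Limits

variable {R : ℝ} {V : VelocityDomain n} {X : Set (Space n)} {σ : Space n → Space n → ℝ}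
  {k : Space n → Space n → Space n → ℝ} {ι : Type*} {l : Filter ι}

/-- Inside `X` this is the continuity of `σ`; outside the closure the restricted coefficient is
locally zero. The velocities converge within `V`, since continuity is known only relative to `V`. -/
theorem tendsto_cutSigma (hX : IsOpen X) (h : ContinuousIn X V σ k) {y w : ι → Space n}
    {y₀ w₀ : Space n} (hy₀ : y₀ ∉ frontier X) (hw₀ : w₀ ∈ V.carrier)
    (hy : Tendsto y l (𝓝 y₀)) (hw : Tendsto w l (𝓝[V.carrier] w₀)) :
    Tendsto (fun i => cutSigma X V σ (y i) (w i)) l (𝓝 (cutSigma X V σ y₀ w₀)) := by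
  rcases mem_or_notMem_closure hX hy₀ with hy₀ | hy₀
  · rw [cutSigma_of_mem hy₀ hw₀]
    obtain ⟨hw1, hw2⟩ := tendsto_nhdsWithin_iff.1 hw
    have hyX : ∀ᶠ i in l, y i ∈ X := hy (hX.mem_nhds hy₀)
    have ht : Tendsto (fun i => (y i, w i)) l (𝓝[X ×ˢ V.carrier] (y₀, w₀)) := by
      refine tendsto_nhdsWithin_iff.2 ⟨hy.prodMk_nhds hw1, ?_⟩
      filter_upwards [hyX, hw2] with i h1 h2 using mk_mem_prod h1 h2
    refine ((h.sigma_continuousOn _ (mk_mem_prod hy₀ hw₀)).tendsto.comp ht).congr' ?_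
    filter_upwards [hyX, hw2] with i h1 h2
    exact (cutSigma_of_mem h1 h2).symm
  · rw [cutSigma_of_notMem fun h => hy₀ (subset_closure h)]
    refine tendsto_const_nhds.congr' ?_
    filter_upwards [hy (isClosed_closure.isOpen_compl.mem_nhds hy₀)] with i hi
    exact (cutSigma_of_notMem fun h => hi (subset_closure h)).symm

theorem tendsto_cutK (hX : IsOpen X) (h : ContinuousIn X V σ k) {y w : ι → Space n}
    {y₀ w₀ v : Space n} (hy₀ : y₀ ∉ frontier X) (hw₀ : w₀ ∈ V.carrier) (hv : v ∈ V.carrier)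
    (hy : Tendsto y l (𝓝 y₀)) (hw : Tendsto w l (𝓝[V.carrier] w₀)) :
    Tendsto (fun i => cutK X V k (y i) (w i) v) l (𝓝 (cutK X V k y₀ w₀ v)) := by
  rcases mem_or_notMem_closure hX hy₀ with hy₀ | hy₀
  · rw [cutK_of_mem hy₀ hw₀ hv]
    obtain ⟨hw1, hw2⟩ := tendsto_nhdsWithin_iff.1 hw
    have hyX : ∀ᶠ i in l, y i ∈ X := hy (hX.mem_nhds hy₀)
    have ht : Tendsto (fun i => (y i, w i, v)) l
        (𝓝[X ×ˢ (V.carrier ×ˢ V.carrier)] (y₀, w₀, v)) := by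
      refine tendsto_nhdsWithin_iff.2 ⟨hy.prodMk_nhds (hw1.prodMk_nhds tendsto_const_nhds), ?_⟩
      filter_upwards [hyX, hw2] with i h1 h2 using mk_mem_prod h1 (mk_mem_prod h2 hv)
    refine ((h.k_continuousOn _ (mk_mem_prod hy₀ (mk_mem_prod hw₀ hv))).tendsto.comp
      ht).congr' ?_
    filter_upwards [hyX, hw2] with i h1 h2
    exact (cutK_of_mem h1 h2 hv).symm
  · rw [cutK_of_notMem fun h => hy₀ (subset_closure h)]
    refine tendsto_const_nhds.congr' ?_
    filter_upwards [hy (isClosed_closure.isOpen_compl.mem_nhds hy₀)] with i hi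
    exact (cutK_of_notMem fun h => hi (subset_closure h)).symm

/-- Only the limiting line has to avoid the frontier almost everywhere. The integrands then converge
at almost every `s` and are bounded by `M`. -/
theorem tendsto_depth [l.IsCountablyGenerated] (hX : IsOpen X) (h : ContinuousIn X V σ k)
    {M : ℝ} (hreg : Regular R V (cutSigma X V σ) (cutK X V k) M) (a b : ℝ)
    {y e w : ι → Space n} {y₀ e₀ w₀ : Space n} (hfr : ∀ᵐ s : ℝ, y₀ + s • e₀ ∉ frontier X)
    (hw₀ : w₀ ∈ V.carrier) (hy : Tendsto y l (𝓝 y₀)) (he : Tendsto e l (𝓝 e₀))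
    (hw : Tendsto w l (𝓝[V.carrier] w₀)) :
    Tendsto (fun i => ∫ s in a..b, cutSigma X V σ (y i + s • e i) (w i)) l
      (𝓝 (∫ s in a..b, cutSigma X V σ (y₀ + s • e₀) w₀)) := by
  refine intervalIntegral.tendsto_integral_filter_of_dominated_convergence (fun _ => M)
    (Eventually.of_forall fun i => ?_) (Eventually.of_forall fun i => Eventually.of_forall
      fun s _ => ?_) intervalIntegrable_const ?_
  · exact (hreg.sigma_measurable.comp (f := fun s : ℝ => (y i + s • e i, w i))
      (by fun_prop)).aestronglyMeasurable
  · rw [Real.norm_of_nonneg (hreg.sigma_nonneg _ _)]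
    exact hreg.sigma_le _ _
  · filter_upwards [hfr] with s hs _
    exact tendsto_cutSigma hX h hs hw₀ (hy.add (tendsto_const_nhds.smul he)) hw

theorem tendsto_dir {w : ι → Space n} {w₀ : Space n} (hw₀ : w₀ ∈ V.carrier)
    (hw : Tendsto w l (𝓝[V.carrier] w₀)) : Tendsto (fun i => dir (w i)) l (𝓝 (dir w₀)) :=
  ((VelocityDomain.continuousAt_dir (VelocityDomain.ne_zero hw₀)).tendsto).comp
    (hw.mono_right nhdsWithin_le_nhds)

theorem tendsto_inv_norm {w : ι → Space n} {w₀ : Space n} (hw₀ : w₀ ∈ V.carrier)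
    (hw : Tendsto w l (𝓝[V.carrier] w₀)) : Tendsto (fun i => ‖w i‖⁻¹) l (𝓝 ‖w₀‖⁻¹) :=
  (hw.mono_right nhdsWithin_le_nhds).norm.inv₀ (by simpa using VelocityDomain.ne_zero hw₀)

theorem tendsto_outAtt [l.IsCountablyGenerated] (hX : IsOpen X) (h : ContinuousIn X V σ k)
    {M : ℝ} (hreg : Regular R V (cutSigma X V σ) (cutK X V k) M)
    {y w : ι → Space n} {y₀ w₀ : Space n} (hfr : ∀ᵐ s : ℝ, y₀ + s • dir w₀ ∉ frontier X)
    (hw₀ : w₀ ∈ V.carrier) (hy : Tendsto y l (𝓝 y₀)) (hw : Tendsto w l (𝓝[V.carrier] w₀)) :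
    Tendsto (fun i => outAtt R (cutSigma X V σ) (y i, w i)) l
      (𝓝 (outAtt R (cutSigma X V σ) (y₀, w₀))) :=
  (Real.continuous_exp.tendsto _).comp ((tendsto_inv_norm hw₀ hw).mul
    (tendsto_depth hX h hreg _ _ hfr hw₀ hy (tendsto_dir hw₀ hw) hw)).neg

theorem tendsto_inAtt [l.IsCountablyGenerated] (hX : IsOpen X) (h : ContinuousIn X V σ k)
    {M : ℝ} (hreg : Regular R V (cutSigma X V σ) (cutK X V k) M)
    {y w : ι → Space n} {y₀ w₀ : Space n} (hfr : ∀ᵐ s : ℝ, y₀ + s • dir w₀ ∉ frontier X)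
    (hw₀ : w₀ ∈ V.carrier) (hy : Tendsto y l (𝓝 y₀)) (hw : Tendsto w l (𝓝[V.carrier] w₀)) :
    Tendsto (fun i => inAtt R (cutSigma X V σ) (y i, w i)) l
      (𝓝 (inAtt R (cutSigma X V σ) (y₀, w₀))) := by
  have hfr' : ∀ᵐ s : ℝ, y₀ + s • -dir w₀ ∉ frontier X := by
    simpa [sub_eq_add_neg] using ae_backward hfr
  have := (Real.continuous_exp.tendsto _).comp ((tendsto_inv_norm hw₀ hw).mul
    (tendsto_depth hX h hreg 0 (2 * R) hfr' hw₀ hy (tendsto_dir hw₀ hw).neg hw)).neg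
  simpa [inAtt, sub_eq_add_neg, Function.comp_def] using this

end Limits

/-! ### The flux of particles scattered once on a fixed line -/

/-- A test function for outgoing particles with velocity in `Z` whose characteristic line has
distance less than `δ` from the line `x₀ + ℝ e`; the value depends on the velocity and on the
nearest point of that line. -/
def testWeight (x₀ e : Space n) (Z : Set (Space n)) (δ : ℝ) (ϑ : ℝ × Space n → ℝ≥0∞)
    (p : Space n × Space n) : ℝ≥0∞ :=
  Z.indicator 1 p.2 * ((Iio δ).indicator 1 (nearDist x₀ e p) * ϑ (nearParam x₀ e p, p.2))

/-- The flux of the particles that enter on the line `x₀ + ℝ v₀`, are scattered once and leave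
with velocity in `Z`, weighted by `ϑ`. -/
def singleFlux (R : ℝ) (V : VelocityDomain n) (σ : Space n → Space n → ℝ)
    (k : Space n → Space n → Space n → ℝ) (x₀ v₀ : Space n) (Z : Set (Space n))
    (ϑ : ℝ × Space n → ℝ≥0∞) : ℝ≥0∞ :=
  ‖v₀‖ₑ⁻¹ * ∫⁻ r in Ioo (-R) R, ENNReal.ofReal (inAtt R σ (x₀ + r • dir v₀, v₀)) *
    ∫⁻ v in Z, ϑ (r, v) * ENNReal.ofReal (outAtt R σ (x₀ + r • dir v₀, v)) *
      ENNReal.ofReal (k (x₀ + r • dir v₀) v₀ v) ∂V.measure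

theorem measurable_testWeight (x₀ e : Space n) {Z : Set (Space n)} (hZ : MeasurableSet Z) (δ : ℝ)
    {ϑ : ℝ × Space n → ℝ≥0∞} (hϑ : Measurable ϑ) : Measurable (testWeight x₀ e Z δ ϑ) :=
  ((measurable_one.indicator hZ).comp measurable_snd).mul
    (((measurable_one.indicator measurableSet_Iio).comp (measurable_nearDist x₀ e)).mul
      (hϑ.comp ((measurable_nearParam x₀ e).prodMk measurable_snd)))

theorem testWeight_shift_foot {v : Space n} (hv : v ≠ 0) (x₀ e : Space n) (Z : Set (Space n))
    (δ : ℝ) (ϑ : ℝ × Space n → ℝ≥0∞) (c : ℝ) (y : Space n) :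
    testWeight x₀ e Z δ ϑ (shift c (foot (y, v))) = testWeight x₀ e Z δ ϑ (y, v) := by
  simp only [testWeight, nearDist_shift_foot hv, nearParam_shift_foot hv]
  rfl

theorem indicator_one_le {α : Type*} (s : Set α) (a : α) :
    s.indicator (1 : α → ℝ≥0∞) a ≤ 1 := indicator_le_self' (by simp) _

theorem lintegral_testWeight (V : VelocityDomain n) (x₀ e : Space n) {Z : Set (Space n)}
    (hZ : MeasurableSet Z) (δ : ℝ) (ϑ : ℝ × Space n → ℝ≥0∞) (c : ℝ) (y : Space n)
    (F G : Space n → ℝ≥0∞) :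
    ∫⁻ v, testWeight x₀ e Z δ ϑ (shift c (foot (y, v))) * F v * G v ∂V.measure =
      ∫⁻ v in Z, (Iio δ).indicator 1 (nearDist x₀ e (y, v)) * ϑ (nearParam x₀ e (y, v), v) *
        F v * G v ∂V.measure := by
  rw [← lintegral_indicator hZ]
  refine lintegral_congr_ae ?_
  filter_upwards [V.ae_mem] with v hv
  rw [testWeight_shift_foot (VelocityDomain.ne_zero hv), testWeight]
  by_cases hvZ : v ∈ Z <;> simp [hvZ]

section SingleLimit

variable {R M : ℝ} {V : VelocityDomain n} {X : Set (Space n)} {σ : Space n → Space n → ℝ}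
  {k : Space n → Space n → Space n → ℝ}

theorem perp_ne_zero_of_notMem_span {v e : Space n} (he : e ≠ 0) (hv : v ≠ 0)
    (h : v ∉ Submodule.span ℝ {e, e}) : perp v e ≠ 0 := by
  intro h0
  obtain ⟨a, ha⟩ := (perp_eq_zero_iff hv e).1 h0
  have ha0 : a ≠ 0 := by
    rintro rfl
    exact he (by simpa using ha)
  refine h ?_
  have : v = a⁻¹ • e := by rw [ha, smul_smul, inv_mul_cancel₀ ha0, one_smul]
  rw [this]
  exact Submodule.smul_mem _ _ (Submodule.subset_span (by simp))

/-- At a collision point in `X` all factors converge, the cut-off to `1` because the limiting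
outgoing line meets the fixed line. Outside the closure of `X` the factor `k` is eventually zero, so
continuity of `ϑ` matters only over `X`. -/
theorem tendsto_single_velocity (hX : IsOpen X) (hc : Convex ℝ X)
    (h : ContinuousIn X V σ k) (hreg : Regular R V (cutSigma X V σ) (cutK X V k) M)
    {x₀ v₀ v : Space n} (hv₀ : v₀ ∈ V.carrier) (hv : v ∈ V.carrier) (hvp : perp v (dir v₀) ≠ 0)
    {δ : ℝ} (hδ : 0 < δ) {ϑ : ℝ × Space n → ℝ≥0∞} (hϑ1 : ∀ a, ϑ a ≤ 1)
    {r : ℝ} (hr : x₀ + r • dir v₀ ∉ frontier X)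
    (hϑc : x₀ + r • dir v₀ ∈ X → ContinuousAt (fun t => ϑ (t, v)) r)
    {ι : Type*} {l : Filter ι} [l.IsCountablyGenerated] {y w : ι → Space n}
    (hy : Tendsto y l (𝓝 (x₀ + r • dir v₀))) (hw : Tendsto w l (𝓝[V.carrier] v₀)) :
    Tendsto (fun i => (Iio δ).indicator 1 (nearDist x₀ (dir v₀) (y i, v)) *
        ϑ (nearParam x₀ (dir v₀) (y i, v), v) *
        ENNReal.ofReal (outAtt R (cutSigma X V σ) (y i, v)) *
          ENNReal.ofReal (cutK X V k (y i) (w i) v)) l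
      (𝓝 (ϑ (r, v) * ENNReal.ofReal (outAtt R (cutSigma X V σ) (x₀ + r • dir v₀, v)) *
        ENNReal.ofReal (cutK X V k (x₀ + r • dir v₀) v₀ v))) := by
  rcases mem_or_notMem_closure hX hr with hrX | hrX
  · have h1 : Tendsto (fun i => (Iio δ).indicator (1 : ℝ → ℝ≥0∞)
        (nearDist x₀ (dir v₀) (y i, v))) l (𝓝 1) := by
      have hd := ((continuous_nearDist x₀ (dir v₀) v).tendsto _).comp hy
      rw [nearDist_of_mem_line hvp] at hd
      refine tendsto_const_nhds.congr' ?_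
      filter_upwards [hd.eventually_lt_const hδ] with i hi
      rw [indicator_of_mem (by exact hi)]
      rfl
    have h2 : Tendsto (fun i => ϑ (nearParam x₀ (dir v₀) (y i, v), v)) l (𝓝 (ϑ (r, v))) := by
      have hp := ((continuous_nearParam x₀ (dir v₀) v).tendsto _).comp hy
      rw [nearParam_of_mem_line hvp] at hp
      exact (hϑc hrX).tendsto.comp hp
    have h3 := ENNReal.tendsto_ofReal (tendsto_outAtt (w := fun _ => v) hX h hreg
      (ae_line_notMem_frontier hX hc ⟨0, by simpa using hrX⟩) hv hy
      (tendsto_nhdsWithin_iff.2 ⟨tendsto_const_nhds, Eventually.of_forall fun _ => hv⟩))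
    have h4 := ENNReal.tendsto_ofReal (tendsto_cutK (v := v) hX h hr hv₀ hv hy hw)
    have hϑt : ϑ (r, v) ≠ ∞ := ((hϑ1 _).trans_lt ENNReal.one_lt_top).ne
    have h12 := ENNReal.Tendsto.mul h1 (Or.inr hϑt) h2 (Or.inr (by simp))
    rw [one_mul] at h12
    have h123 := ENNReal.Tendsto.mul h12 (Or.inr ENNReal.ofReal_ne_top) h3 (Or.inr hϑt)
    exact ENNReal.Tendsto.mul h123 (Or.inr ENNReal.ofReal_ne_top) h4
      (Or.inr (ENNReal.mul_ne_top hϑt ENNReal.ofReal_ne_top))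
  · rw [cutK_of_notMem fun h => hrX (subset_closure h), ENNReal.ofReal_zero, mul_zero]
    refine tendsto_const_nhds.congr' ?_
    filter_upwards [hy (isClosed_closure.isOpen_compl.mem_nhds hrX)] with i hi
    rw [cutK_of_notMem fun h => hi (subset_closure h), ENNReal.ofReal_zero, mul_zero]

theorem single_integrand_le (hR : 0 < R) (hreg : Regular R V (cutSigma X V σ) (cutK X V k) M)
    {x₀ e : Space n} {δ : ℝ} {ϑ : ℝ × Space n → ℝ≥0∞} (hϑ1 : ∀ a, ϑ a ≤ 1) (y w v : Space n) :
    (Iio δ).indicator 1 (nearDist x₀ e (y, v)) * ϑ (nearParam x₀ e (y, v), v) *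
        ENNReal.ofReal (outAtt R (cutSigma X V σ) (y, v)) * ENNReal.ofReal (cutK X V k y w v) ≤
      ENNReal.ofReal M := by
  have h3 : ENNReal.ofReal (outAtt R (cutSigma X V σ) (y, v)) ≤ 1 :=
    ENNReal.ofReal_le_one.2 (hreg.outAtt_le_one hR _)
  calc _ ≤ 1 * 1 * 1 * ENNReal.ofReal M := by
        gcongr
        · exact indicator_one_le _ _
        · exact hϑ1 _
        · exact hreg.k_le _ _ _
    _ = _ := by simp

/-- The weight of an incoming line depends continuously on the line. -/
theorem tendsto_singleWeight (hn : 3 ≤ n) (hR : 0 < R) (hX : IsOpen X) (hc : Convex ℝ X)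
    (h : ContinuousIn X V σ k) (hreg : Regular R V (cutSigma X V σ) (cutK X V k) M)
    {x₀ v₀ : Space n} (hv₀ : v₀ ∈ V.carrier) (hline : ∃ t : ℝ, x₀ + t • dir v₀ ∈ X)
    {Z : Set (Space n)} (hZ : MeasurableSet Z) {N : ℝ} (hZN : Z ⊆ closedBall 0 N)
    {δ : ℝ} (hδ : 0 < δ) {ϑ : ℝ × Space n → ℝ≥0∞} (hϑ : Measurable ϑ) (hϑ1 : ∀ a, ϑ a ≤ 1)
    (hϑc : ∀ v ∈ V.carrier, ∀ r : ℝ, x₀ + r • dir v₀ ∈ X → ContinuousAt (fun t => ϑ (t, v)) r) :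
    Tendsto (singleWeight R V (cutSigma X V σ) (cutK X V k)
        (testWeight x₀ (dir v₀) Z δ ϑ)) (𝓝[univ ×ˢ V.carrier] (x₀, v₀))
      (𝓝 (singleFlux R V (cutSigma X V σ) (cutK X V k) x₀ v₀ Z ϑ)) := by
  set l := 𝓝[univ ×ˢ V.carrier] (x₀, v₀)
  have hx : Tendsto (fun q : Space n × Space n => q.1) l (𝓝 x₀) :=
    (continuous_fst.tendsto (x₀, v₀)).mono_left nhdsWithin_le_nhds
  have hw : Tendsto (fun q : Space n × Space n => q.2) l (𝓝[V.carrier] v₀) := by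
    refine tendsto_nhdsWithin_iff.2
      ⟨(continuous_snd.tendsto (x₀, v₀)).mono_left nhdsWithin_le_nhds, ?_⟩
    filter_upwards [self_mem_nhdsWithin] with q hq using hq.2
  have hv0 := enorm_ne_zero_of_mem hv₀
  have hdir0 : dir v₀ ≠ 0 := by
    rw [← norm_ne_zero_iff, norm_dir (VelocityDomain.ne_zero hv₀)]
    exact one_ne_zero
  have hZfin : V.measure Z < ∞ :=
    (measure_mono hZN).trans_lt (V.measure_closedBall_lt_top N)
  have : IsFiniteMeasure (V.measure.restrict Z) := ⟨by simpa using hZfin⟩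
  have hy : ∀ r : ℝ, Tendsto (fun q : Space n × Space n => q.1 + r • dir q.2) l
      (𝓝 (x₀ + r • dir v₀)) := fun r =>
    hx.add (tendsto_const_nhds.smul (tendsto_dir hv₀ hw))
  have hfr := ae_line_notMem_frontier hX hc hline
  have hout := (hreg.measurable_outAtt hR).ennreal_ofReal
  have hWm := measurable_testWeight x₀ (dir v₀) hZ δ hϑ
  have hΦ : Measurable fun p => testWeight x₀ (dir v₀) Z δ ϑ (shift R (foot p)) *
      ENNReal.ofReal (outAtt R (cutSigma X V σ) p) :=
    (hWm.comp ((measurable_shift R).comp measurable_foot)).mul hout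
  have hmeas := (hreg.measurable_inAtt hR).ennreal_ofReal.mul (hreg.measurable_weighted_k hΦ)
  have hinner : ∀ (q : Space n × Space n) (r : ℝ),
      ∫⁻ v, testWeight x₀ (dir v₀) Z δ ϑ (shift R (foot ((alongLine (q, r)).1, v))) *
        ENNReal.ofReal (outAtt R (cutSigma X V σ) ((alongLine (q, r)).1, v)) *
          ENNReal.ofReal (cutK X V k (alongLine (q, r)).1 q.2 v) ∂V.measure =
      ∫⁻ v in Z, (Iio δ).indicator 1 (nearDist x₀ (dir v₀) (q.1 + r • dir q.2, v)) *
        ϑ (nearParam x₀ (dir v₀) (q.1 + r • dir q.2, v), v) *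
        ENNReal.ofReal (outAtt R (cutSigma X V σ) (q.1 + r • dir q.2, v)) *
          ENNReal.ofReal (cutK X V k (q.1 + r • dir q.2) q.2 v) ∂V.measure := fun q r =>
    lintegral_testWeight V x₀ (dir v₀) hZ δ ϑ R _ _ _
  refine ENNReal.Tendsto.mul ?_ (Or.inl (by simp)) ?_ (Or.inr (by simpa using hv0))
  · exact (continuous_inv.tendsto _).comp ((continuous_enorm.tendsto _).comp
      (hw.mono_right nhdsWithin_le_nhds))
  refine tendsto_lintegral_of_bounded (C := ENNReal.ofReal M * V.measure Z)
    (ENNReal.mul_ne_top ENNReal.ofReal_ne_top hZfin.ne) (fun q => ?_) (fun q r => ?_)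
    (ae_restrict_of_ae ?_)
  · exact hmeas.comp (measurable_alongLine.comp (measurable_prodMk_left (x := q)))
  · rw [hinner]
    have h1 : ENNReal.ofReal (inAtt R (cutSigma X V σ) (alongLine (q, r))) ≤ 1 :=
      ENNReal.ofReal_le_one.2 (hreg.inAtt_le_one hR _)
    refine (mul_le_of_le_one_left zero_le h1).trans ?_
    refine (lintegral_mono fun v => single_integrand_le hR hreg hϑ1 _ _ v).trans ?_
    rw [setLIntegral_const]
  · filter_upwards [hfr] with r hr
    simp_rw [hinner]
    have hin : Tendsto (fun q : Space n × Space n =>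
        ENNReal.ofReal (inAtt R (cutSigma X V σ) (alongLine (q, r)))) l
        (𝓝 (ENNReal.ofReal (inAtt R (cutSigma X V σ) (x₀ + r • dir v₀, v₀)))) := by
      refine ENNReal.tendsto_ofReal (tendsto_inAtt hX h hreg ?_ hv₀ (hy r) hw)
      refine ae_line_notMem_frontier hX hc ?_
      obtain ⟨t, ht⟩ := hline
      exact ⟨t - r, by rwa [add_assoc, ← add_smul, add_sub_cancel]⟩
    refine ENNReal.Tendsto.mul hin (Or.inr ?_) ?_ (Or.inr ENNReal.ofReal_ne_top)
    · refine ne_top_of_le_ne_top (b := ENNReal.ofReal M * V.measure Z)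
        (ENNReal.mul_ne_top ENNReal.ofReal_ne_top hZfin.ne) ?_
      rw [← setLIntegral_const]
      refine lintegral_mono fun v => ?_
      calc _ ≤ 1 * 1 * ENNReal.ofReal M := by
            gcongr
            · exact hϑ1 _
            · exact ENNReal.ofReal_le_one.2 (hreg.outAtt_le_one hR _)
            · exact hreg.k_le _ _ _
        _ = _ := by simp
    refine tendsto_lintegral_of_bounded (C := ENNReal.ofReal M) ENNReal.ofReal_ne_top
      (fun q => ?_) (fun q v => single_integrand_le hR hreg hϑ1 _ _ v) (ae_restrict_of_ae ?_)
    · have hk : Measurable fun v => cutK X V k (q.1 + r • dir q.2) q.2 v :=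
        hreg.k_measurable.comp (f := fun v => (q.1 + r • dir q.2, q.2, v)) (by fun_prop)
      have hp : Measurable fun v : Space n => (q.1 + r • dir q.2, v) := by fun_prop
      exact ((((measurable_one.indicator measurableSet_Iio).comp
        ((measurable_nearDist x₀ (dir v₀)).comp hp)).mul
          (hϑ.comp (((measurable_nearParam x₀ (dir v₀)).comp hp).prodMk measurable_id))).mul
            (hout.comp hp)).mul hk.ennreal_ofReal
    · filter_upwards [V.ae_notMem_span_pair hn (dir v₀) (dir v₀), V.ae_mem] with v hvs hv
      exact tendsto_single_velocity hX hc h hreg hv₀ hv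
        (perp_ne_zero_of_notMem_span hdir0 (VelocityDomain.ne_zero hv) hvs) hδ hϑ1 hr
        (hϑc v hv r) (hy r) hw

end SingleLimit

/-! ### Stability of the ballistic part -/

/-- The expansion of the albedo operator into the ballistic part and scattered parts. -/
def HasExpansion (R : ℝ) (V : VelocityDomain n) (σ : Space n → Space n → ℝ)
    (k : Space n → Space n → Space n → ℝ) (A : L1In R V →L[ℝ] L1Out R V) (C : ℝ) : Prop :=
  ∀ (g : L1In R V) (g' : Space n × Space n → ℝ), Measurable g' →
    g =ᵐ[fluxMeasure R V (-R)] g' → ∃ u w : Space n × Space n → ℝ,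
    Measurable u ∧ Measurable w ∧
    ∫⁻ p, ‖u p‖ₑ ∂phaseMeasure R V ≤ ENNReal.ofReal (C * ‖g‖) ∧
    w =ᵐ[phaseMeasure R V] opK R V σ k u ∧
    A g =ᵐ[fluxMeasure R V R] (fun p => ballistic R σ g' p - opK R V σ k u p) ∧
    A g =ᵐ[fluxMeasure R V R] (fun p => ballistic R σ g' p -
      opK R V σ k (ballistic R σ g') p + opK R V σ k w p)

/-- After a collision, the velocity distribution has the density `k ≤ M`, so the flux scattered into
a small ball of velocities is proportional to the measure of that ball. -/
theorem Regular.lintegral_ball_opK_le {R M : ℝ} {V : VelocityDomain n}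
    {σ : Space n → Space n → ℝ} {k : Space n → Space n → Space n → ℝ}
    (h : Regular R V σ k M) (hR : 0 < R) {c : ℝ} (hc : 0 < c)
    (hcV : ∀ v ∈ V.carrier, c ≤ ‖v‖) {f : Space n × Space n → ℝ} (hf : Measurable f)
    (v₀ : Space n) (r : ℝ) :
    ∫⁻ p in {p | p.2 ∈ ball v₀ r}, ‖opK R V σ k f p‖ₑ ∂fluxMeasure R V R ≤
      ENNReal.ofReal c⁻¹ * (ENNReal.ofReal M * V.measure (ball v₀ r)) *
        ∫⁻ p, ‖f p‖ₑ ∂phaseMeasure R V := by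
  have hB : MeasurableSet {p : Space n × Space n | p.2 ∈ ball v₀ r} :=
    measurable_snd measurableSet_ball
  have h1 := h.lintegral_flux_opK_le hR hf
    (W := {p : Space n × Space n | p.2 ∈ ball v₀ r}.indicator 1) (measurable_one.indicator hB)
  rw [← lintegral_indicator hB]
  refine le_trans (lintegral_mono fun p => ?_) (h1.trans ?_)
  · by_cases hp : p ∈ {p : Space n × Space n | p.2 ∈ ball v₀ r} <;> simp only [hp,
      indicator_of_mem, indicator_of_notMem, Pi.one_apply, one_mul, le_refl, not_false_eq_true,
      zero_le]
  rw [← lintegral_const_mul _ hf.enorm]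
  refine lintegral_mono_ae ?_
  filter_upwards [ae_phase_mem R V] with p hp
  have h2 : ∫⁻ v, {p : Space n × Space n | p.2 ∈ ball v₀ r}.indicator 1 (shift R (foot (p.1, v))) *
      ENNReal.ofReal (k p.1 p.2 v) ∂V.measure ≤ ENNReal.ofReal M * V.measure (ball v₀ r) := by
    rw [← setLIntegral_const, ← lintegral_indicator measurableSet_ball]
    refine lintegral_mono fun v => ?_
    by_cases hv : v ∈ ball v₀ r
    · rw [indicator_of_mem hv]
      refine (mul_le_of_le_one_left zero_le (indicator_one_le _ _)).trans ?_
      exact ENNReal.ofReal_le_ofReal (h.k_le _ _ _)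
    · rw [indicator_of_notMem (by exact hv), zero_mul]
      exact zero_le
  calc _ ≤ ENNReal.ofReal c⁻¹ * (‖f p‖ₑ * (ENNReal.ofReal M * V.measure (ball v₀ r))) := by
        gcongr
        exact ofReal_inv_norm_le hc hcV hp.1
    _ = _ := by ring

theorem ballistic_exit {R : ℝ} {V : VelocityDomain n} (σ : Space n → Space n → ℝ)
    (g : Space n × Space n → ℝ) {q : Space n × Space n} (hq : q ∈ discBundle R V) :
    ballistic R σ g (shift R q) = inAtt R σ (shift R q) * g (shift (-R) q) := by
  rw [ballistic, foot_shift (VelocityDomain.ne_zero hq.1), foot_eq_self hq]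

theorem lintegral_enorm_sub_le {R : ℝ} {V : VelocityDomain n}
    (A A' : L1In R V →L[ℝ] L1Out R V) {g : L1In R V} (hg : ‖g‖ = 1) :
    ∫⁻ p, ‖A g p - A' g p‖ₑ ∂fluxMeasure R V R ≤ ENNReal.ofReal ‖A - A'‖ := by
  have h1 : ‖(A - A') g‖ ≤ ‖A - A'‖ := by simpa [hg] using (A - A').le_opNorm g
  refine le_trans (le_of_eq ?_) (ENNReal.ofReal_le_ofReal h1)
  rw [L1.norm_def, ENNReal.ofReal_toReal (L1.integrable_coeFn ((A - A') g)).2.ne]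
  refine lintegral_congr_ae ?_
  filter_upwards [Lp.coeFn_sub (A g) (A' g)] with p hp
  rw [sub_apply, hp, Pi.sub_apply]

theorem lintegral_add_three_le {α : Type*} [MeasurableSpace α] {μ : Measure α}
    {f f₁ f₂ f₃ : α → ℝ≥0∞} (h₁ : AEMeasurable f₁ μ) (h₂ : AEMeasurable f₂ μ)
    (h : ∀ᵐ x ∂μ, f x ≤ f₁ x + f₂ x + f₃ x) :
    ∫⁻ x, f x ∂μ ≤ ∫⁻ x, f₁ x ∂μ + ∫⁻ x, f₂ x ∂μ + ∫⁻ x, f₃ x ∂μ := by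
  refine (lintegral_mono_ae h).trans ?_
  rw [lintegral_add_left' (show AEMeasurable (fun x => f₁ x + f₂ x) μ from h₁.add h₂),
    lintegral_add_left' h₁]

section Stability

variable {R M M' C C' : ℝ} {V : VelocityDomain n} {X : Set (Space n)}
  {σ σ' : Space n → Space n → ℝ} {k k' : Space n → Space n → Space n → ℝ}
  {A A' : L1In R V →L[ℝ] L1Out R V} {x₀ v₀ : Space n}

theorem tendsto_inAtt_exit (hX : IsOpen X) (hc : Convex ℝ X) (h : ContinuousIn X V σ k)
    (hreg : Regular R V (cutSigma X V σ) (cutK X V k) M) (hv₀ : v₀ ∈ V.carrier)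
    (hline : ∃ t : ℝ, x₀ + t • dir v₀ ∈ X) :
    Tendsto (fun q : Space n × Space n => inAtt R (cutSigma X V σ) (shift R q))
      (𝓝[univ ×ˢ V.carrier] (x₀, v₀)) (𝓝 (inAtt R (cutSigma X V σ) (shift R (x₀, v₀)))) := by
  set l := 𝓝[univ ×ˢ V.carrier] (x₀, v₀)
  have hx : Tendsto (fun q : Space n × Space n => q.1) l (𝓝 x₀) :=
    (continuous_fst.tendsto (x₀, v₀)).mono_left nhdsWithin_le_nhds
  have hw : Tendsto (fun q : Space n × Space n => q.2) l (𝓝[V.carrier] v₀) := by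
    refine tendsto_nhdsWithin_iff.2
      ⟨(continuous_snd.tendsto (x₀, v₀)).mono_left nhdsWithin_le_nhds, ?_⟩
    filter_upwards [self_mem_nhdsWithin] with q hq using hq.2
  refine tendsto_inAtt hX h hreg (ae_line_notMem_frontier hX hc ?_) hv₀
    (hx.add (tendsto_const_nhds.smul (tendsto_dir hv₀ hw))) hw
  obtain ⟨t, ht⟩ := hline
  exact ⟨t - R, by rwa [add_assoc, ← add_smul, add_sub_cancel]⟩

theorem exists_nhds_of_eventually {P : Space n × Space n → Prop}
    (hP : ∀ᶠ q in 𝓝[univ ×ˢ V.carrier] (x₀, v₀), P q) :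
    ∃ U ∈ 𝓝 (x₀, v₀), ∀ q ∈ U, q.2 ∈ V.carrier → P q := by
  obtain ⟨U, hU, hUP⟩ := mem_nhdsWithin_iff_exists_mem_nhds_inter.1 hP
  exact ⟨U, hU, fun q hq hqV => hUP ⟨hq, trivial, hqV⟩⟩

/-- Incoming data concentrated near `(x₀, v₀)` are tested on a small ball of velocities. The
ballistic difference keeps almost the full gap of the attenuations, while each scattered part costs
at most `ε / 3` by `Regular.lintegral_ball_opK_le`. -/
theorem abs_inAtt_sub_le (hn : 3 ≤ n) (hR : 0 < R) (hX : IsOpen X) (hc : Convex ℝ X)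
    (h : ContinuousIn X V σ k) (h' : ContinuousIn X V σ' k')
    (hreg : Regular R V (cutSigma X V σ) (cutK X V k) M)
    (hreg' : Regular R V (cutSigma X V σ') (cutK X V k') M')
    (hA : HasExpansion R V (cutSigma X V σ) (cutK X V k) A C)
    (hA' : HasExpansion R V (cutSigma X V σ') (cutK X V k') A' C')
    (hp : (x₀, v₀) ∈ discBundle R V) (hline : ∃ t : ℝ, x₀ + t • dir v₀ ∈ X) :
    |inAtt R (cutSigma X V σ) (shift R (x₀, v₀)) - inAtt R (cutSigma X V σ') (shift R (x₀, v₀))|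
      ≤ ‖A - A'‖ := by
  obtain ⟨c, hc0, hcV⟩ := V.exists_le_norm
  set a := fun q => inAtt R (cutSigma X V σ) (shift R q)
  set a' := fun q => inAtt R (cutSigma X V σ') (shift R q)
  change |a (x₀, v₀) - a' (x₀, v₀)| ≤ _
  rw [← ENNReal.ofReal_le_ofReal_iff (norm_nonneg _)]
  refine ENNReal.le_of_forall_pos_le_add fun ε hε _ => ?_
  have hε3 : 0 < (ε : ℝ) / 3 := by positivity
  have ht := ((tendsto_inAtt_exit hX hc h hreg hp.1 hline).sub
    (tendsto_inAtt_exit hX hc h' hreg' hp.1 hline)).abs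
  obtain ⟨U, hU, hUa⟩ := exists_nhds_of_eventually
    (ht.eventually_const_lt (sub_lt_self _ hε3))
  set b := ENNReal.ofReal c⁻¹ * ENNReal.ofReal M * ENNReal.ofReal C with hb
  set b' := ENNReal.ofReal c⁻¹ * ENNReal.ofReal M' * ENNReal.ofReal C' with hb'
  have hbt : b + b' + 1 ≠ ∞ := by finiteness
  obtain ⟨r, hr, hrm⟩ := V.exists_ball_measure_lt hn v₀
    (ENNReal.div_pos (ENNReal.ofReal_pos.2 hε3).ne' hbt)
  have hsmall : ∀ d : ℝ≥0∞, d ≤ b + b' + 1 → d * V.measure (ball v₀ r) ≤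
      ENNReal.ofReal ((ε : ℝ) / 3) := fun d hd => by
    calc d * V.measure (ball v₀ r) ≤ (b + b' + 1) *
          (ENNReal.ofReal ((ε : ℝ) / 3) / (b + b' + 1)) := by gcongr
      _ ≤ _ := ENNReal.mul_div_le
  set B : Set (Space n × Space n) := {p | p.2 ∈ ball v₀ r} with hBdef
  have hBm : MeasurableSet B := measurable_snd measurableSet_ball
  have hBn : B ∈ 𝓝 (x₀, v₀) := continuous_snd.continuousAt.preimage_mem_nhds (ball_mem_nhds _ hr)
  obtain ⟨g, φ, hφm, hφ0, hgφ, hg1, -, hφ1, hφU⟩ := exists_concentrated hR hp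
    (inter_mem hU hBn)
  obtain ⟨u, -, hum, -, huC, -, hAu, -⟩ := hA g φ hφm hgφ
  obtain ⟨u', -, hum', -, huC', -, hAu', -⟩ := hA' g φ hφm hgφ
  rw [hg1, mul_one] at huC huC'
  -- On the support of `φ` the attenuations differ by nearly their gap at `(x₀, v₀)`, and `φ` has
  -- mass one.
  have hlow : ENNReal.ofReal (|a (x₀, v₀) - a' (x₀, v₀)| - ε / 3) ≤
      ∫⁻ p in B, ‖ballistic R (cutSigma X V σ) φ p - ballistic R (cutSigma X V σ') φ p‖ₑ
        ∂fluxMeasure R V R := by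
    have hbm : Measurable fun p => ‖ballistic R (cutSigma X V σ) φ p -
        ballistic R (cutSigma X V σ') φ p‖ₑ :=
      ((hreg.measurable_ballistic hR hφm).sub (hreg'.measurable_ballistic hR hφm)).enorm
    rw [← lintegral_indicator hBm, ← (measurePreserving_shift hR V R (zero_add R)).lintegral_comp
      (hbm.indicator hBm)]
    rw [← mul_one (ENNReal.ofReal _), ← hφ1, ← lintegral_const_mul' _ _ ENNReal.ofReal_ne_top]
    refine lintegral_mono_ae ?_
    filter_upwards [ae_flux_zero_mem hR V] with q hq
    by_cases hqU : q ∈ U ∩ B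
    · rw [indicator_of_mem (show shift R q ∈ B from hqU.2)]
      rw [ballistic_exit _ _ hq, ballistic_exit _ _ hq, ← sub_mul,
        enorm_mul, Real.enorm_of_nonneg (hφ0 _), Real.enorm_eq_ofReal_abs]
      gcongr
      exact (hUa q hqU.1 hq.1).le
    · rw [hφU q hqU, ENNReal.ofReal_zero, mul_zero]
      exact zero_le
  have hup : ∫⁻ p in B, ‖ballistic R (cutSigma X V σ) φ p - ballistic R (cutSigma X V σ') φ p‖ₑ
        ∂fluxMeasure R V R ≤ ENNReal.ofReal ‖A - A'‖ + ENNReal.ofReal ((ε : ℝ) / 3) +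
          ENNReal.ofReal ((ε : ℝ) / 3) := by
    have hle : ∀ᵐ p ∂(fluxMeasure R V R).restrict B,
        ‖ballistic R (cutSigma X V σ) φ p - ballistic R (cutSigma X V σ') φ p‖ₑ ≤
        ‖A g p - A' g p‖ₑ + ‖opK R V (cutSigma X V σ) (cutK X V k) u p‖ₑ +
          ‖opK R V (cutSigma X V σ') (cutK X V k') u' p‖ₑ := by
      filter_upwards [ae_restrict_of_ae hAu, ae_restrict_of_ae hAu'] with p h1 h2
      have : ballistic R (cutSigma X V σ) φ p - ballistic R (cutSigma X V σ') φ p =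
          (A g p - A' g p) + opK R V (cutSigma X V σ) (cutK X V k) u p -
            opK R V (cutSigma X V σ') (cutK X V k') u' p := by
        rw [h1, h2]; ring
      rw [this]
      refine (enorm_sub_le).trans ?_
      gcongr
      exact enorm_add_le _ _
    have hme : AEMeasurable (fun p => ‖A g p - A' g p‖ₑ) (fluxMeasure R V R) :=
      (((Lp.aestronglyMeasurable (A g)).sub (Lp.aestronglyMeasurable (A' g)))).enorm
    refine (lintegral_add_three_le hme.restrict
      (hreg.aestronglyMeasurable_opK hR hum).enorm.restrict hle).trans ?_
    have e1 := hreg.lintegral_ball_opK_le hR hc0 hcV hum v₀ r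
    have e2 := hreg'.lintegral_ball_opK_le hR hc0 hcV hum' v₀ r
    gcongr
    · exact (setLIntegral_le_lintegral _ _).trans (lintegral_enorm_sub_le A A' hg1)
    · refine e1.trans (le_trans ?_ (hsmall b (by rw [add_assoc]; exact le_self_add)))
      calc _ ≤ ENNReal.ofReal c⁻¹ * (ENNReal.ofReal M * V.measure (ball v₀ r)) *
            ENNReal.ofReal C := by gcongr
        _ = _ := by rw [hb]; ring
    · refine e2.trans (le_trans ?_ (hsmall b'
        (by rw [add_comm b, add_assoc]; exact le_self_add)))
      calc _ ≤ ENNReal.ofReal c⁻¹ * (ENNReal.ofReal M' * V.measure (ball v₀ r)) *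
            ENNReal.ofReal C' := by gcongr
        _ = _ := by rw [hb']; ring
  calc ENNReal.ofReal |a (x₀, v₀) - a' (x₀, v₀)| ≤
        ENNReal.ofReal (|a (x₀, v₀) - a' (x₀, v₀)| - ε / 3) + ENNReal.ofReal ((ε : ℝ) / 3) := by
        refine le_trans (le_of_eq ?_) ENNReal.ofReal_add_le
        congr 1; ring
    _ ≤ ENNReal.ofReal ‖A - A'‖ + ENNReal.ofReal ((ε : ℝ) / 3) + ENNReal.ofReal ((ε : ℝ) / 3) +
        ENNReal.ofReal ((ε : ℝ) / 3) := by
        gcongr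
        exact hlow.trans hup
    _ = ENNReal.ofReal ‖A - A'‖ + ε := by
        rw [add_assoc, add_assoc, ← ENNReal.ofReal_add hε3.le hε3.le,
          ← ENNReal.ofReal_add hε3.le (by linarith)]
        congr 1
        rw [show (ε : ℝ) / 3 + (ε / 3 + ε / 3) = ε by ring, ENNReal.ofReal_coe_nnreal]

end Stability

/-! ### Stability of the single scattering part -/

theorem nearSet_mono (x₀ e : Space n) (N : ℝ) {δ δ' : ℝ} (h : δ ≤ δ') :
    nearSet x₀ e N δ ⊆ nearSet x₀ e N δ' := fun _ hp => ⟨hp.1, hp.2.trans_le h⟩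

theorem testWeight_of_notMem (x₀ e : Space n) {Z : Set (Space n)} (δ : ℝ)
    (ϑ : ℝ × Space n → ℝ≥0∞) {p : Space n × Space n} (hp : p.2 ∉ Z) :
    testWeight x₀ e Z δ ϑ p = 0 := by
  rw [testWeight, indicator_of_notMem hp, zero_mul]

theorem testWeight_add_le (x₀ e : Space n) {Z : Set (Space n)} {N : ℝ}
    (hZ : Z ⊆ closedBall 0 N) (δ : ℝ) {ϑ ϑ' : ℝ × Space n → ℝ≥0∞} (h : ∀ a, ϑ a + ϑ' a ≤ 1)
    (p : Space n × Space n) :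
    testWeight x₀ e Z δ ϑ p + testWeight x₀ e Z δ ϑ' p ≤ (nearSet x₀ e N δ).indicator 1 p := by
  by_cases hpZ : p.2 ∈ Z
  · by_cases hpδ : nearDist x₀ e p < δ
    · rw [indicator_of_mem (show p ∈ nearSet x₀ e N δ from ⟨hZ hpZ, hpδ⟩)]
      simpa [testWeight, hpZ, hpδ] using h _
    · simp [testWeight, hpδ]
  · simp [testWeight, hpZ]

/-- This is `(a - b) (x - y) ≤ (a + b) |x - y|`, arranged so that no difference is taken in `[0,
∞]`. It replaces testing against the signed weight `a - b`. -/
theorem weighted_le (a b : ℝ≥0∞) (x y : ℝ) :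
    a * ENNReal.ofReal x + b * ENNReal.ofReal y ≤
      b * ENNReal.ofReal x + a * ENNReal.ofReal y + (a + b) * ‖x - y‖ₑ := by
  have h1 : ∀ x y : ℝ, ENNReal.ofReal x ≤ ENNReal.ofReal y + ‖x - y‖ₑ := fun x y => by
    rw [Real.enorm_eq_ofReal_abs]
    refine le_trans (ENNReal.ofReal_le_ofReal ?_) ENNReal.ofReal_add_le
    linarith [le_abs_self (x - y)]
  calc _ ≤ a * (ENNReal.ofReal y + ‖x - y‖ₑ) + b * (ENNReal.ofReal x + ‖x - y‖ₑ) := by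
        gcongr
        · exact h1 _ _
        · rw [← enorm_neg, neg_sub]; exact h1 _ _
    _ = _ := by ring

theorem lintegral_mul_mem_Icc {α : Type*} [MeasurableSpace α] {μ : Measure α}
    {f s : α → ℝ≥0∞} (hf : Measurable f) (hf1 : ∫⁻ x, f x ∂μ = 1) {F ε : ℝ≥0∞}
    (h : ∀ᵐ x ∂μ, f x ≠ 0 → s x ∈ Icc (F - ε) (F + ε)) :
    F ≤ ∫⁻ x, f x * s x ∂μ + ε ∧ ∫⁻ x, f x * s x ∂μ ≤ F + ε := by
  rw [← tsub_le_iff_right]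
  have hconst : ∀ c : ℝ≥0∞, ∫⁻ x, f x * c ∂μ = c := fun c => by
    rw [lintegral_mul_const _ hf, hf1, one_mul]
  constructor
  · rw [← hconst (F - ε)]
    refine lintegral_mono_ae ?_
    filter_upwards [h] with x hx
    by_cases h0 : f x = 0
    · simp [h0]
    · gcongr
      exact (hx h0).1
  · rw [← hconst (F + ε)]
    refine lintegral_mono_ae ?_
    filter_upwards [h] with x hx
    by_cases h0 : f x = 0
    · simp [h0]
    · gcongr
      exact (hx h0).2

theorem Regular.singleFlux_ne_top {R M : ℝ} {V : VelocityDomain n}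
    {σ : Space n → Space n → ℝ} {k : Space n → Space n → Space n → ℝ}
    (h : Regular R V σ k M) (hR : 0 < R) (x₀ : Space n) {v₀ : Space n} (hv₀ : v₀ ∈ V.carrier)
    (Z : Set (Space n)) {ϑ : ℝ × Space n → ℝ≥0∞} (hϑ : ∀ a, ϑ a ≤ 1) :
    singleFlux R V σ k x₀ v₀ Z ϑ ≠ ∞ := by
  refine ENNReal.mul_ne_top (ENNReal.inv_ne_top.2 (enorm_ne_zero_of_mem hv₀)) ?_
  refine ne_top_of_le_ne_top (b := ENNReal.ofReal M * volume (Ioo (-R) R)) (by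
    rw [Real.volume_Ioo]; finiteness) ?_
  rw [← setLIntegral_const]
  refine lintegral_mono fun r => ?_
  calc _ ≤ 1 * ∫⁻ v in Z, 1 * 1 * ENNReal.ofReal (k (x₀ + r • dir v₀) v₀ v) ∂V.measure := by
        gcongr
        · exact ENNReal.ofReal_le_one.2 (h.inAtt_le_one hR _)
        · exact hϑ _
        · exact ENNReal.ofReal_le_one.2 (h.outAtt_le_one hR _)
    _ ≤ ENNReal.ofReal M := by
        simp only [one_mul]
        exact (setLIntegral_le_lintegral _ _).trans (h.lintegral_k_le _ _)

section SingleStability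

variable {R M M' C C' : ℝ} {V : VelocityDomain n} {X : Set (Space n)}
  {σ σ' : Space n → Space n → ℝ} {k k' : Space n → Space n → Space n → ℝ}
  {A A' : L1In R V →L[ℝ] L1Out R V} {x₀ v₀ : Space n}

/-- The comparison of two weighted fluxes of particles scattered once, for an incoming condition
for which no unscattered particle is seen by the weights. -/
theorem lintegral_weighted_le (hR : 0 < R) (hreg : Regular R V σ k M)
    (hreg' : Regular R V σ' k' M') {g : L1In R V} (hg1 : ‖g‖ = 1)
    {φ w w' : Space n × Space n → ℝ} (hφm : Measurable φ) (hw : Measurable w)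
    (hAw : A g =ᵐ[fluxMeasure R V R] (fun p => ballistic R σ φ p -
      opK R V σ k (ballistic R σ φ) p + opK R V σ k w p))
    (hAw' : A' g =ᵐ[fluxMeasure R V R] (fun p => ballistic R σ' φ p -
      opK R V σ' k' (ballistic R σ' φ) p + opK R V σ' k' w' p))
    {Wp Wm : Space n × Space n → ℝ≥0∞} (hWp : Measurable Wp) (hWm : Measurable Wm)
    {S : Set (Space n × Space n)} (hS : MeasurableSet S)
    (hWS : ∀ p, Wp p + Wm p ≤ S.indicator 1 p)
    (hWφ : ∀ᵐ p ∂fluxMeasure R V R, φ (shift (-R) (foot p)) = 0 ∨ (Wp p = 0 ∧ Wm p = 0)) :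
    ∫⁻ p, Wp p * ENNReal.ofReal (-opK R V σ k (ballistic R σ φ) p) ∂fluxMeasure R V R +
      ∫⁻ p, Wm p * ENNReal.ofReal (-opK R V σ' k' (ballistic R σ' φ) p) ∂fluxMeasure R V R ≤
    ∫⁻ p, Wm p * ENNReal.ofReal (-opK R V σ k (ballistic R σ φ) p) ∂fluxMeasure R V R +
      ∫⁻ p, Wp p * ENNReal.ofReal (-opK R V σ' k' (ballistic R σ' φ) p) ∂fluxMeasure R V R +
      (ENNReal.ofReal ‖A - A'‖ + ∫⁻ p in S, ‖opK R V σ k w p‖ₑ ∂fluxMeasure R V R +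
        ∫⁻ p in S, ‖opK R V σ' k' w' p‖ₑ ∂fluxMeasure R V R) := by
  have hP := (hreg.aestronglyMeasurable_opK hR
    (hreg.measurable_ballistic hR hφm)).aemeasurable.neg.ennreal_ofReal
  have hP' := (hreg'.aestronglyMeasurable_opK hR
    (hreg'.measurable_ballistic hR hφm)).aemeasurable.neg.ennreal_ofReal
  set P := fun p => -opK R V σ k (ballistic R σ φ) p with hPdef
  set P' := fun p => -opK R V σ' k' (ballistic R σ' φ) p with hPdef'
  have hme : AEMeasurable (fun p => ‖A g p - A' g p‖ₑ) (fluxMeasure R V R) :=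
    ((Lp.aestronglyMeasurable (A g)).sub (Lp.aestronglyMeasurable (A' g))).enorm
  have hrem : ∫⁻ p in S, (‖A g p - A' g p‖ₑ + ‖opK R V σ k w p‖ₑ + ‖opK R V σ' k' w' p‖ₑ)
      ∂fluxMeasure R V R ≤ ENNReal.ofReal ‖A - A'‖ +
        ∫⁻ p in S, ‖opK R V σ k w p‖ₑ ∂fluxMeasure R V R +
        ∫⁻ p in S, ‖opK R V σ' k' w' p‖ₑ ∂fluxMeasure R V R := by
    refine (lintegral_add_three_le hme.restrict
      (hreg.aestronglyMeasurable_opK hR hw).enorm.restrict (ae_of_all _ fun _ => le_rfl)).trans ?_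
    gcongr
    exact (setLIntegral_le_lintegral _ _).trans (lintegral_enorm_sub_le A A' hg1)
  rw [← lintegral_add_left' (show AEMeasurable (fun p => Wp p * ENNReal.ofReal (P p)) _ from
    hWp.aemeasurable.mul hP)]
  refine le_trans (lintegral_add_three_le (hWm.aemeasurable.mul hP) (hWp.aemeasurable.mul hP')
    (f₃ := S.indicator fun p => ‖A g p - A' g p‖ₑ + ‖opK R V σ k w p‖ₑ + ‖opK R V σ' k' w' p‖ₑ)
    ?_) (by rw [lintegral_indicator hS]; exact add_le_add le_rfl hrem)
  filter_upwards [hAw, hAw', hWφ] with p h1 h2 h3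
  refine (weighted_le (Wp p) (Wm p) (P p) (P' p)).trans (add_le_add le_rfl ?_)
  rcases h3 with h3 | h3
  · refine (mul_le_mul_left (hWS p) _).trans ?_
    by_cases hpS : p ∈ S
    · rw [indicator_of_mem hpS, indicator_of_mem hpS, Pi.one_apply, one_mul]
      have : P p - P' p = (A g p - A' g p) - opK R V σ k w p + opK R V σ' k' w' p := by
        rw [h1, h2, ballistic, ballistic, h3]
        simp only [hPdef, hPdef']
        ring
      rw [this]
      refine (enorm_add_le _ _).trans ?_
      gcongr
      exact enorm_sub_le
    · rw [indicator_of_notMem hpS, zero_mul]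
      exact zero_le
  · rw [h3.1, h3.2, add_zero, zero_mul]
    exact zero_le

/-- Concentrated data turn the single scattering terms of `lintegral_weighted_le` into averages of
`singleWeight` near `(x₀, v₀)`, which converge to `singleFlux`. The width `δ` is fixed beforehand to
make multiple scattering negligible, and only then are the data concentrated. -/
theorem singleFlux_add_le (hn : 3 ≤ n) (hR : 0 < R) (hX : IsOpen X) (hc : Convex ℝ X)
    (h : ContinuousIn X V σ k) (h' : ContinuousIn X V σ' k')
    (hreg : Regular R V (cutSigma X V σ) (cutK X V k) M)
    (hreg' : Regular R V (cutSigma X V σ') (cutK X V k') M')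
    (hA : HasExpansion R V (cutSigma X V σ) (cutK X V k) A C)
    (hA' : HasExpansion R V (cutSigma X V σ') (cutK X V k') A' C')
    (hp : (x₀, v₀) ∈ discBundle R V) (hline : ∃ t : ℝ, x₀ + t • dir v₀ ∈ X)
    {Z : Set (Space n)} (hZ : MeasurableSet Z) {N : ℝ} (hZN : Z ⊆ closedBall 0 N)
    {r : ℝ} (hr : 0 < r) (hZr : Disjoint Z (ball v₀ r))
    {ϑ ϑ' : ℝ × Space n → ℝ≥0∞} (hϑ : Measurable ϑ) (hϑ' : Measurable ϑ')
    (hle : ∀ a, ϑ a + ϑ' a ≤ 1)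
    (hϑc : ∀ v ∈ V.carrier, ∀ r : ℝ, x₀ + r • dir v₀ ∈ X → ContinuousAt (fun t => ϑ (t, v)) r)
    (hϑc' : ∀ v ∈ V.carrier, ∀ r : ℝ, x₀ + r • dir v₀ ∈ X →
      ContinuousAt (fun t => ϑ' (t, v)) r) :
    singleFlux R V (cutSigma X V σ) (cutK X V k) x₀ v₀ Z ϑ +
        singleFlux R V (cutSigma X V σ') (cutK X V k') x₀ v₀ Z ϑ' ≤
      singleFlux R V (cutSigma X V σ) (cutK X V k) x₀ v₀ Z ϑ' +
        singleFlux R V (cutSigma X V σ') (cutK X V k') x₀ v₀ Z ϑ + ENNReal.ofReal ‖A - A'‖ := by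
  have hϑ1 : ∀ a, ϑ a ≤ 1 := fun a => le_self_add.trans (hle a)
  have hϑ1' : ∀ a, ϑ' a ≤ 1 := fun a => le_add_self.trans (hle a)
  refine ENNReal.le_of_forall_pos_le_add fun ε hε _ => ?_
  -- Four averages are replaced by their limits, each with error `η`, and the two multiple
  -- scattering terms cost `η C` and `η C'`.
  set D := 4 + ENNReal.ofReal C + ENNReal.ofReal C' with hD
  have hDt : D ≠ ∞ := by finiteness
  set η : ℝ≥0∞ := ε / D with hη
  have hη0 : 0 < η := ENNReal.div_pos (by simpa using hε.ne') hDt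
  have hηD : η * D ≤ ε := by rw [mul_comm]; exact ENNReal.mul_div_le
  obtain ⟨δ₁, hδ₁, hrem₁⟩ := hreg.exists_lintegral_nearSet_le hn hR x₀ (dir v₀) N hη0
  obtain ⟨δ₂, hδ₂, hrem₂⟩ := hreg'.exists_lintegral_nearSet_le hn hR x₀ (dir v₀) N hη0
  set δ := min δ₁ δ₂
  have hδ : 0 < δ := lt_min hδ₁ hδ₂
  set W := testWeight x₀ (dir v₀) Z δ ϑ with hW
  set W' := testWeight x₀ (dir v₀) Z δ ϑ' with hW'
  have hWm : Measurable W := measurable_testWeight x₀ (dir v₀) hZ δ hϑ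
  have hWm' : Measurable W' := measurable_testWeight x₀ (dir v₀) hZ δ hϑ'
  have t1 := (ENNReal.tendsto_nhds (hreg.singleFlux_ne_top hR x₀ hp.1 Z hϑ1)).1
    (tendsto_singleWeight hn hR hX hc h hreg hp.1 hline hZ hZN hδ hϑ hϑ1 hϑc) η hη0
  have t2 := (ENNReal.tendsto_nhds (hreg.singleFlux_ne_top hR x₀ hp.1 Z hϑ1')).1
    (tendsto_singleWeight hn hR hX hc h hreg hp.1 hline hZ hZN hδ hϑ' hϑ1' hϑc') η hη0
  have t3 := (ENNReal.tendsto_nhds (hreg'.singleFlux_ne_top hR x₀ hp.1 Z hϑ1)).1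
    (tendsto_singleWeight hn hR hX hc h' hreg' hp.1 hline hZ hZN hδ hϑ hϑ1 hϑc) η hη0
  have t4 := (ENNReal.tendsto_nhds (hreg'.singleFlux_ne_top hR x₀ hp.1 Z hϑ1')).1
    (tendsto_singleWeight hn hR hX hc h' hreg' hp.1 hline hZ hZN hδ hϑ' hϑ1' hϑc') η hη0
  obtain ⟨U, hU, hUs⟩ := exists_nhds_of_eventually ((t1.and t2).and (t3.and t4))
  have hBn : {p : Space n × Space n | p.2 ∈ ball v₀ r} ∈ 𝓝 (x₀, v₀) :=
    continuous_snd.continuousAt.preimage_mem_nhds (ball_mem_nhds _ hr)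
  obtain ⟨g, φ, hφm, hφ0, hgφ, hg1, hφi, hφ1, hφU⟩ := exists_concentrated hR hp
    (inter_mem hU hBn)
  have hφi' : ∫⁻ q, ‖φ q‖ₑ ∂fluxMeasure R V (-R) < ∞ := by rw [hφi]; exact ENNReal.one_lt_top
  obtain ⟨u, w, hum, hwm, huC, hwu, -, hAw⟩ := hA g φ hφm hgφ
  obtain ⟨u', w', hum', hwm', huC', hwu', -, hAw'⟩ := hA' g φ hφm hgφ
  rw [hg1, mul_one] at huC huC'
  -- The set `Z` avoids the ball containing all velocities in the support of `φ`, so the weights see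
  -- no unscattered particle.
  have hWφ : ∀ᵐ p ∂fluxMeasure R V R, φ (shift (-R) (foot p)) = 0 ∨ (W p = 0 ∧ W' p = 0) := by
    refine ae_of_all _ fun p => ?_
    by_cases hpZ : p.2 ∈ Z
    · exact Or.inl (hφU _ fun hq => disjoint_left.1 hZr hpZ hq.2)
    · exact Or.inr ⟨testWeight_of_notMem _ _ _ _ hpZ, testWeight_of_notMem _ _ _ _ hpZ⟩
  have key := lintegral_weighted_le hR hreg hreg' hg1 hφm hwm hAw hAw' hWm hWm'
    (measurableSet_nearSet x₀ (dir v₀) N δ) (testWeight_add_le x₀ (dir v₀) hZN δ hle) hWφ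
  rw [hreg.lintegral_single hR hφm hφ0 hφi' hWm, hreg.lintegral_single hR hφm hφ0 hφi' hWm',
    hreg'.lintegral_single hR hφm hφ0 hφi' hWm,
    hreg'.lintegral_single hR hφm hφ0 hφi' hWm'] at key
  have hφsm : Measurable fun q => ENNReal.ofReal (φ (shift (-R) q)) :=
    (hφm.comp (measurable_shift (-R))).ennreal_ofReal
  have hmemU : ∀ q, ENNReal.ofReal (φ (shift (-R) q)) ≠ 0 → q ∈ U := fun q hq => by
    by_contra hqU
    exact hq (by rw [hφU q fun hh => hqU hh.1, ENNReal.ofReal_zero])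
  have hV := ae_flux_zero_mem hR V
  have e1 := lintegral_mul_mem_Icc hφsm hφ1
    (hV.mono fun q hq h0 => (hUs q (hmemU q h0) hq.1).1.1)
  have e2 := lintegral_mul_mem_Icc hφsm hφ1
    (hV.mono fun q hq h0 => (hUs q (hmemU q h0) hq.1).1.2)
  have e3 := lintegral_mul_mem_Icc hφsm hφ1
    (hV.mono fun q hq h0 => (hUs q (hmemU q h0) hq.1).2.1)
  have e4 := lintegral_mul_mem_Icc hφsm hφ1
    (hV.mono fun q hq h0 => (hUs q (hmemU q h0) hq.1).2.2)
  have r1 : ∫⁻ p in nearSet x₀ (dir v₀) N δ, ‖opK R V (cutSigma X V σ) (cutK X V k) w p‖ₑ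
      ∂fluxMeasure R V R ≤ η * ENNReal.ofReal C :=
    (lintegral_mono_set (nearSet_mono _ _ _ (min_le_left _ _))).trans
      ((hrem₁ u w hum hwm hwu).trans (mul_le_mul_right huC _))
  have r2 : ∫⁻ p in nearSet x₀ (dir v₀) N δ, ‖opK R V (cutSigma X V σ') (cutK X V k') w' p‖ₑ
      ∂fluxMeasure R V R ≤ η * ENNReal.ofReal C' :=
    (lintegral_mono_set (nearSet_mono _ _ _ (min_le_right _ _))).trans
      ((hrem₂ u' w' hum' hwm' hwu').trans (mul_le_mul_right huC' _))
  refine (add_le_add e1.1 e4.1).trans ?_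
  rw [add_add_add_comm]
  refine (add_le_add (key.trans (add_le_add (add_le_add e2.2 e3.2)
    (add_le_add (add_le_add le_rfl r1) r2))) le_rfl).trans ?_
  refine le_trans (le_of_eq ?_) (add_le_add le_rfl hηD)
  rw [hD]
  ring

end SingleStability

/-! ### The weighted difference of the scattering coefficients on a line -/

/-- The attenuation along the broken ray that arrives with velocity `v₀` on the line `x₀ + ℝ v₀`
and leaves this line at the parameter `z.1` with velocity `z.2`. -/
def rayAtt (R : ℝ) (σ : Space n → Space n → ℝ) (x₀ v₀ : Space n) (z : ℝ × Space n) : ℝ :=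
  outAtt R σ (x₀ + z.1 • dir v₀, z.2) * inAtt R σ (x₀ + z.1 • dir v₀, v₀)

/-- The scattering coefficient along the line `x₀ + ℝ v₀`. -/
def lineK (k : Space n → Space n → Space n → ℝ) (x₀ v₀ : Space n) (z : ℝ × Space n) : ℝ :=
  k (x₀ + z.1 • dir v₀) v₀ z.2

theorem rayAtt_pos (R : ℝ) (σ : Space n → Space n → ℝ) (x₀ v₀ : Space n) (z : ℝ × Space n) :
    0 < rayAtt R σ x₀ v₀ z := mul_pos (outAtt_pos _ _ _) (inAtt_pos _ _ _)

namespace Regular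

variable {R M : ℝ} {V : VelocityDomain n} {σ : Space n → Space n → ℝ}
  {k : Space n → Space n → Space n → ℝ}

theorem rayAtt_le_one (h : Regular R V σ k M) (hR : 0 < R) (x₀ v₀ : Space n)
    (z : ℝ × Space n) : rayAtt R σ x₀ v₀ z ≤ 1 :=
  mul_le_one₀ (h.outAtt_le_one hR _) (inAtt_pos _ _ _).le (h.inAtt_le_one hR _)

theorem measurable_rayAtt (h : Regular R V σ k M) (hR : 0 < R) (x₀ v₀ : Space n) :
    Measurable (rayAtt R σ x₀ v₀) := by
  have h1 : Measurable fun z : ℝ × Space n => (x₀ + z.1 • dir v₀, z.2) := by fun_prop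
  have h2 : Measurable fun z : ℝ × Space n => (x₀ + z.1 • dir v₀, v₀) := by fun_prop
  exact ((h.measurable_outAtt hR).comp h1).mul ((h.measurable_inAtt hR).comp h2)

theorem measurable_lineK (h : Regular R V σ k M) (x₀ v₀ : Space n) :
    Measurable (lineK k x₀ v₀) :=
  h.k_measurable.comp (f := fun z : ℝ × Space n => (x₀ + z.1 • dir v₀, v₀, z.2)) (by fun_prop)

theorem singleFlux_eq (h : Regular R V σ k M) (hR : 0 < R) (x₀ v₀ : Space n)
    (Z : Set (Space n)) {ϑ : ℝ × Space n → ℝ≥0∞} (hϑ : Measurable ϑ) :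
    singleFlux R V σ k x₀ v₀ Z ϑ = ‖v₀‖ₑ⁻¹ * ∫⁻ z in Ioo (-R) R ×ˢ Z,
      ϑ z * ENNReal.ofReal (lineK k x₀ v₀ z * rayAtt R σ x₀ v₀ z)
        ∂((volume : Measure ℝ).prod V.measure) := by
  have hm : Measurable fun z => ϑ z *
      ENNReal.ofReal (lineK k x₀ v₀ z * rayAtt R σ x₀ v₀ z) :=
    hϑ.mul ((h.measurable_lineK x₀ v₀).mul (h.measurable_rayAtt hR x₀ v₀)).ennreal_ofReal
  rw [singleFlux, ← Measure.prod_restrict, lintegral_prod _ hm.aemeasurable]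
  congr 1
  refine lintegral_congr fun r => ?_
  rw [← lintegral_const_mul' _ _ ENNReal.ofReal_ne_top]
  refine lintegral_congr fun v => ?_
  rw [rayAtt, lineK, ENNReal.ofReal_mul (h.k_nonneg _ _ _), ENNReal.ofReal_mul (outAtt_pos _ _ _).le]
  ring

end Regular

/-- A continuous approximation of the indicator function of the positive reals. -/
def softSign (η x : ℝ) : ℝ := max x 0 / (|x| + η)

theorem continuous_softSign {η : ℝ} (hη : 0 < η) : Continuous (softSign η) := by
  unfold softSign
  refine (continuous_id.max continuous_const).div (by fun_prop) fun x => ?_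
  positivity

theorem softSign_nonneg {η : ℝ} (hη : 0 < η) (x : ℝ) : 0 ≤ softSign η x :=
  div_nonneg (le_max_right _ _) (by positivity)

theorem softSign_add_softSign_neg (η x : ℝ) :
    softSign η x + softSign η (-x) = |x| / (|x| + η) := by
  rw [softSign, softSign, abs_neg, ← add_div]
  congr 1
  rcases le_total 0 x with h | h
  · rw [max_eq_left h, max_eq_right (by linarith), abs_of_nonneg h, add_zero]
  · rw [max_eq_right h, max_eq_left (by linarith), abs_of_nonpos h, zero_add]

theorem softSign_add_le_one {η : ℝ} (hη : 0 < η) (x : ℝ) :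
    softSign η x + softSign η (-x) ≤ 1 := by
  rw [softSign_add_softSign_neg]
  exact div_le_one_of_le₀ (by linarith) (by positivity)

/-- The difference of the two soft indicators is `x / (|x| + η)`, and `x² / (|x| + η) ≥ |x| - η`. -/
theorem le_softSign_mul {η : ℝ} (hη : 0 < η) (x : ℝ) :
    |x| - η ≤ (softSign η x - softSign η (-x)) * x := by
  have hpos : 0 < |x| + η := by positivity
  have h1 : softSign η x - softSign η (-x) = x / (|x| + η) := by
    rw [softSign, softSign, abs_neg, ← sub_div]
    congr 1
    rcases le_total 0 x with h | h
    · rw [max_eq_left h, max_eq_right (by linarith), sub_zero]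
    · rw [max_eq_right h, max_eq_left (by linarith)]; ring
  rw [h1, div_mul_eq_mul_div, le_div_iff₀ hpos]
  nlinarith [abs_mul_abs_self x]

/-- With `d = s - s'`, one writes `d (K E - K' E') = d (K - K') E + d K' (E - E')`. The first term
is at least `|K - K'| E - η` since `E ≤ 1`, the second at least `-K' |E - E'|` since `|d| ≤ 1`. -/
theorem softSign_weighted_le {η K K' E E' : ℝ} (hη : 0 < η) (hK : 0 ≤ K) (hK' : 0 ≤ K')
    (hE : 0 ≤ E) (hE1 : E ≤ 1) (hE' : 0 ≤ E') :
    ENNReal.ofReal (|K - K'| * E) + (ENNReal.ofReal (softSign η (-(K - K'))) *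
        ENNReal.ofReal (K * E) + ENNReal.ofReal (softSign η (K - K')) * ENNReal.ofReal (K' * E')) ≤
      ENNReal.ofReal (softSign η (K - K')) * ENNReal.ofReal (K * E) +
        ENNReal.ofReal (softSign η (-(K - K'))) * ENNReal.ofReal (K' * E') +
          (ENNReal.ofReal η + ENNReal.ofReal (K' * |E - E'|)) := by
  set s := softSign η (K - K') with hs
  set s' := softSign η (-(K - K')) with hs'
  have h0 : 0 ≤ s := softSign_nonneg hη _
  have h0' : 0 ≤ s' := softSign_nonneg hη _
  have h1 : s + s' ≤ 1 := softSign_add_le_one hη _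
  have h2 := le_softSign_mul hη (K - K')
  rw [← hs, ← hs'] at h2
  have h3 : -(K' * |E - E'|) ≤ (s - s') * (K' * (E - E')) := by
    have : |(s - s') * (K' * (E - E'))| ≤ 1 * (K' * |E - E'|) := by
      rw [abs_mul, abs_mul, abs_of_nonneg hK']
      gcongr
      rw [abs_le]
      constructor <;> linarith
    rw [one_mul] at this
    exact (abs_le.1 this).1
  have h4 : |K - K'| * E + (s' * (K * E) + s * (K' * E')) ≤
      s * (K * E) + s' * (K' * E') + (η + K' * |E - E'|) := by
    have h5 := mul_le_mul_of_nonneg_right h2 hE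
    nlinarith
  have hKE := mul_nonneg hK hE
  have hKE' := mul_nonneg hK' hE'
  have hKd := mul_nonneg hK' (abs_nonneg (E - E'))
  rw [← ENNReal.ofReal_mul h0, ← ENNReal.ofReal_mul h0, ← ENNReal.ofReal_mul h0',
    ← ENNReal.ofReal_mul h0', ← ENNReal.ofReal_add (by positivity) (by positivity),
    ← ENNReal.ofReal_add (by positivity) (by positivity),
    ← ENNReal.ofReal_add (by positivity) (by positivity),
    ← ENNReal.ofReal_add (by positivity) (by positivity),
    ← ENNReal.ofReal_add (by positivity) (by positivity)]
  exact ENNReal.ofReal_le_ofReal h4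

section LineStability

variable {R M M' C C' : ℝ} {V : VelocityDomain n} {X : Set (Space n)}
  {σ σ' : Space n → Space n → ℝ} {k k' : Space n → Space n → Space n → ℝ}
  {A A' : L1In R V →L[ℝ] L1Out R V} {x₀ v₀ : Space n}

theorem continuousAt_lineK (hX : IsOpen X) (h : ContinuousIn X V σ k) (hv₀ : v₀ ∈ V.carrier)
    {v : Space n} (hv : v ∈ V.carrier) {r : ℝ} (hr : x₀ + r • dir v₀ ∈ X) :
    ContinuousAt (fun t => lineK (cutK X V k) x₀ v₀ (t, v)) r := by
  refine tendsto_cutK (y := fun t : ℝ => x₀ + t • dir v₀) (w := fun _ => v₀) hX h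
    (fun hf => hf.2 (by rwa [hX.interior_eq])) hv₀ hv ?_
    (tendsto_nhdsWithin_iff.2 ⟨tendsto_const_nhds, Eventually.of_forall fun _ => hv₀⟩)
  exact (by fun_prop : Continuous fun t : ℝ => x₀ + t • dir v₀).tendsto r

theorem lintegral_lineK_sub_bounded_le (hn : 3 ≤ n) (hR : 0 < R) (hX : IsOpen X)
    (hc : Convex ℝ X) (h : ContinuousIn X V σ k) (h' : ContinuousIn X V σ' k')
    (hreg : Regular R V (cutSigma X V σ) (cutK X V k) M)
    (hreg' : Regular R V (cutSigma X V σ') (cutK X V k') M')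
    (hA : HasExpansion R V (cutSigma X V σ) (cutK X V k) A C)
    (hA' : HasExpansion R V (cutSigma X V σ') (cutK X V k') A' C')
    (hp : (x₀, v₀) ∈ discBundle R V) (hline : ∃ t : ℝ, x₀ + t • dir v₀ ∈ X)
    {Z : Set (Space n)} (hZ : MeasurableSet Z) {N : ℝ} (hZN : Z ⊆ closedBall 0 N)
    {r : ℝ} (hr : 0 < r) (hZr : Disjoint Z (ball v₀ r)) :
    ‖v₀‖ₑ⁻¹ * ∫⁻ z in Ioo (-R) R ×ˢ Z, ENNReal.ofReal
        (|lineK (cutK X V k) x₀ v₀ z - lineK (cutK X V k') x₀ v₀ z| *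
          rayAtt R (cutSigma X V σ) x₀ v₀ z) ∂((volume : Measure ℝ).prod V.measure) ≤
      ‖v₀‖ₑ⁻¹ * ∫⁻ z in Ioo (-R) R ×ˢ Z, ENNReal.ofReal (lineK (cutK X V k') x₀ v₀ z *
          |rayAtt R (cutSigma X V σ) x₀ v₀ z - rayAtt R (cutSigma X V σ') x₀ v₀ z|)
            ∂((volume : Measure ℝ).prod V.measure) + ENNReal.ofReal ‖A - A'‖ := by
  set ρ := ((volume : Measure ℝ).prod V.measure).restrict (Ioo (-R) R ×ˢ Z) with hρ
  set c := ‖v₀‖ₑ⁻¹ with hcdef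
  have hct : c ≠ ∞ := ENNReal.inv_ne_top.2 (enorm_ne_zero_of_mem hp.1)
  set K := lineK (cutK X V k) x₀ v₀
  set K' := lineK (cutK X V k') x₀ v₀
  set E := rayAtt R (cutSigma X V σ) x₀ v₀
  set E' := rayAtt R (cutSigma X V σ') x₀ v₀
  have hK : Measurable K := hreg.measurable_lineK x₀ v₀
  have hK' : Measurable K' := hreg'.measurable_lineK x₀ v₀
  have hE : Measurable E := hreg.measurable_rayAtt hR x₀ v₀
  have hE' : Measurable E' := hreg'.measurable_rayAtt hR x₀ v₀
  have hρt : c * ρ univ ≠ ∞ := by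
    refine ENNReal.mul_ne_top hct ?_
    rw [hρ, Measure.restrict_apply_univ, Measure.prod_prod, Real.volume_Ioo]
    exact ENNReal.mul_ne_top ENNReal.ofReal_ne_top
      ((measure_mono hZN).trans_lt (V.measure_closedBall_lt_top N)).ne
  refine ENNReal.le_of_forall_pos_le_add fun ε hε _ => ?_
  -- The smoothing error is `η` times the finite mass of `c ρ`; the `1` in the denominator covers
  -- the case of zero mass.
  obtain ⟨η, hη, hηε⟩ : ∃ η : ℝ, 0 < η ∧ c * ρ univ * ENNReal.ofReal η ≤ ε := by
    have hpos : 0 < (c * ρ univ).toReal + 1 := by positivity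
    refine ⟨ε / ((c * ρ univ).toReal + 1), by positivity, ?_⟩
    nth_rw 1 [← ENNReal.ofReal_toReal hρt]
    rw [← ENNReal.ofReal_mul ENNReal.toReal_nonneg, ← ENNReal.ofReal_coe_nnreal]
    refine ENNReal.ofReal_le_ofReal ?_
    rw [← mul_div_assoc, div_le_iff₀ hpos]
    nlinarith [ε.coe_nonneg]
  -- These soft indicators of `k > k'` and `k < k'` must be continuous in the position, because the
  -- test evaluates them at the nearest point of the fixed line, which only approximates the
  -- collision point.
  set ϑ : ℝ × Space n → ℝ≥0∞ := fun z => ENNReal.ofReal (softSign η (K z - K' z)) with hϑdef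
  set ϑ' : ℝ × Space n → ℝ≥0∞ := fun z => ENNReal.ofReal (softSign η (-(K z - K' z))) with hϑdef'
  have hss := continuous_softSign hη
  have hϑ : Measurable ϑ := (hss.measurable.comp (hK.sub hK')).ennreal_ofReal
  have hϑ' : Measurable ϑ' := (hss.measurable.comp (hK.sub hK').neg).ennreal_ofReal
  have hle : ∀ a, ϑ a + ϑ' a ≤ 1 := fun a => by
    rw [hϑdef, hϑdef', ← ENNReal.ofReal_add (softSign_nonneg hη _) (softSign_nonneg hη _)]
    exact ENNReal.ofReal_le_one.2 (softSign_add_le_one hη _)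
  have hϑ1 : ∀ a, ϑ a ≤ 1 := fun a => le_self_add.trans (hle a)
  have hϑ1' : ∀ a, ϑ' a ≤ 1 := fun a => le_add_self.trans (hle a)
  have hcK : ∀ v ∈ V.carrier, ∀ r : ℝ, x₀ + r • dir v₀ ∈ X →
      ContinuousAt (fun t => K (t, v) - K' (t, v)) r := fun v hv r hr =>
    (continuousAt_lineK hX h hp.1 hv hr).sub (continuousAt_lineK hX h' hp.1 hv hr)
  have key := singleFlux_add_le hn hR hX hc h h' hreg hreg' hA hA' hp hline hZ hZN hr hZr hϑ hϑ'
    hle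
    (fun v hv r hr => (ENNReal.continuous_ofReal.comp hss).continuousAt.comp (hcK v hv r hr))
    (fun v hv r hr => (ENNReal.continuous_ofReal.comp hss).continuousAt.comp (hcK v hv r hr).neg)
  have hfin : singleFlux R V (cutSigma X V σ) (cutK X V k) x₀ v₀ Z ϑ' +
      singleFlux R V (cutSigma X V σ') (cutK X V k') x₀ v₀ Z ϑ ≠ ∞ :=
    ENNReal.add_ne_top.2 ⟨hreg.singleFlux_ne_top hR x₀ hp.1 Z hϑ1',
      hreg'.singleFlux_ne_top hR x₀ hp.1 Z hϑ1⟩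
  have h_int : (c * ∫⁻ z, ENNReal.ofReal (|K z - K' z| * E z) ∂ρ) +
      (singleFlux R V (cutSigma X V σ) (cutK X V k) x₀ v₀ Z ϑ' +
        singleFlux R V (cutSigma X V σ') (cutK X V k') x₀ v₀ Z ϑ) ≤
      (singleFlux R V (cutSigma X V σ) (cutK X V k) x₀ v₀ Z ϑ +
        singleFlux R V (cutSigma X V σ') (cutK X V k') x₀ v₀ Z ϑ') +
      (c * ρ univ * ENNReal.ofReal η +
        c * ∫⁻ z, ENNReal.ofReal (K' z * |E z - E' z|) ∂ρ) := by
    have f1 : singleFlux R V (cutSigma X V σ) (cutK X V k) x₀ v₀ Z ϑ =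
        c * ∫⁻ z, ϑ z * ENNReal.ofReal (K z * E z) ∂ρ := hreg.singleFlux_eq hR x₀ v₀ Z hϑ
    have f2 : singleFlux R V (cutSigma X V σ) (cutK X V k) x₀ v₀ Z ϑ' =
        c * ∫⁻ z, ϑ' z * ENNReal.ofReal (K z * E z) ∂ρ := hreg.singleFlux_eq hR x₀ v₀ Z hϑ'
    have f3 : singleFlux R V (cutSigma X V σ') (cutK X V k') x₀ v₀ Z ϑ =
        c * ∫⁻ z, ϑ z * ENNReal.ofReal (K' z * E' z) ∂ρ := hreg'.singleFlux_eq hR x₀ v₀ Z hϑ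
    have f4 : singleFlux R V (cutSigma X V σ') (cutK X V k') x₀ v₀ Z ϑ' =
        c * ∫⁻ z, ϑ' z * ENNReal.ofReal (K' z * E' z) ∂ρ := hreg'.singleFlux_eq hR x₀ v₀ Z hϑ'
    rw [f1, f2, f3, f4, mul_assoc c, mul_comm (ρ univ), ← lintegral_const]
    simp only [← mul_add]
    refine mul_le_mul_right ?_ _
    have m1 : Measurable fun z => ϑ' z * ENNReal.ofReal (K z * E z) :=
      hϑ'.mul (hK.mul hE).ennreal_ofReal
    have m2 : Measurable fun z => ENNReal.ofReal (|K z - K' z| * E z) :=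
      ((hK.sub hK').abs.mul hE).ennreal_ofReal
    have m3 : Measurable fun z => ϑ z * ENNReal.ofReal (K z * E z) :=
      hϑ.mul (hK.mul hE).ennreal_ofReal
    have m4 : Measurable fun z => ϑ' z * ENNReal.ofReal (K' z * E' z) :=
      hϑ'.mul (hK'.mul hE').ennreal_ofReal
    have m5 : Measurable fun z => ϑ z * ENNReal.ofReal (K z * E z) +
      ϑ' z * ENNReal.ofReal (K' z * E' z) := m3.add m4
    rw [← lintegral_add_left m1, ← lintegral_add_left m2, ← lintegral_add_left m3,
      ← lintegral_add_left measurable_const, ← lintegral_add_left m5]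
    refine lintegral_mono fun z => ?_
    exact softSign_weighted_le hη (hreg.k_nonneg _ _ _) (hreg'.k_nonneg _ _ _)
      (rayAtt_pos _ _ _ _ _).le (hreg.rayAtt_le_one hR _ _ _) (rayAtt_pos _ _ _ _ _).le
  -- The crossed fluxes occur on both sides and may be cancelled because they are finite.
  refine (ENNReal.add_le_add_iff_right hfin).1 ?_
  refine h_int.trans ((add_le_add key (add_le_add hηε le_rfl)).trans (le_of_eq ?_))
  ring

/-- The sets `closedBall 0 N \ ball v₀ (1 / (N + 1))` increase to all velocities except the null set
`{v₀}`. Monotone convergence removes the restrictions, since the bound contains `‖A - A'‖` only once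
for each `N`. -/
theorem lintegral_lineK_sub_le (hn : 3 ≤ n) (hR : 0 < R) (hX : IsOpen X)
    (hc : Convex ℝ X) (h : ContinuousIn X V σ k) (h' : ContinuousIn X V σ' k')
    (hreg : Regular R V (cutSigma X V σ) (cutK X V k) M)
    (hreg' : Regular R V (cutSigma X V σ') (cutK X V k') M')
    (hA : HasExpansion R V (cutSigma X V σ) (cutK X V k) A C)
    (hA' : HasExpansion R V (cutSigma X V σ') (cutK X V k') A' C')
    (hp : (x₀, v₀) ∈ discBundle R V) (hline : ∃ t : ℝ, x₀ + t • dir v₀ ∈ X) :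
    ‖v₀‖ₑ⁻¹ * ∫⁻ z, ENNReal.ofReal
        (|lineK (cutK X V k) x₀ v₀ z - lineK (cutK X V k') x₀ v₀ z| *
          rayAtt R (cutSigma X V σ) x₀ v₀ z)
            ∂((volume : Measure ℝ).restrict (Ioo (-R) R)).prod V.measure ≤
      ‖v₀‖ₑ⁻¹ * ∫⁻ z, ENNReal.ofReal (lineK (cutK X V k') x₀ v₀ z *
          |rayAtt R (cutSigma X V σ) x₀ v₀ z - rayAtt R (cutSigma X V σ') x₀ v₀ z|)
            ∂((volume : Measure ℝ).restrict (Ioo (-R) R)).prod V.measure +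
        ENNReal.ofReal ‖A - A'‖ := by
  set ρ := ((volume : Measure ℝ).restrict (Ioo (-R) R)).prod V.measure with hρ
  let Z : ℕ → Set (Space n) := fun N => closedBall 0 N \ ball v₀ (1 / ((N : ℝ) + 1))
  have hZm : ∀ N, MeasurableSet (Z N) := fun N => measurableSet_closedBall.diff measurableSet_ball
  have hρZ : ∀ N, ρ.restrict (univ ×ˢ Z N) =
      ((volume : Measure ℝ).prod V.measure).restrict (Ioo (-R) R ×ˢ Z N) := fun N => by
    rw [hρ, ← Measure.prod_restrict, Measure.restrict_univ, Measure.prod_restrict]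
  have hmono : Monotone fun N => (univ : Set ℝ) ×ˢ Z N := by
    intro N L hNL
    have hNL' : (N : ℝ) ≤ L := by exact_mod_cast hNL
    refine prod_mono le_rfl (sdiff_subset_sdiff (closedBall_subset_closedBall hNL') ?_)
    exact ball_subset_ball (one_div_le_one_div_of_le (by positivity) (by linarith))
  have hcover : ∀ᵐ z ∂ρ, z ∈ ⋃ N, (univ : Set ℝ) ×ˢ Z N := by
    have hne : ∀ᵐ v ∂V.measure, v ≠ v₀ := by
      rw [ae_iff]
      simpa using V.measure_singleton_eq_zero hn v₀
    filter_upwards [Measure.quasiMeasurePreserving_snd.ae hne] with z hz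
    obtain ⟨N₁, hN₁⟩ := exists_nat_ge ‖z.2‖
    obtain ⟨N₂, hN₂⟩ := exists_nat_one_div_lt (dist_pos.2 hz)
    refine mem_iUnion.2 ⟨max N₁ N₂, trivial, ?_, ?_⟩
    · rw [mem_closedBall_zero_iff]
      exact hN₁.trans (by exact_mod_cast le_max_left _ _)
    · rw [mem_ball, not_lt]
      refine le_trans (one_div_le_one_div_of_le (by positivity) ?_) hN₂.le
      gcongr
      exact le_max_right _ _
  conv_lhs => rw [← Measure.restrict_eq_self_of_ae_mem hcover]
  rw [setLIntegral_iUnion_of_directed _ hmono.directed_le, ENNReal.mul_iSup]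
  refine iSup_le fun N => ?_
  have hb := lintegral_lineK_sub_bounded_le hn hR hX hc h h' hreg hreg' hA hA' hp hline (hZm N)
    (N := N) sdiff_subset (r := 1 / ((N : ℝ) + 1)) (by positivity) disjoint_sdiff_left
  rw [← hρZ] at hb
  refine hb.trans ?_
  gcongr
  exact Measure.restrict_le_self

end LineStability

/-! ### Broken rays -/

section BrokenRay

variable {R M M' : ℝ} {V : VelocityDomain n} {X : Set (Space n)}
  {σ σ' : Space n → Space n → ℝ} {k k' : Space n → Space n → Space n → ℝ}

theorem perp_mem_discBundle {y v : Space n} (hy : ‖y‖ < R) (hv : v ∈ V.carrier) :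
    (perp v y, v) ∈ discBundle R V := by
  have hv0 := VelocityDomain.ne_zero hv
  refine ⟨hv, ?_, (norm_perp_le hv0 y).trans_lt hy⟩
  have := inner_perp_dir hv0 y
  rw [dir, inner_smul_right] at this
  simpa [hv0] using this

/-- The parameters `(perp v y, -⟪y, v̂⟫)` describe the broken ray with its corner at `y`. The
reflection `s ↦ -s` turns its first integral into the path from `y` to the exit; the second is the
path from the entrance to `y`. -/
theorem Regular.brokenRay_eq (h : Regular R V σ k M) {y v v₀ : Space n} (hy : ‖y‖ < R)
    (hv : v ∈ V.carrier) (hv₀ : v₀ ∈ V.carrier) :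
    brokenRay R σ (perp v y) (-⟪y, dir v⟫) v v₀ = outAtt R σ (y, v) * inAtt R σ (y, v₀) := by
  have hmem : ∀ {w : Space n}, w ∈ V.carrier → ⟪y, dir w⟫ ∈ Icc (-R) R := fun hw =>
    abs_le.1 ((abs_inner_dir_le (VelocityDomain.ne_zero hw) y).trans hy.le)
  have hal : ∀ w : Space n, alongLine ((perp w y, w), ⟪y, dir w⟫) = (y, w) := fun w => by
    simp only [alongLine, perp_add_inner_smul]
  have h1 := h.outAtt_alongLine (perp_mem_discBundle hy hv) (hmem hv)
  have h2 := h.inAtt_alongLine (perp_mem_discBundle hy hv₀) (hmem hv₀)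
  rw [hal] at h1 h2
  have hy1 : perp v y - (-⟪y, dir v⟫) • dir v = y := by
    rw [neg_smul, sub_neg_eq_add, perp_add_inner_smul]
  have h3 := intervalIntegral.integral_comp_neg (a := -R) (b := -⟪y, dir v⟫)
    (fun s => σ (perp v y + s • dir v) v)
  simp only [neg_neg, neg_smul, ← sub_eq_add_neg] at h3
  have h4 := integral_backward (fun z => σ z v₀) (perp v₀ y) (dir v₀) ⟪y, dir v₀⟫
    (R + ⟪y, dir v₀⟫)
  rw [perp_add_inner_smul, show ⟪y, dir v₀⟫ - (R + ⟪y, dir v₀⟫) = -R by ring] at h4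
  rw [brokenRay, hy1, h1, h2, h3, h4, sub_eq_add_neg, Real.exp_add]

theorem brokenRay_cut (hX : IsOpen X) (hc : Convex ℝ X) (h : ContinuousIn X V σ k)
    {y v v₀ : Space n} (hy : y ∈ X) (hv : v ∈ V.carrier) (hv₀ : v₀ ∈ V.carrier) :
    brokenRay R (cutSigma X V σ) (perp v y) (-⟪y, dir v⟫) v v₀ =
      brokenRay R σ (perp v y) (-⟪y, dir v⟫) v v₀ := by
  have hy1 : perp v y - (-⟪y, dir v⟫) • dir v = y := by
    rw [neg_smul, sub_neg_eq_add, perp_add_inner_smul]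
  rw [brokenRay, brokenRay, hy1]
  congr 2
  · congr 2
    refine intervalIntegral.integral_congr_ae ?_
    filter_upwards [ae_backward (ae_line_notMem_frontier hX hc (x := perp v y) (e := dir v)
      ⟨⟪y, dir v⟫, by rwa [perp_add_inner_smul]⟩)] with s hs _
    exact cutSigma_eq hX h hs hv
  · congr 1
    refine intervalIntegral.integral_congr_ae ?_
    filter_upwards [ae_backward (ae_line_notMem_frontier hX hc (x := y) (e := dir v₀)
      ⟨0, by simpa using hy⟩)] with s hs _
    exact cutSigma_eq hX h hs hv₀

theorem rayAtt_cut (hX : IsOpen X) (hc : Convex ℝ X) (hXR : closure X ⊆ ball 0 R)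
    (h : ContinuousIn X V σ k) (hreg : Regular R V (cutSigma X V σ) (cutK X V k) M)
    {x₀ v₀ : Space n} (hv₀ : v₀ ∈ V.carrier) {t : ℝ} (ht : x₀ + t • dir v₀ ∈ X)
    {v : Space n} (hv : v ∈ V.carrier) :
    rayAtt R (cutSigma X V σ) x₀ v₀ (t, v) =
      brokenRay R σ (perp v (x₀ + t • dir v₀)) (-⟪x₀ + t • dir v₀, dir v⟫) v v₀ := by
  have hlt : ‖x₀ + t • dir v₀‖ < R := by simpa using hXR (subset_closure ht)
  rw [← brokenRay_cut hX hc h ht hv hv₀, hreg.brokenRay_eq hlt hv hv₀, rayAtt]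

theorem lintegral_cutK_eq (hX : IsOpen X) (h : ContinuousIn X V σ k)
    (hreg : Regular R V (cutSigma X V σ) (cutK X V k) M) {y v₀ : Space n}
    (hy : y ∉ frontier X) (hv₀ : v₀ ∈ V.carrier) :
    ∫⁻ v, ENNReal.ofReal (cutK X V k y v₀ v) ∂V.measure = ‖sigmaP V k y v₀‖ₑ := by
  have hm : Measurable fun v => cutK X V k y v₀ v :=
    hreg.k_measurable.comp (f := fun v => (y, v₀, v)) (by fun_prop)
  have hi : Integrable (fun v => cutK X V k y v₀ v) V.measure := by
    refine ⟨hm.aestronglyMeasurable, ?_⟩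
    rw [hasFiniteIntegral_iff_ofReal (ae_of_all _ fun v => hreg.k_nonneg _ _ _)]
    exact (hreg.lintegral_k_le y v₀).trans_lt ENNReal.ofReal_lt_top
  rw [← ofReal_integral_eq_lintegral_ofReal hi (ae_of_all _ fun v => hreg.k_nonneg _ _ _),
    ← Real.enorm_of_nonneg (integral_nonneg fun v => hreg.k_nonneg _ _ _), sigmaP]
  congr 1
  refine integral_congr_ae ?_
  filter_upwards [V.ae_mem] with v hv
  exact cutK_eq hX h hy hv₀ hv

theorem lintegral_brokenRay_eq (hR : 0 < R) (hX : IsOpen X) (hc : Convex ℝ X)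
    (hXR : closure X ⊆ ball 0 R) (h : ContinuousIn X V σ k) (h' : ContinuousIn X V σ' k')
    (hreg : Regular R V (cutSigma X V σ) (cutK X V k) M)
    (hreg' : Regular R V (cutSigma X V σ') (cutK X V k') M')
    {x₀ v₀ : Space n} (hv₀ : v₀ ∈ V.carrier) (hline : ∃ t : ℝ, x₀ + t • dir v₀ ∈ X) :
    ∫⁻ v, (∫⁻ t in Ioo (-R) R, ENNReal.ofReal
        (|k (x₀ + t • dir v₀) v₀ v - k' (x₀ + t • dir v₀) v₀ v| *
          brokenRay R σ (perp v (x₀ + t • dir v₀)) (-⟪x₀ + t • dir v₀, dir v⟫) v v₀)) ∂V.measure =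
      ∫⁻ z, ENNReal.ofReal (|lineK (cutK X V k) x₀ v₀ z - lineK (cutK X V k') x₀ v₀ z| *
        rayAtt R (cutSigma X V σ) x₀ v₀ z)
          ∂((volume : Measure ℝ).restrict (Ioo (-R) R)).prod V.measure := by
  have hm : Measurable fun z => ENNReal.ofReal
      (|lineK (cutK X V k) x₀ v₀ z - lineK (cutK X V k') x₀ v₀ z| *
        rayAtt R (cutSigma X V σ) x₀ v₀ z) :=
    (((hreg.measurable_lineK x₀ v₀).sub (hreg'.measurable_lineK x₀ v₀)).abs.mul
      (hreg.measurable_rayAtt hR x₀ v₀)).ennreal_ofReal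
  rw [lintegral_prod_symm' _ hm]
  refine lintegral_congr_ae ?_
  filter_upwards [V.ae_mem] with v hv
  refine lintegral_congr_ae (ae_restrict_of_ae ?_)
  filter_upwards [ae_line_notMem_frontier hX hc hline] with t ht
  simp only [lineK]
  rw [cutK_eq hX h ht hv₀ hv, cutK_eq hX h' ht hv₀ hv]
  rcases mem_or_notMem_closure hX ht with hX' | hX'
  · rw [rayAtt_cut hX hc hXR h hreg hv₀ hX' hv]
  · rw [h.k_zero _ hX' _ hv₀ _ hv, h'.k_zero _ hX' _ hv₀ _ hv]
    simp

/-- At a point of `X` the attenuation difference is one of the values under the supremum, and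
outside the closure `k'` vanishes. The integral of `k'` over `v` is `σ_p`, and the integral over `t`
contributes the length `2 R`. -/
theorem lintegral_lineK_mul_le (hR : 0 < R) (hX : IsOpen X) (hc : Convex ℝ X)
    (hXR : closure X ⊆ ball 0 R) (h : ContinuousIn X V σ k) (h' : ContinuousIn X V σ' k')
    (hreg : Regular R V (cutSigma X V σ) (cutK X V k) M)
    (hreg' : Regular R V (cutSigma X V σ') (cutK X V k') M')
    {x₀ v₀ : Space n} (hv₀ : v₀ ∈ V.carrier) (hline : ∃ t : ℝ, x₀ + t • dir v₀ ∈ X) :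
    ∫⁻ z, ENNReal.ofReal (lineK (cutK X V k') x₀ v₀ z *
        |rayAtt R (cutSigma X V σ) x₀ v₀ z - rayAtt R (cutSigma X V σ') x₀ v₀ z|)
          ∂((volume : Measure ℝ).restrict (Ioo (-R) R)).prod V.measure ≤
      ENNReal.ofReal (2 * R) *
        (eLpNormEssSup (fun t : ℝ => sigmaP V k' (x₀ + t • dir v₀) v₀) volume *
        ⨆ p ∈ discBundle R V, ⨆ t : ℝ,
          ENNReal.ofReal |brokenRay R σ p.1 t p.2 v₀ - brokenRay R σ' p.1 t p.2 v₀|) := by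
  set D := ⨆ p ∈ discBundle R V, ⨆ t : ℝ,
    ENNReal.ofReal |brokenRay R σ p.1 t p.2 v₀ - brokenRay R σ' p.1 t p.2 v₀| with hD
  have hm : Measurable fun z => ENNReal.ofReal (lineK (cutK X V k') x₀ v₀ z *
      |rayAtt R (cutSigma X V σ) x₀ v₀ z - rayAtt R (cutSigma X V σ') x₀ v₀ z|) :=
    ((hreg'.measurable_lineK x₀ v₀).mul ((hreg.measurable_rayAtt hR x₀ v₀).sub
      (hreg'.measurable_rayAtt hR x₀ v₀)).abs).ennreal_ofReal
  have hvol : ENNReal.ofReal (2 * R) = volume (Ioo (-R) R) := by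
    rw [Real.volume_Ioo]; congr 1; ring
  rw [lintegral_prod _ hm.aemeasurable, mul_comm, hvol, ← setLIntegral_const]
  refine lintegral_mono_ae (ae_restrict_of_ae ?_)
  filter_upwards [ae_line_notMem_frontier hX hc hline,
    ae_le_eLpNormEssSup (f := fun t : ℝ => sigmaP V k' (x₀ + t • dir v₀) v₀)] with t ht hsup
  have hkm : Measurable fun v => ENNReal.ofReal (cutK X V k' (x₀ + t • dir v₀) v₀ v) :=
    (hreg'.k_measurable.comp (f := fun v => (x₀ + t • dir v₀, v₀, v))
      (by fun_prop)).ennreal_ofReal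
  refine le_trans ?_ (mul_le_mul_left hsup D)
  rw [← lintegral_cutK_eq hX h' hreg' ht hv₀, ← lintegral_mul_const _ hkm]
  refine lintegral_mono_ae ?_
  filter_upwards [V.ae_mem] with v hv
  rw [lineK, ENNReal.ofReal_mul (hreg'.k_nonneg _ _ _)]
  rcases mem_or_notMem_closure hX ht with hX' | hX'
  · refine mul_le_mul_right ?_ _
    rw [rayAtt_cut hX hc hXR h hreg hv₀ hX' hv, rayAtt_cut hX hc hXR h' hreg' hv₀ hX' hv]
    have hlt : ‖x₀ + t • dir v₀‖ < R := by simpa using hXR (subset_closure hX')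
    exact le_iSup₂_of_le (perp v (x₀ + t • dir v₀), v) (perp_mem_discBundle hlt hv)
      (le_iSup_of_le (-⟪x₀ + t • dir v₀, dir v⟫) le_rfl)
  · rw [cutK_of_notMem fun hx => hX' (subset_closure hx)]
    simp

theorem inAtt_cut_exit (hR : 0 < R) (hX : IsOpen X) (hc : Convex ℝ X)
    (h : ContinuousIn X V σ k) (hreg : Regular R V (cutSigma X V σ) (cutK X V k) M)
    {x₀ v₀ : Space n} (hp : (x₀, v₀) ∈ discBundle R V)
    (hline : ∃ t : ℝ, x₀ + t • dir v₀ ∈ X) :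
    inAtt R (cutSigma X V σ) (shift R (x₀, v₀)) =
      Real.exp (-(‖v₀‖⁻¹ * ∫ s in (-R)..R, σ (x₀ - s • dir v₀) v₀)) := by
  rw [← alongLine_eq_shift, hreg.inAtt_alongLine hp ⟨by linarith, le_rfl⟩]
  have h1 := intervalIntegral.integral_comp_neg (a := -R) (b := R)
    (fun s => σ (x₀ + s • dir v₀) v₀)
  simp only [neg_neg, neg_smul, ← sub_eq_add_neg] at h1
  rw [h1]
  congr 3
  refine intervalIntegral.integral_congr_ae ?_
  filter_upwards [ae_line_notMem_frontier hX hc hline] with s hs _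
  exact cutSigma_eq hX h hs hp.1

/-- Existence and uniqueness hold for the given coefficients, whereas the expansion of the same
operator is recorded with the restricted ones, for which all bounds hold pointwise. -/
theorem exists_unique_albedo (hR : 0 < R) (hX : IsOpen X) (hc : Convex ℝ X)
    (h : ContinuousIn X V σ k) (hs : Subcritical R V σ k)
    (hreg : Regular R V (cutSigma X V σ) (cutK X V k) M) :
    ∃ A : L1In R V →L[ℝ] L1Out R V, IsAlbedo R V σ k A ∧ (∀ A', IsAlbedo R V σ k A' → A' = A) ∧
      ∃ C : ℝ, HasExpansion R V (cutSigma X V σ) (cutK X V k) A C := by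
  obtain ⟨A, hA, huniq, C, -, hC⟩ := hreg.exists_albedo hR (subcritical_cut hX hc h hs)
  exact ⟨A, (isAlbedo_cut hX hc h A).1 hA, fun A' hA' =>
    huniq A' ((isAlbedo_cut hX hc h A').2 hA'), C, hC⟩

end BrokenRay

end Transport

end

open MeasureTheory Set Transport in
open scoped ENNReal RealInnerProductSpace in
theorem theorem3p1 (n : ℕ) (hn : 3 ≤ n) (R : ℝ) (hR : 0 < R) (V : VelocityDomain n)
    (X : Set (Space n)) (hX_open : IsOpen X) (hX_convex : Convex ℝ X)
    (hX_C1 : HasC1Boundary X) (hX_ball : closure X ⊆ Metric.ball 0 R)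
    (σ σ' : Space n → Space n → ℝ) (k k' : Space n → Space n → Space n → ℝ)
    (hadm : Admissible R V σ k) (hsub : Subcritical R V σ k) (hcont : ContinuousIn X V σ k)
    (hadm' : Admissible R V σ' k') (hsub' : Subcritical R V σ' k')
    (hcont' : ContinuousIn X V σ' k') :
    (∃! A : L1In R V →L[ℝ] L1Out R V, IsAlbedo R V σ k A) ∧
    (∃! A' : L1In R V →L[ℝ] L1Out R V, IsAlbedo R V σ' k' A') ∧
    ∀ A A' : L1In R V →L[ℝ] L1Out R V, IsAlbedo R V σ k A → IsAlbedo R V σ' k' A' →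
      ∀ x₀ v₀ : Space n, (x₀, v₀) ∈ discBundle R V → (∃ t : ℝ, x₀ + t • v₀ ∈ X) →
        |Real.exp (-(‖v₀‖⁻¹ * ∫ s in (-R)..R, σ (x₀ - s • dir v₀) v₀)) -
            Real.exp (-(‖v₀‖⁻¹ * ∫ s in (-R)..R, σ' (x₀ - s • dir v₀) v₀))| ≤ ‖A - A'‖ ∧
        ENNReal.ofReal ‖v₀‖⁻¹ *
            ∫⁻ v, (∫⁻ t' in Ioo (-R) R,
              ENNReal.ofReal (|k (x₀ + t' • dir v₀) v₀ v - k' (x₀ + t' • dir v₀) v₀ v| *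
                brokenRay R σ (perp v (x₀ + t' • dir v₀)) (-⟪x₀ + t' • dir v₀, dir v⟫) v v₀))
              ∂V.measure
          ≤ ENNReal.ofReal (2 * R * ‖v₀‖⁻¹) *
              eLpNormEssSup (fun t' : ℝ => sigmaP V k' (x₀ + t' • dir v₀) v₀) volume *
              (⨆ p ∈ discBundle R V, ⨆ t : ℝ,
                ENNReal.ofReal |brokenRay R σ p.1 t p.2 v₀ - brokenRay R σ' p.1 t p.2 v₀|) +
            ENNReal.ofReal ‖A - A'‖ := by
  obtain ⟨M, hreg⟩ := exists_regular hX_open hX_ball hadm hcont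
  obtain ⟨M', hreg'⟩ := exists_regular hX_open hX_ball hadm' hcont'
  obtain ⟨B, hB, hBu, C, hC⟩ := exists_unique_albedo hR hX_open hX_convex hcont hsub hreg
  obtain ⟨B', hB', hBu', C', hC'⟩ := exists_unique_albedo hR hX_open hX_convex hcont' hsub' hreg'
  refine ⟨⟨B, hB, hBu⟩, ⟨B', hB', hBu'⟩, fun A A' hA hA' x₀ v₀ hp ht => ?_⟩
  obtain rfl := hBu A hA
  obtain rfl := hBu' A' hA'
  have hv₀ : v₀ ∈ V.carrier := hp.1
  have hv0 : ‖v₀‖ ≠ 0 := norm_ne_zero_iff.2 (VelocityDomain.ne_zero hv₀)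
  -- The line is given with direction `v₀`, while all estimates parametrize it by arc length.
  have hline : ∃ t : ℝ, x₀ + t • dir v₀ ∈ X := by
    obtain ⟨t, ht⟩ := ht
    exact ⟨t * ‖v₀‖, by rwa [dir, smul_smul, mul_assoc, mul_inv_cancel₀ hv0, mul_one]⟩
  constructor
  · rw [← inAtt_cut_exit hR hX_open hX_convex hcont hreg hp hline,
      ← inAtt_cut_exit hR hX_open hX_convex hcont' hreg' hp hline]
    exact abs_inAtt_sub_le hn hR hX_open hX_convex hcont hcont' hreg hreg' hC hC' hp hline
  · have hinv : ENNReal.ofReal ‖v₀‖⁻¹ = ‖v₀‖ₑ⁻¹ := by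
      rw [ENNReal.ofReal_inv_of_pos (by positivity), ofReal_norm]
    rw [lintegral_brokenRay_eq hR hX_open hX_convex hX_ball hcont hcont' hreg hreg' hv₀ hline,
      mul_comm (2 * R), ENNReal.ofReal_mul (by positivity), hinv]
    refine (lintegral_lineK_sub_le hn hR hX_open hX_convex hcont hcont' hreg hreg' hC hC' hp
      hline).trans ?_
    rw [mul_assoc, mul_assoc]
    gcongr
    exact lintegral_lineK_mul_le hR hX_open hX_convex hX_ball hcont hcont' hreg hreg' hv₀ hline
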